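/- Let $1\le r\le q$ be integers and let $\alpha_1\ge\cdots\ge\alpha_r\ge 0$ be real numbers with $\alpha_i\le (q+r-2i-1)/2$ for $i=1,\ldots,r$. For $\Theta\in\mathbb R^{r\times q}$ let $\lambda_1\ge\cdots\ge\lambda_r\ge 0$ be the eigenvalues of $\Theta\Theta^\top$, and put $\pi_{ST}(\Theta)=\prod_{i=1}^r\lambda_i^{-\alpha_i/2}$ (its values on the Lebesgue-null set of matrices of rank less than $r$ are immaterial; by convention a factor $0^{-a}$ with $a>0$ is set to $0$ there). (1) $\pi_{ST}$ is superharmonic, that is: (a) $\pi_{ST}$ is twice continuously differentiable near every $\Theta$ for which $\lambda_1>\cdots>\lambda_r>0$, and at every $\Theta$ near which it is twice continuously differentiable, $$\sum_{i=1}^r\sum_{j=1}^q\frac{\partial^2\pi_{ST}}{\partial\theta_{ij}^2}(\Theta)\le 0;$$ (b) $\pi_{ST}$ is locally integrable and superharmonic on all of $\mathbb R^{r\times q}$ in the sense of distributions: $\int\pi_{ST}(\Theta)\,\Delta g(\Theta)\,d\Theta\le 0$ for every nonnegative $g\in C_c^\infty(\mathbb R^{r\times q})$, where $\Delta=\sum_{i,j}\partial^2/\partial\theta_{ij}^2$.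 (2) Let $v_x,v_y>0$ be known and let $X\sim N_{r\times q}(\Theta,v_xI_r\otimes I_q)$ and $Y\sim N_{r\times q}(\Theta,v_yI_r\otimes I_q)$ be independent with densities $p(X\mid\Theta)$ and $p(Y\mid\Theta)$. Then $m(X)=\int p(X\mid\Theta)\,\pi_{ST}(\Theta)\,d\Theta$ is finite for every $X$, and the Bayesian predictive density $$\hat p(Y\mid X)=\frac{1}{m(X)}\int p(X\mid\Theta)\,p(Y\mid\Theta)\,\pi_{ST}(\Theta)\,d\Theta$$ is minimax under Kullback–Leibler loss: with $$R(\Theta,\hat\varphi)=\iint p(X\mid\Theta)\,p(Y\mid\Theta)\log\frac{p(Y\mid\Theta)}{\hat\varphi(Y\mid X)}\,dY\,dX\in[0,\infty],$$ one has $\sup_\Theta R(\Theta,\hat p)\le\sup_\Theta R(\Theta,\hat\varphi)$ for every predictive density $\hat\varphi$, i.e. every jointly measurable $\hat\varphi\ge 0$ with $\int\hat\varphi(Y\mid X)\,dY=1$ for all $X$; and $\hat p$ is itself such a predictive density. -/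

import Mathlib

noncomputable section

namespace MatrixPrediction

open MeasureTheory
open scoped ENNReal

/-- Real `r × q` matrices, carrying the Frobenius norm and the Lebesgue measure on their entries. -/
abbrev Mat (r q : ℕ) : Type := EuclideanSpace ℝ (Fin r × Fin q)

variable {r q : ℕ}

/-- The element of `Mat r q`, seen as a matrix. -/
def toMatrix (Θ : Mat r q) : Matrix (Fin r) (Fin q) ℝ := Matrix.of fun i j => Θ (i, j)

/-- `eig Θ 0 ≥ eig Θ 1 ≥ …` are the eigenvalues of `Θ Θᵀ` in decreasing order, with multiplicity
(for real matrices `ᴴ` is the transpose). -/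
def eig (Θ : Mat r q) (i : Fin r) : ℝ :=
  (Matrix.isHermitian_mul_conjTranspose_self (toMatrix Θ)).eigenvalues₀
    (Fin.cast (Fintype.card_fin r).symm i)

theorem eig_antitone (Θ : Mat r q) : Antitone (eig Θ) := fun _ _ h =>
  Matrix.IsHermitian.eigenvalues₀_antitone _ h

/-- The prior density `∏ i, λ i ^ (-α i / 2)`. (On the Lebesgue-null set of matrices of rank less
than `r`, where a power of zero with a negative exponent would be `+∞`, Lean's real power gives
`0`.) -/
def priorST (α : Fin r → ℝ) (Θ : Mat r q) : ℝ := ∏ i, eig Θ i ^ (-(α i) / 2)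

/-- Density at `X` of the matrix normal distribution with mean `Θ` and covariance `v I_r ⊗ I_q`. -/
def normalDensity (v : ℝ) (Θ X : Mat r q) : ℝ :=
  (2 * Real.pi * v) ^ (-((r : ℝ) * (q : ℝ)) / 2) * Real.exp (-‖X - Θ‖ ^ 2 / (2 * v))

/-- The marginal density `m_π(X; v)` of `X` under the prior density `prior`. -/
def marginal (prior : Mat r q → ℝ) (v : ℝ) (X : Mat r q) : ℝ :=
  ∫ Θ, normalDensity v Θ X * prior Θ

/-- The Bayesian predictive density `p_π(X, Y) / m_π(X; vx)` of `Y` given `X`. -/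
def bayesPredictive (prior : Mat r q → ℝ) (vx vy : ℝ) (X Y : Mat r q) : ℝ :=
  (∫ Θ, normalDensity vx Θ X * normalDensity vy Θ Y * prior Θ) / marginal prior vx X

/-- A predictive density: for each observation `X`, a probability density `p X` in `Y`. -/
structure IsPredictiveDensity (p : Mat r q → Mat r q → ℝ) : Prop where
  measurable : Measurable (Function.uncurry p)
  nonneg : ∀ X Y, 0 ≤ p X Y
  lintegral_eq_one : ∀ X, ∫⁻ Y, ENNReal.ofReal (p X Y) = 1

open scoped Classical in
/-- The Kullback-Leibler loss `∫ p(Y|Θ) log (p(Y|Θ) / f Y) dY` of the probability density `f`.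
The integral always exists in `[0, ∞]` when `f` is a probability density; it is `∞` when `f`
vanishes on a set of positive measure or the integrand is not integrable. -/
def klLoss (vy : ℝ) (Θ : Mat r q) (f : Mat r q → ℝ) : ℝ≥0∞ :=
  if (∀ᵐ Y, 0 < f Y) ∧
      Integrable (fun Y => normalDensity vy Θ Y * Real.log (normalDensity vy Θ Y / f Y)) then
    ENNReal.ofReal (∫ Y, normalDensity vy Θ Y * Real.log (normalDensity vy Θ Y / f Y))
  else ∞

/-- The Kullback-Leibler risk: the expected loss under `X ∼ N(Θ, vx I_r ⊗ I_q)`. -/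
def klRisk (vx vy : ℝ) (Θ : Mat r q) (p : Mat r q → Mat r q → ℝ) : ℝ≥0∞ :=
  ∫⁻ X, ENNReal.ofReal (normalDensity vx Θ X) * klLoss vy Θ (p X)

/-- `p` is a predictive density whose maximal risk is the smallest possible. -/
def IsMinimax (vx vy : ℝ) (p : Mat r q → Mat r q → ℝ) : Prop :=
  IsPredictiveDensity p ∧
    ∀ p' : Mat r q → Mat r q → ℝ, IsPredictiveDensity p' →
      (⨆ Θ, klRisk vx vy Θ p) ≤ (⨆ Θ, klRisk vx vy Θ p')

/-- `∑ i, ∑ j, ∂² f / ∂ θ i j ²`. -/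
def laplacian (f : Mat r q → ℝ) (Θ : Mat r q) : ℝ :=
  ∑ i : Fin r, ∑ j : Fin q,
    iteratedFDeriv ℝ 2 f Θ
      ![EuclideanSpace.single (i, j) (1 : ℝ), EuclideanSpace.single (i, j) (1 : ℝ)]

/-- Superharmonicity on the whole matrix space in the sense of distributions. -/
def IsDistribSuperharmonic (f : Mat r q → ℝ) : Prop :=
  LocallyIntegrable f ∧
    ∀ g : Mat r q → ℝ, ContDiff ℝ (⊤ : ℕ∞) g → HasCompactSupport g → (∀ Θ, 0 ≤ g Θ) →
      (∫ Θ, f Θ * laplacian g Θ) ≤ 0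

end MatrixPrediction

end

/-! Everything is proved for the bounded continuous regularization `regPrior ε`, the product of (λ_i
+ ε)^(-α_i/2), and then transferred to `priorST` as ε decreases to 0; the regularizations increase
because α ≥ 0.

Two facts about `regPrior ε` carry the superharmonicity. The first is pointwise. Where the λ_i are
positive and distinct, which is almost everywhere, the prior is C² and its Laplacian can be summed
over the orthonormal basis u_i v_jᵀ built from singular vectors. Along each such line the
eigenvalues are explicit or solve a quadratic equation. With d = q - r, nonpositivity then reduces
to α_i (α_i + 1 - d) ≤ 2 ∑_{l>i} (α_i - α_l), which follows from the bounds on α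
(`exponent_inequality`, `HasSimpleSpectrum.laplacian_regPrior_nonpos`).

The second is global. The exceptional null set could still carry a positive singular part of the
distributional Laplacian. This is excluded by semiconcavity, uniform in Θ
(`exists_regPrior_semiconcave`). As α decreases, ∑ α_i log (λ_i + ε) is a nonnegative combination of
the sums of the k largest terms. By interlacing, each such sum is at least the log-determinant of
the compression to any k-frame, with equality at the base point for its own eigenvectors. So
`regPrior ε` lies below a smooth function touching it at the base point, with uniformly controlled
second-order behaviour.

Semiconcavity bounds symmetric difference quotients from above, so dominated convergence applies to
their positive parts and only the a.e. Laplacian matters. This gives both the distributional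
inequality and the decrease of Gaussian averages in the variance
(`IsSemiconcaveSuperharmonic.heat_antitone`). In the limit, the marginals of `priorST` are finite
and decrease with the variance.

For minimaxity the common benchmark is (rq/2) log ((vy + vx)/vy), the constant risk of the
predictive density N(X, vx + vy) of the uniform prior. No maximal risk is smaller, by comparison
with the Bayes rules of the priors N(0, s) as s → ∞ (`le_iSup_klRisk`). The Bayes rule of `priorST`
never exceeds it: log x ≤ x - 1 reduces the claim to E[m(X; vx) / m(W; vw)] ≤ 1, where W is the
precision-weighted mean of X and Y and vw its variance. Conditionally on W, averaging m(X; vx) only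
increases the variance beyond vw, so monotonicity of the marginals suffices
(`IsHeatDecreasing.lintegral_marginal_ratio_le`). -/

noncomputable section

namespace MatrixPrediction

open MeasureTheory
open scoped ENNReal

variable {r q : ℕ}

/-! ### Eigenvalues of the Gram matrix: min-max, continuity, determinants. -/

open Matrix in
/-- The linear combination `∑ i, x i • Θ i` of the rows of `Θ`. -/
def rowComb (Θ : Mat r q) (x : EuclideanSpace ℝ (Fin r)) : EuclideanSpace ℝ (Fin q) :=
  WithLp.toLp 2 (fun j => ∑ i, x i * Θ (i, j))

@[simp] theorem rowComb_apply (Θ : Mat r q) (x : EuclideanSpace ℝ (Fin r)) (j : Fin q) :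
    rowComb Θ x j = ∑ i, x i * Θ (i, j) := rfl

/-- The symmetric operator `Θ Θᵀ` on `ℝʳ`. -/
def gramOp (Θ : Mat r q) : EuclideanSpace ℝ (Fin r) →ₗ[ℝ] EuclideanSpace ℝ (Fin r) :=
  Matrix.toEuclideanLin (toMatrix Θ * (toMatrix Θ).conjTranspose)

theorem gramOp_isSymmetric (Θ : Mat r q) : (gramOp Θ).IsSymmetric :=
  Matrix.isSymmetric_toEuclideanLin_iff.mpr (Matrix.isHermitian_mul_conjTranspose_self (toMatrix Θ))

theorem gramOp_apply (Θ : Mat r q) (x : EuclideanSpace ℝ (Fin r)) (i : Fin r) :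
    gramOp Θ x i = ∑ j, Θ (i, j) * rowComb Θ x j := by
  simp only [gramOp, Matrix.toLpLin_apply, ← Matrix.mulVec_mulVec]
  simp [Matrix.mulVec, dotProduct, toMatrix, mul_comm]

theorem inner_gramOp (Θ : Mat r q) (x y : EuclideanSpace ℝ (Fin r)) :
    inner ℝ (gramOp Θ x) y = inner ℝ (rowComb Θ x) (rowComb Θ y) := by
  simp only [PiLp.inner_apply, RCLike.inner_apply, conj_trivial, gramOp_apply]
  simp_rw [Finset.mul_sum, rowComb_apply Θ y, Finset.sum_mul]
  rw [Finset.sum_comm]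
  exact Finset.sum_congr rfl fun j _ => Finset.sum_congr rfl fun i _ => by ring

/-- An orthonormal basis of eigenvectors of `Θ Θᵀ`, in the order of the eigenvalues. -/
def eigBasis (Θ : Mat r q) : OrthonormalBasis (Fin r) ℝ (EuclideanSpace ℝ (Fin r)) :=
  ((gramOp_isSymmetric Θ).eigenvectorBasis finrank_euclideanSpace).reindex
    (finCongr (Fintype.card_fin r))

theorem gramOp_eigBasis (Θ : Mat r q) (i : Fin r) :
    gramOp Θ (eigBasis Θ i) = eig Θ i • eigBasis Θ i := by
  have := (gramOp_isSymmetric Θ).apply_eigenvectorBasis finrank_euclideanSpace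
    (Fin.cast (Fintype.card_fin r).symm i)
  simp only [eigBasis, OrthonormalBasis.reindex_apply]
  exact this

theorem inner_gramOp_eigBasis (Θ : Mat r q) (x : EuclideanSpace ℝ (Fin r)) (i : Fin r) :
    inner ℝ (eigBasis Θ i) (gramOp Θ x) = eig Θ i * inner ℝ (eigBasis Θ i) x := by
  rw [← gramOp_isSymmetric, gramOp_eigBasis, inner_smul_left]; simp

theorem norm_rowComb_sq (Θ : Mat r q) (x : EuclideanSpace ℝ (Fin r)) :
    ‖rowComb Θ x‖ ^ 2 = ∑ i, eig Θ i * inner ℝ (eigBasis Θ i) x ^ 2 := by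
  rw [← real_inner_self_eq_norm_sq, ← inner_gramOp, ← (eigBasis Θ).sum_inner_mul_inner]
  refine Finset.sum_congr rfl fun i _ => ?_
  rw [real_inner_comm, inner_gramOp_eigBasis]; ring

theorem eig_eq_norm_sq (Θ : Mat r q) (i : Fin r) : eig Θ i = ‖rowComb Θ (eigBasis Θ i)‖ ^ 2 := by
  rw [← real_inner_self_eq_norm_sq, ← inner_gramOp, gramOp_eigBasis, inner_smul_left]
  simp

theorem eig_nonneg (Θ : Mat r q) (i : Fin r) : 0 ≤ eig Θ i := by
  rw [eig_eq_norm_sq]; positivity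

theorem exists_eig_eq (Θ : Mat r q) {μ : ℝ} {v : EuclideanSpace ℝ (Fin r)} (hv : v ≠ 0)
    (h : gramOp Θ v = μ • v) : ∃ i, eig Θ i = μ := by
  by_contra! hne
  refine hv (norm_eq_zero.mp (sq_eq_zero_iff.mp ?_))
  rw [← (eigBasis Θ).sum_sq_inner_right]
  refine Finset.sum_eq_zero fun i _ => ?_
  have := inner_gramOp_eigBasis Θ v i
  rw [h, inner_smul_right] at this
  simpa [sub_eq_zero, hne i] using (by linarith : (eig Θ i - μ) * inner ℝ (eigBasis Θ i) v = 0)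

theorem norm_rowComb_le (Θ : Mat r q) (x : EuclideanSpace ℝ (Fin r)) :
    ‖rowComb Θ x‖ ≤ ‖Θ‖ * ‖x‖ := by
  refine abs_le_of_sq_le_sq' ?_ (by positivity) |>.2
  rw [mul_pow, EuclideanSpace.real_norm_sq_eq, EuclideanSpace.real_norm_sq_eq,
    EuclideanSpace.real_norm_sq_eq, Fintype.sum_prod_type_right, Finset.sum_mul]
  refine Finset.sum_le_sum fun j _ => ?_
  rw [mul_comm, rowComb_apply]
  exact Finset.sum_mul_sq_le_sq_mul_sq Finset.univ (fun i => x i) (fun i => Θ (i, j))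

theorem rowComb_sub_left (Θ Θ' : Mat r q) (x : EuclideanSpace ℝ (Fin r)) :
    rowComb (Θ - Θ') x = rowComb Θ x - rowComb Θ' x := by
  ext j; simp [mul_sub, Finset.sum_sub_distrib]

/-- The Courant–Fischer dimension count: the span of the top i + 1 eigenvectors on one side contains
a nonzero vector whose image is orthogonal to the top i on the other. With `V` the identity this is
a Weyl-type perturbation bound; with δ = 0 it is Cauchy interlacing. -/
theorem eig_le_eig_add {k q' : ℕ} (Θ : Mat r q) (Θ' : Mat k q')
    (V : EuclideanSpace ℝ (Fin k) →ₗᵢ[ℝ] EuclideanSpace ℝ (Fin r)) (δ : ℝ)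
    (h : ∀ x, ‖rowComb Θ' x‖ ^ 2 ≤ ‖rowComb Θ (V x)‖ ^ 2 + δ * ‖x‖ ^ 2)
    (i : Fin k) (j : Fin r) (hij : i.val = j.val) : eig Θ' i ≤ eig Θ j + δ := by
  let emb : Fin (i + 1) → Fin k := Fin.castLE i.2
  let W : (Fin (i + 1) → ℝ) →ₗ[ℝ] EuclideanSpace ℝ (Fin k) :=
    Fintype.linearCombination ℝ (fun m => eigBasis Θ' (emb m))
  have hW : ∀ a m, inner ℝ (eigBasis Θ' m) (W a) = if hm : m ≤ i then a ⟨m, Nat.lt_succ_of_le hm⟩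
      else 0 := by
    intro a m
    simp only [W, Fintype.linearCombination_apply, inner_sum, inner_smul_right,
      orthonormal_iff_ite.mp (eigBasis Θ').orthonormal]
    split_ifs with hm
    · rw [Finset.sum_eq_single ⟨m, Nat.lt_succ_of_le hm⟩]
      · simp [emb]
      · intro b _ hb
        rw [if_neg]; · simp
        rintro rfl; exact hb (by simp [emb])
      · simp
    · refine Finset.sum_eq_zero fun b _ => ?_
      rw [if_neg]; · simp
      rintro rfl
      exact hm (Fin.le_def.mpr (Nat.lt_succ_iff.mp b.2))
  let T : (Fin (i + 1) → ℝ) →ₗ[ℝ] (Fin j → ℝ) := LinearMap.pi fun l =>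
    (innerₛₗ ℝ (eigBasis Θ (Fin.castLE j.2.le l))) ∘ₗ V.toLinearMap ∘ₗ W
  -- `T` imposes j = i linear conditions on i + 1 coefficients, so its kernel is nonzero.
  obtain ⟨a, ha, ha0⟩ := (Submodule.ne_bot_iff _).mp
    (LinearMap.ker_ne_bot_of_finrank_lt (f := T) (by simp [hij]))
  have hT : ∀ l : Fin r, l < j → inner ℝ (eigBasis Θ l) (V (W a)) = 0 := fun l hl => by
    simpa [T] using congrFun (LinearMap.mem_ker.mp ha) ⟨l, hl⟩
  set x := W a with hx
  have hx0 : x ≠ 0 := by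
    intro h0
    apply ha0
    ext m
    have := hW a (emb m)
    rw [← hx, h0, inner_zero_right, dif_pos (Fin.le_def.mpr (Nat.lt_succ_iff.mp m.2))] at this
    exact this.symm
  have h1 : eig Θ' i * ‖x‖ ^ 2 ≤ ‖rowComb Θ' x‖ ^ 2 := by
    rw [norm_rowComb_sq, ← (eigBasis Θ').sum_sq_inner_right, Finset.mul_sum]
    refine Finset.sum_le_sum fun m _ => ?_
    by_cases hm : m ≤ i
    · exact mul_le_mul_of_nonneg_right (eig_antitone Θ' hm) (sq_nonneg _)
    · simp [hx, hW, hm]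
  have h2 : ‖rowComb Θ (V x)‖ ^ 2 ≤ eig Θ j * ‖x‖ ^ 2 := by
    rw [norm_rowComb_sq, ← V.norm_map x, ← (eigBasis Θ).sum_sq_inner_right, Finset.mul_sum]
    refine Finset.sum_le_sum fun m _ => ?_
    by_cases hm : m < j
    · simp [hT m hm]
    · exact mul_le_mul_of_nonneg_right (eig_antitone Θ (not_lt.mp hm)) (sq_nonneg _)
  have hpos : 0 < ‖x‖ ^ 2 := by positivity
  have := h x
  nlinarith

/-- Comes from a² - b² = (a - b)(a + b) with a, b the norms of the two row combinations. -/
theorem eig_sub_le (Θ Θ' : Mat r q) (i : Fin r) :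
    eig Θ i ≤ eig Θ' i + ‖Θ - Θ'‖ * (‖Θ‖ + ‖Θ'‖) := by
  refine eig_le_eig_add Θ' Θ LinearIsometry.id _ (fun x => ?_) i i rfl
  have h1 := norm_rowComb_le Θ x
  have h2 := norm_rowComb_le Θ' x
  have h3 := norm_rowComb_le (Θ - Θ') x
  rw [rowComb_sub_left] at h3
  have h4 := norm_sub_norm_le (rowComb Θ x) (rowComb Θ' x)
  simp only [LinearIsometry.id_apply]
  have h5 : ‖rowComb Θ x‖ - ‖rowComb Θ' x‖ ≤ ‖Θ - Θ'‖ * ‖x‖ := h4.trans h3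
  have h6 := mul_le_mul h5 (add_le_add h1 h2) (by positivity) (by positivity)
  nlinarith

theorem continuous_eig (i : Fin r) : Continuous fun Θ : Mat r q => eig Θ i := by
  rw [continuous_iff_continuousAt]
  intro Θ
  rw [ContinuousAt, tendsto_iff_dist_tendsto_zero]
  have : Filter.Tendsto (fun Θ' : Mat r q => ‖Θ' - Θ‖ * (‖Θ'‖ + ‖Θ‖)) (nhds Θ) (nhds 0) := by
    have : Continuous (fun Θ' : Mat r q => ‖Θ' - Θ‖ * (‖Θ'‖ + ‖Θ‖)) := by fun_prop
    simpa using this.tendsto Θ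
  refine squeeze_zero (fun _ => dist_nonneg) (fun Θ' => ?_) this
  rw [Real.dist_eq, abs_sub_le_iff]
  have h1 := eig_sub_le Θ' Θ i
  have h2 := eig_sub_le Θ Θ' i
  rw [norm_sub_rev, add_comm ‖Θ‖] at h2
  constructor <;> linarith

theorem map_eig_univ (Θ : Mat r q) :
    (toMatrix Θ * (toMatrix Θ).conjTranspose).charpoly.roots =
      Multiset.map (eig Θ) Finset.univ.val := by
  rw [(Matrix.isHermitian_mul_conjTranspose_self (toMatrix Θ)).roots_charpoly_eq_eigenvalues₀]
  have := congrArg Finset.val (Finset.map_univ_equiv (finCongr (Fintype.card_fin r).symm))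
  rw [← this, Finset.map_val, Multiset.map_map]
  rfl

theorem charpoly_gram (Θ : Mat r q) :
    (toMatrix Θ * (toMatrix Θ).conjTranspose).charpoly =
      ∏ i, (Polynomial.X - Polynomial.C (eig Θ i)) := by
  have h := (Matrix.isHermitian_mul_conjTranspose_self (toMatrix Θ)).splits_charpoly
  rw [h.eq_prod_roots_of_monic (Matrix.charpoly_monic _), map_eig_univ,
    Multiset.map_map]
  rfl

theorem det_gram_sub (Θ : Mat r q) (x : ℝ) :
    (x • (1 : Matrix (Fin r) (Fin r) ℝ) - toMatrix Θ * (toMatrix Θ).conjTranspose).det =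
      ∏ i, (x - eig Θ i) := by
  rw [Matrix.smul_one_eq_diagonal, ← Matrix.scalar_apply, ← Matrix.eval_charpoly, charpoly_gram, Polynomial.eval_prod]
  simp

theorem det_gram_add (Θ : Mat r q) (ε : ℝ) :
    (toMatrix Θ * (toMatrix Θ).conjTranspose + ε • (1 : Matrix (Fin r) (Fin r) ℝ)).det =
      ∏ i, (eig Θ i + ε) := by
  have h := det_gram_sub Θ (-ε)
  rw [← neg_neg (toMatrix Θ * (toMatrix Θ).conjTranspose + ε • (1 : Matrix (Fin r) (Fin r) ℝ)),
    Matrix.det_neg]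
  have e : -(toMatrix Θ * (toMatrix Θ).conjTranspose + ε • (1 : Matrix (Fin r) (Fin r) ℝ)) =
    (-ε) • (1 : Matrix (Fin r) (Fin r) ℝ) - toMatrix Θ * (toMatrix Θ).conjTranspose := by
    rw [neg_smul]; abel
  rw [e, h, Fintype.card_fin]
  have : ∀ i, -ε - eig Θ i = -1 * (eig Θ i + ε) := fun i => by ring
  simp only [this, Finset.prod_mul_distrib, Finset.prod_const, Finset.card_univ, Fintype.card_fin]
  rw [← mul_assoc, ← mul_pow]; simp

end MatrixPrediction

end

/-! ### The regularized prior and its uniform semiconcavity. -/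

noncomputable section

namespace MatrixPrediction

open MeasureTheory
open scoped ENNReal

variable {r q : ℕ}

/-- The regularized prior `∏ i, (λ i + ε) ^ (-α i / 2)`. -/
def regPrior (ε : ℝ) (α : Fin r → ℝ) (Θ : Mat r q) : ℝ := ∏ i, (eig Θ i + ε) ^ (-(α i) / 2)

theorem regPrior_zero (α : Fin r → ℝ) : (regPrior 0 α : Mat r q → ℝ) = priorST α := by
  ext Θ; simp [regPrior, priorST]

theorem regPrior_nonneg {ε : ℝ} (hε : 0 ≤ ε) (α : Fin r → ℝ) (Θ : Mat r q) :
    0 ≤ regPrior ε α Θ :=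
  Finset.prod_nonneg fun i _ => Real.rpow_nonneg (add_nonneg (eig_nonneg Θ i) hε) _

theorem regPrior_eq_exp {ε : ℝ} (α : Fin r → ℝ) {Θ : Mat r q} (h : ∀ i, 0 < eig Θ i + ε) :
    regPrior ε α Θ = Real.exp (-(∑ i, α i * Real.log (eig Θ i + ε)) / 2) := by
  rw [regPrior, ← Finset.sum_neg_distrib, Finset.sum_div, Real.exp_sum]
  refine Finset.prod_congr rfl fun i _ => ?_
  rw [Real.rpow_def_of_pos (h i)]
  congr 1; ring

theorem eig_add_pos {ε : ℝ} (hε : 0 < ε) (Θ : Mat r q) (i : Fin r) : 0 < eig Θ i + ε :=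
  add_pos_of_nonneg_of_pos (eig_nonneg Θ i) hε

theorem regPrior_pos {ε : ℝ} (α : Fin r → ℝ) {Θ : Mat r q} (h : ∀ i, 0 < eig Θ i + ε) :
    0 < regPrior ε α Θ := by
  rw [regPrior_eq_exp α h]; positivity

theorem continuous_regPrior {ε : ℝ} (hε : 0 < ε) (α : Fin r → ℝ) :
    Continuous (regPrior ε α : Mat r q → ℝ) := by
  refine continuous_finsetProd _ fun i _ => ?_
  exact ((continuous_eig i).add continuous_const).rpow_const
    fun Θ => Or.inl (eig_add_pos hε Θ i).ne'

theorem regPrior_anti {ε ε' : ℝ} (h : ε ≤ ε') {α : Fin r → ℝ} (hα : ∀ i, 0 ≤ α i) {Θ : Mat r q}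
    (hpos : ∀ i, 0 < eig Θ i + ε) : regPrior ε' α Θ ≤ regPrior ε α Θ := by
  refine Finset.prod_le_prod (fun i _ => Real.rpow_nonneg (by linarith [hpos i]) _) fun i _ => ?_
  exact Real.rpow_le_rpow_of_nonpos (hpos i) (by linarith) (by linarith [hα i])

theorem regPrior_le {ε : ℝ} (hε : 0 < ε) {α : Fin r → ℝ} (hα : ∀ i, 0 ≤ α i) (Θ : Mat r q) :
    regPrior ε α Θ ≤ ∏ i, ε ^ (-(α i) / 2) := by
  refine Finset.prod_le_prod (fun i _ => Real.rpow_nonneg (eig_add_pos hε Θ i).le _) fun i _ => ?_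
  exact Real.rpow_le_rpow_of_nonpos hε (by linarith [eig_nonneg Θ i]) (by linarith [hα i])

theorem tendsto_regPrior (α : Fin r → ℝ) {Θ : Mat r q} (h : ∀ i, 0 < eig Θ i) :
    Filter.Tendsto (fun ε => regPrior ε α Θ) (nhds 0) (nhds (priorST α Θ)) := by
  rw [← regPrior_zero]
  refine tendsto_finsetProd _ fun i _ => ?_
  refine Filter.Tendsto.rpow_const ?_ (Or.inl (by simpa using (h i).ne'))
  exact (continuous_const.add continuous_id).tendsto' _ _ rfl

/-! ### Semiconcavity -/

/-- Abel summation: a decreasing nonnegative α is a nonnegative combination of indicators of initial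
segments. The induction subtracts the last value of α from all the others. -/
theorem sum_mul_nonneg_of_antitone {n : ℕ} {α z : Fin n → ℝ} (hα : ∀ i, 0 ≤ α i)
    (hanti : Antitone α) (hz : ∀ k (hk : k ≤ n), 0 ≤ ∑ i : Fin k, z (Fin.castLE hk i)) :
    0 ≤ ∑ i, α i * z i := by
  induction n with
  | zero => simp
  | succ n ih =>
    have h1 : ∑ i, α i * z i =
        ∑ i : Fin n, (α i.castSucc - α (Fin.last n)) * z i.castSucc
          + α (Fin.last n) * ∑ i, z i := by
      rw [Fin.sum_univ_castSucc, Fin.sum_univ_castSucc (f := z), mul_add, Finset.mul_sum, ← add_assoc,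
        ← Finset.sum_add_distrib]
      congr 1
      exact Finset.sum_congr rfl fun i _ => by ring
    rw [h1]
    refine add_nonneg (ih (fun i => sub_nonneg.mpr (hanti (Fin.le_last _))) ?_ ?_) ?_
    · intro i j hij
      exact sub_le_sub_right (hanti (Fin.castSucc_le_castSucc_iff.mpr hij)) _
    · intro k hk
      exact hz k (hk.trans n.le_succ)
    · exact mul_nonneg (hα _) (hz (n + 1) le_rfl)

/-- The leading principal minor of order `k` of `1 + E`. -/
def leadMinor (k : ℕ) (hk : k ≤ r) (E : Mat r r) : ℝ :=
  Matrix.det (Matrix.of fun i j : Fin k =>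
    (if i = j then 1 else 0) + E (Fin.castLE hk i, Fin.castLE hk j))

theorem contDiff_leadMinor (k : ℕ) (hk : k ≤ r) : ContDiff ℝ 2 (leadMinor k hk) := by
  unfold leadMinor
  simp only [Matrix.det_apply, Matrix.of_apply]
  fun_prop

theorem leadMinor_zero (k : ℕ) (hk : k ≤ r) : leadMinor k hk 0 = 1 := by
  rw [leadMinor, ← Matrix.det_one (n := Fin k)]
  congr 1
  ext i j
  simp [Matrix.one_apply]

/-- The relative change of the upper bound for `regPrior` under a relative perturbation. -/
def pertFactor (α : Fin r → ℝ) (E : Mat r r) : ℝ :=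
  Real.exp (-(∑ i : Fin r, α i *
    (Real.log (leadMinor (i + 1) i.2 E) - Real.log (leadMinor i i.2.le E))) / 2)

theorem pertFactor_zero (α : Fin r → ℝ) : pertFactor α 0 = 1 := by
  simp [pertFactor, leadMinor_zero]

theorem contDiffAt_pertFactor (α : Fin r → ℝ) : ContDiffAt ℝ 2 (pertFactor α) 0 := by
  unfold pertFactor
  refine ContDiffAt.exp (ContDiffAt.div_const (ContDiffAt.neg (ContDiffAt.sum fun i _ => ?_)) _)
  refine contDiffAt_const.mul (ContDiffAt.sub ?_ ?_)
  · exact (contDiff_leadMinor _ _).contDiffAt.log (by simp [leadMinor_zero])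
  · exact (contDiff_leadMinor _ _).contDiffAt.log (by simp [leadMinor_zero])

/-- The derivative is Lipschitz near x, so on the closed ball of radius ‖y - x‖ it stays within K‖y
- x‖ of its value at x; the mean value inequality there gives the quadratic remainder. -/
theorem _root_.ContDiffAt.exists_taylor_bound {E : Type*} [NormedAddCommGroup E] [NormedSpace ℝ E]
    {f : E → ℝ} {x : E} (hf : ContDiffAt ℝ 2 f x) :
    ∃ C, 0 ≤ C ∧ ∀ᶠ y in nhds x, |f y - f x - fderiv ℝ f x (y - x)| ≤ C * ‖y - x‖ ^ 2 := by
  obtain ⟨K, s, hs, hK⟩ := (hf.fderiv_right (m := 1) (by norm_num)).exists_lipschitzOnWith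
  have hd : ∀ᶠ y in nhds x, DifferentiableAt ℝ f y := by
    filter_upwards [hf.eventually (by simp)] with y hy using hy.differentiableAt (by simp)
  obtain ⟨ρ, hρ, hball⟩ := Metric.mem_nhds_iff.mp (Filter.inter_mem hs hd)
  refine ⟨K, K.2, ?_⟩
  filter_upwards [Metric.ball_mem_nhds x hρ] with y hy
  have hsub : Metric.closedBall x ‖y - x‖ ⊆ Metric.ball x ρ := fun z hz => by
    rw [Metric.mem_ball, dist_eq_norm] at *
    exact lt_of_le_of_lt (by simpa [dist_eq_norm] using hz) hy
  have := (convex_closedBall x ‖y - x‖).norm_image_sub_le_of_norm_hasFDerivWithin_le'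
    (f := f) (f' := fderiv ℝ f) (φ := fderiv ℝ f x) (C := K * ‖y - x‖) (x := x) (y := y)
    (fun z hz => (hball (hsub hz)).2.hasFDerivAt.hasFDerivWithinAt)
    (fun z hz => by
      have := hK.dist_le_mul z (hball (hsub hz)).1 x (hball (Metric.mem_ball_self hρ)).1
      rw [dist_eq_norm, dist_eq_norm] at this
      refine this.trans (mul_le_mul_of_nonneg_left ?_ K.2)
      simpa [dist_eq_norm] using hz)
    (by simp) (by simp [dist_eq_norm])
  rw [Real.norm_eq_abs] at this
  linarith

/-- The rows of `Θ` in the coordinates of a family of vectors. -/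
def rowsAlong {k : ℕ} (Θ : Mat r q) (u : Fin k → EuclideanSpace ℝ (Fin r)) : Mat k q :=
  WithLp.toLp 2 fun p => rowComb Θ (u p.1) p.2

@[simp] theorem rowsAlong_apply {k : ℕ} (Θ : Mat r q) (u : Fin k → EuclideanSpace ℝ (Fin r))
    (p : Fin k × Fin q) : rowsAlong Θ u p = rowComb Θ (u p.1) p.2 := rfl

theorem rowComb_rowsAlong {k : ℕ} (Θ : Mat r q) (u : Fin k → EuclideanSpace ℝ (Fin r))
    (x : EuclideanSpace ℝ (Fin k)) : rowComb (rowsAlong Θ u) x = rowComb Θ (∑ m, x m • u m) := by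
  ext j
  simp only [rowComb_apply, rowsAlong_apply, WithLp.ofLp_sum, Finset.sum_apply, Finset.mul_sum,
    Finset.sum_mul, WithLp.ofLp_smul, Pi.smul_apply, smul_eq_mul]
  rw [Finset.sum_comm]
  exact Finset.sum_congr rfl fun _ _ => Finset.sum_congr rfl fun _ _ => by ring

/-- The isometric embedding with prescribed orthonormal images of the standard basis. -/
def orthonormalEmb {k : ℕ} {u : Fin k → EuclideanSpace ℝ (Fin r)} (hu : Orthonormal ℝ u) :
    EuclideanSpace ℝ (Fin k) →ₗᵢ[ℝ] EuclideanSpace ℝ (Fin r) where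
  toFun x := ∑ m, x m • u m
  map_add' x y := by simp [add_smul, Finset.sum_add_distrib]
  map_smul' c x := by simp [mul_smul, Finset.smul_sum]
  norm_map' x := by
    have : ‖∑ m, x m • u m‖ ^ 2 = ‖x‖ ^ 2 := by
      rw [← real_inner_self_eq_norm_sq, hu.inner_sum, EuclideanSpace.real_norm_sq_eq]
      simp [sq]
    exact (sq_eq_sq₀ (norm_nonneg _) (norm_nonneg _)).mp this

/-- Cauchy interlacing for the compression to the span of `u`. -/
theorem eig_rowsAlong_le {k : ℕ} (hk : k ≤ r) (Θ : Mat r q)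
    {u : Fin k → EuclideanSpace ℝ (Fin r)} (hu : Orthonormal ℝ u) (i : Fin k) :
    eig (rowsAlong Θ u) i ≤ eig Θ (Fin.castLE hk i) := by
  simpa using eig_le_eig_add Θ (rowsAlong Θ u) (orthonormalEmb hu) 0
    (fun x => by rw [rowComb_rowsAlong]; simp [orthonormalEmb]) i (Fin.castLE hk i) rfl

theorem gram_rowsAlong {k : ℕ} (Θ : Mat r q) (u : Fin k → EuclideanSpace ℝ (Fin r)) (i j : Fin k) :
    (toMatrix (rowsAlong Θ u) * (toMatrix (rowsAlong Θ u)).conjTranspose) i j =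
      inner ℝ (rowComb Θ (u i)) (rowComb Θ (u j)) := by
  simp [Matrix.mul_apply, toMatrix, PiLp.inner_apply, mul_comm]

theorem rowComb_add_left (Θ Θ' : Mat r q) (x : EuclideanSpace ℝ (Fin r)) :
    rowComb (Θ + Θ') x = rowComb Θ x + rowComb Θ' x := by
  ext j; simp [mul_add, Finset.sum_add_distrib]

theorem rowComb_neg_left (Θ : Mat r q) (x : EuclideanSpace ℝ (Fin r)) :
    rowComb (-Θ) x = -rowComb Θ x := by
  ext j; simp

/-- The perturbation of `Θ Θᵀ + ε` caused by `Θ ↦ Θ + h`, in the eigenbasis of `Θ Θᵀ` and relative to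
`Θ Θᵀ + ε`. -/
def relPert (ε : ℝ) (Θ h : Mat r q) : Mat r r :=
  WithLp.toLp 2 fun p =>
    (inner ℝ (rowComb Θ (eigBasis Θ p.1)) (rowComb h (eigBasis Θ p.2))
      + inner ℝ (rowComb h (eigBasis Θ p.1)) (rowComb Θ (eigBasis Θ p.2))
      + inner ℝ (rowComb h (eigBasis Θ p.1)) (rowComb h (eigBasis Θ p.2)))
    / (√(eig Θ p.1 + ε) * √(eig Θ p.2 + ε))

theorem inner_rowComb_eigBasis (Θ : Mat r q) (i j : Fin r) :
    inner ℝ (rowComb Θ (eigBasis Θ i)) (rowComb Θ (eigBasis Θ j)) = if i = j then eig Θ i else 0 := by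
  rw [← inner_gramOp, gramOp_eigBasis, inner_smul_left,
    orthonormal_iff_ite.mp (eigBasis Θ).orthonormal]
  simp

/-- The compression of the perturbed Gram matrix plus ε to the top k unperturbed eigenvectors is D
(1 + E) D, where D is diagonal with entries √(λ_i + ε) and E is the leading block of `relPert`;
determinants multiply. -/
theorem prod_eig_rowsAlong {ε : ℝ} (hε : 0 < ε) (Θ h : Mat r q) (k : ℕ) (hk : k ≤ r) :
    ∏ i : Fin k, (eig (rowsAlong (Θ + h) fun m : Fin k => eigBasis Θ (Fin.castLE hk m)) i + ε) =
      (∏ i : Fin k, (eig Θ (Fin.castLE hk i) + ε)) * leadMinor k hk (relPert ε Θ h) := by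
  rw [← det_gram_add]
  set d : Fin k → ℝ := fun i => √(eig Θ (Fin.castLE hk i) + ε) with hd
  have hd0 : ∀ i, d i ≠ 0 := fun i => (Real.sqrt_pos.mpr (eig_add_pos hε _ _)).ne'
  have hdd : ∀ i, d i * d i = eig Θ (Fin.castLE hk i) + ε := fun i =>
    Real.mul_self_sqrt (eig_add_pos hε _ _).le
  have key : toMatrix (rowsAlong (Θ + h) fun m : Fin k => eigBasis Θ (Fin.castLE hk m)) *
      (toMatrix (rowsAlong (Θ + h) fun m : Fin k => eigBasis Θ (Fin.castLE hk m))).conjTranspose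
      + ε • (1 : Matrix (Fin k) (Fin k) ℝ) =
      Matrix.diagonal d * (Matrix.of fun i j : Fin k => (if i = j then 1 else 0)
        + relPert ε Θ h (Fin.castLE hk i, Fin.castLE hk j)) * Matrix.diagonal d := by
    ext i j
    rw [Matrix.add_apply, gram_rowsAlong, Matrix.mul_diagonal, Matrix.diagonal_mul, Matrix.of_apply]
    simp only [relPert, rowComb_add_left, inner_add_left, inner_add_right, inner_rowComb_eigBasis]
    have e1 : (Fin.castLE hk i = Fin.castLE hk j) ↔ i = j := by
      simp [Fin.ext_iff]
    rw [Matrix.smul_apply, Matrix.one_apply]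
    change _ = d i * (_ + _ / (d i * d j)) * d j
    simp only [e1]
    have hi := hd0 i
    have hj := hd0 j
    by_cases hij : i = j
    · subst hij
      simp only [if_true, smul_eq_mul, mul_one]
      field_simp
      rw [sq, hdd]; ring
    · simp only [hij, if_false, smul_eq_mul, mul_zero]
      field_simp
      ring
  rw [key, Matrix.det_mul, Matrix.det_mul, Matrix.det_diagonal, leadMinor]
  have : ∏ i : Fin k, (eig Θ (Fin.castLE hk i) + ε) = (∏ i, d i) * ∏ i, d i := by
    rw [← Finset.prod_mul_distrib]
    exact Finset.prod_congr rfl fun i _ => (hdd i).symm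
  rw [this]; ring

theorem leadMinor_relPert_pos {ε : ℝ} (hε : 0 < ε) (Θ h : Mat r q) (k : ℕ) (hk : k ≤ r) :
    0 < leadMinor k hk (relPert ε Θ h) := by
  have h1 := prod_eig_rowsAlong hε Θ h k hk
  have h2 : 0 < ∏ i : Fin k, (eig Θ (Fin.castLE hk i) + ε) :=
    Finset.prod_pos fun i _ => eig_add_pos hε _ _
  have h3 : 0 < ∏ i : Fin k,
      (eig (rowsAlong (Θ + h) fun m : Fin k => eigBasis Θ (Fin.castLE hk m)) i + ε) :=
    Finset.prod_pos fun i _ => eig_add_pos hε _ _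
  rw [h1] at h3
  exact (mul_pos_iff_of_pos_left h2).mp h3

/-- The upper bound that touches `regPrior` at h = 0. By interlacing, the sum of the k largest log
(λ_i + ε) at Θ + h is at least the log-determinant of the compression to the old eigenvectors; since
α is decreasing, Abel summation combines these inequalities for all k. -/
theorem regPrior_add_le {ε : ℝ} (hε : 0 < ε) {α : Fin r → ℝ} (hα : ∀ i, 0 ≤ α i)
    (hanti : Antitone α) (Θ h : Mat r q) :
    regPrior ε α (Θ + h) ≤ regPrior ε α Θ * pertFactor α (relPert ε Θ h) := by
  rw [regPrior_eq_exp α (eig_add_pos hε _), regPrior_eq_exp α (eig_add_pos hε _), pertFactor,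
    ← Real.exp_add, Real.exp_le_exp]
  -- The log-minors are extended by 0 beyond r to a function on ℕ, so that the sum of increments
  -- telescopes over a range.
  let L : ℕ → ℝ := fun k => if hk : k ≤ r then Real.log (leadMinor k hk (relPert ε Θ h)) else 0
  have hL : ∀ k (hk : k ≤ r), L k = Real.log (leadMinor k hk (relPert ε Θ h)) := fun k hk => by
    simp [L, hk]
  have key : 0 ≤ ∑ i : Fin r, α i * (Real.log (eig (Θ + h) i + ε) - Real.log (eig Θ i + ε)
      - (L (i + 1) - L i)) := by
    refine sum_mul_nonneg_of_antitone hα hanti fun k hk => ?_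
    simp only [Finset.sum_sub_distrib, Fin.val_castLE]
    rw [← Finset.sum_sub_distrib (f := fun i : Fin k => L (i + 1)),
      Fin.sum_univ_eq_sum_range (fun i => L (i + 1) - L i) k, Finset.sum_range_sub,
      hL k hk, show L 0 = 0 by simp [L, leadMinor], sub_zero]
    have hu : Orthonormal ℝ fun m : Fin k => eigBasis Θ (Fin.castLE hk m) :=
      (eigBasis Θ).orthonormal.comp _ (Fin.castLE_injective hk)
    have h1 : ∏ i : Fin k, (eig (rowsAlong (Θ + h) fun m : Fin k =>
        eigBasis Θ (Fin.castLE hk m)) i + ε) ≤ ∏ i : Fin k, (eig (Θ + h) (Fin.castLE hk i) + ε) :=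
      Finset.prod_le_prod (fun i _ => (eig_add_pos hε _ _).le) fun i _ =>
        by simpa using eig_rowsAlong_le hk (Θ + h) hu i
    rw [prod_eig_rowsAlong hε] at h1
    have h2 : 0 < ∏ i : Fin k, (eig Θ (Fin.castLE hk i) + ε) :=
      Finset.prod_pos fun i _ => eig_add_pos hε _ _
    have h3 := Real.log_le_log (mul_pos h2 (leadMinor_relPert_pos hε Θ h k hk)) h1
    rw [Real.log_mul h2.ne' (leadMinor_relPert_pos hε Θ h k hk).ne', Real.log_prod
      (fun i _ => (eig_add_pos hε _ _).ne'), Real.log_prod (fun i _ => (eig_add_pos hε _ _).ne')] at h3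
    change 0 ≤ _ - _ - Real.log (leadMinor k hk (relPert ε Θ h))
    linarith
  have e : ∀ i : Fin r, Real.log (leadMinor (i + 1) i.2 (relPert ε Θ h)) -
      Real.log (leadMinor i i.2.le (relPert ε Θ h)) = L (i + 1) - L i := fun i => by
    rw [hL _ i.2, hL _ i.2.le]
  simp only [e]
  simp only [mul_sub, Finset.sum_sub_distrib] at key ⊢
  linarith

/-- This is where the relative normalization pays off: the rows of Θ along an eigenvector have norm
√λ_i ≤ √(λ_i + ε), so a large Θ is absorbed by the denominator and the bound does not involve Θ. -/
theorem abs_relPert_le {ε : ℝ} (hε : 0 < ε) (Θ h : Mat r q) (p : Fin r × Fin r) :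
    |relPert ε Θ h p| ≤ 2 * (‖h‖ / √ε) + (‖h‖ / √ε) ^ 2 := by
  have hs : 0 < √ε := Real.sqrt_pos.mpr hε
  have hn : ∀ i, ‖rowComb Θ (eigBasis Θ i)‖ ≤ √(eig Θ i + ε) := fun i => by
    apply Real.le_sqrt_of_sq_le
    rw [← eig_eq_norm_sq]; linarith
  have hh : ∀ i, ‖rowComb h (eigBasis Θ i)‖ ≤ ‖h‖ := fun i => by
    simpa using norm_rowComb_le h (eigBasis Θ i)
  have hm : ∀ i, √ε ≤ √(eig Θ i + ε) := fun i =>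
    Real.sqrt_le_sqrt (by linarith [eig_nonneg Θ i])
  have hm0 : ∀ i, 0 < √(eig Θ i + ε) := fun i => hs.trans_le (hm i)
  obtain ⟨i, j⟩ := p
  change |_ / _| ≤ _
  rw [abs_div, abs_of_pos (mul_pos (hm0 _) (hm0 _)), div_le_iff₀ (mul_pos (hm0 _) (hm0 _))]
  simp only
  refine (abs_add_three _ _ _).trans ?_
  have h1 := (abs_real_inner_le_norm (rowComb Θ (eigBasis Θ i)) (rowComb h (eigBasis Θ j))).trans
    (mul_le_mul (hn i) (hh j) (norm_nonneg _) (hm0 i).le)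
  have h2 := (abs_real_inner_le_norm (rowComb h (eigBasis Θ i)) (rowComb Θ (eigBasis Θ j))).trans
    (mul_le_mul (hh i) (hn j) (norm_nonneg _) (norm_nonneg h))
  have h3 := (abs_real_inner_le_norm (rowComb h (eigBasis Θ i)) (rowComb h (eigBasis Θ j))).trans
    (mul_le_mul (hh i) (hh j) (norm_nonneg _) (norm_nonneg h))
  have hκ : ‖h‖ = ‖h‖ / √ε * √ε := by field_simp
  set κ := ‖h‖ / √ε
  have hκ0 : 0 ≤ κ := by positivity
  rw [hκ] at h1 h2 h3
  have hi := hm i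
  have hj := hm j
  have hi0 := hm0 i
  have hj0 := hm0 j
  generalize √(eig Θ i + ε) = a at *
  generalize √(eig Θ j + ε) = b at *
  have k1 : a * (κ * √ε) ≤ κ * (a * b) := by
    have := mul_le_mul_of_nonneg_left hj (mul_nonneg hi0.le hκ0); linarith
  have k2 : κ * √ε * b ≤ κ * (a * b) := by
    have := mul_le_mul_of_nonneg_left hi (mul_nonneg hj0.le hκ0); linarith
  have k3 : κ * √ε * (κ * √ε) ≤ κ ^ 2 * (a * b) := by
    have := mul_le_mul hi hj hs.le hi0.le
    have := mul_le_mul_of_nonneg_left this (sq_nonneg κ); linarith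
  linarith

/-- The terms linear in h cancel, so the sum is of second order. -/
theorem abs_relPert_add_neg_le {ε : ℝ} (hε : 0 < ε) (Θ h : Mat r q) (p : Fin r × Fin r) :
    |(relPert ε Θ h + relPert ε Θ (-h)) p| ≤ 2 * (‖h‖ / √ε) ^ 2 := by
  have hs : 0 < √ε := Real.sqrt_pos.mpr hε
  have hh : ∀ i, ‖rowComb h (eigBasis Θ i)‖ ≤ ‖h‖ := fun i => by
    simpa using norm_rowComb_le h (eigBasis Θ i)
  have hm : ∀ i, √ε ≤ √(eig Θ i + ε) := fun i =>
    Real.sqrt_le_sqrt (by linarith [eig_nonneg Θ i])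
  obtain ⟨i, j⟩ := p
  have e : (relPert ε Θ h + relPert ε Θ (-h)) (i, j) =
      2 * inner ℝ (rowComb h (eigBasis Θ i)) (rowComb h (eigBasis Θ j)) /
        (√(eig Θ i + ε) * √(eig Θ j + ε)) := by
    simp only [relPert, PiLp.add_apply, rowComb_neg_left, inner_neg_left, inner_neg_right]
    ring
  have hm0 : ∀ i, 0 < √(eig Θ i + ε) := fun i => hs.trans_le (hm i)
  rw [e, abs_div, abs_of_pos (mul_pos (hm0 _) (hm0 _)), abs_mul, abs_two, mul_div_assoc]
  refine mul_le_mul_of_nonneg_left ?_ zero_le_two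
  rw [div_pow, sq, sq]
  exact div_le_div₀ (by positivity) ((abs_real_inner_le_norm _ _).trans
    (mul_le_mul (hh i) (hh j) (norm_nonneg _) (norm_nonneg h))) (by positivity)
    (mul_le_mul (hm i) (hm j) hs.le (hm0 i).le)

theorem norm_le_of_abs_apply_le {E : Mat r r} {c : ℝ} (h : ∀ p, |E p| ≤ c) :
    ‖E‖ ≤ (r : ℝ) ^ 2 * c := by
  have : E = ∑ p, E p • EuclideanSpace.single p (1 : ℝ) := by
    ext p; simp [Finset.sum_apply, Pi.single_apply]
  rw [this]
  refine (norm_sum_le _ _).trans ?_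
  have h1 : ∀ p ∈ Finset.univ, ‖E p • EuclideanSpace.single p (1 : ℝ)‖ ≤ c := fun p _ => by
    simpa [norm_smul] using h p
  refine (Finset.sum_le_sum h1).trans_eq ?_
  simp [sq]

/-- `regPrior` is semiconcave, uniformly on the whole space. -/
theorem exists_regPrior_semiconcave {ε : ℝ} (hε : 0 < ε) {α : Fin r → ℝ} (hα : ∀ i, 0 ≤ α i)
    (hanti : Antitone α) : ∃ C, 0 ≤ C ∧ ∀ Θ h : Mat r q,
      regPrior ε α (Θ + h) + regPrior ε α (Θ - h) - 2 * regPrior ε α Θ ≤ C * ‖h‖ ^ 2 := by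
  obtain ⟨C, hC, hT⟩ := (contDiffAt_pertFactor α).exists_taylor_bound
  obtain ⟨η, hη, hT⟩ := Metric.eventually_nhds_iff.mp hT
  set D := fderiv ℝ (pertFactor α) 0
  set M := ∏ i, ε ^ (-(α i) / 2) with hM
  have hM0 : 0 ≤ M := Finset.prod_nonneg fun i _ => Real.rpow_nonneg hε.le _
  set R : ℝ := (r : ℝ) ^ 2
  have hR : 0 ≤ R := by positivity
  -- Below `κ₀` one has κ² ≤ κ, hence entries of `relPert` at most 3κ and norm at most 3Rκ < η,
  -- inside the range of the Taylor bound.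
  set κ₀ : ℝ := min 1 (η / (3 * R + 1)) with hκ₀
  have hκ₀0 : 0 < κ₀ := lt_min one_pos (by positivity)
  have hs : 0 < √ε := Real.sqrt_pos.mpr hε
  -- The sup bound `M` times two second-order contributions: the derivative applied to the sum of
  -- the two perturbations, and the two Taylor remainders.
  set C₁ := M * (‖D‖ * (R * 2) + 2 * (C * (3 * R) ^ 2)) with hC₁
  have hC₁0 : 0 ≤ C₁ := by positivity
  refine ⟨(C₁ + 2 * M / κ₀ ^ 2) / ε, by positivity, fun Θ h => ?_⟩
  set κ := ‖h‖ / √ε with hκ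
  have hκ0 : 0 ≤ κ := by positivity
  have hh : (C₁ + 2 * M / κ₀ ^ 2) / ε * ‖h‖ ^ 2 = (C₁ + 2 * M / κ₀ ^ 2) * κ ^ 2 := by
    rw [hκ, div_pow, Real.sq_sqrt hε.le]; ring
  rw [hh]
  have hF0 := regPrior_nonneg hε.le α Θ
  have hFM := regPrior_le hε hα Θ
  by_cases hlt : κ < κ₀
  · have hE : ∀ h' : Mat r q, ‖h'‖ = ‖h‖ → ‖relPert ε Θ h'‖ ≤ 3 * R * κ := fun h' e => by
      have := norm_le_of_abs_apply_le (abs_relPert_le hε Θ h')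
      rw [e] at this
      refine this.trans ?_
      have hκ1 : κ ≤ 1 := hlt.le.trans (min_le_left _ _)
      have : κ ^ 2 ≤ κ := by nlinarith
      have := mul_le_mul_of_nonneg_left this hR
      linarith
    have hEη : 3 * R * κ < η := by
      have h1 : κ < η / (3 * R + 1) := hlt.trans_le (min_le_right _ _)
      rw [lt_div_iff₀ (by positivity)] at h1
      nlinarith
    have hP : ∀ h' : Mat r q, ‖h'‖ = ‖h‖ →
        pertFactor α (relPert ε Θ h') ≤ 1 + D (relPert ε Θ h') + C * (3 * R) ^ 2 * κ ^ 2 := fun h' e => by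
      have h1 := (hE h' e)
      have := hT (y := relPert ε Θ h') (by rw [dist_zero_right]; exact h1.trans_lt hEη)
      rw [sub_zero, pertFactor_zero] at this
      have h2 := (abs_le.mp this).2
      have h3 := mul_le_mul_of_nonneg_left (pow_le_pow_left₀ (norm_nonneg _) h1 2) hC
      change pertFactor α (relPert ε Θ h') - 1 - D (relPert ε Θ h') ≤ _ at h2
      rw [mul_pow] at h3
      linarith
    have hD : D (relPert ε Θ h) + D (relPert ε Θ (-h)) ≤ ‖D‖ * (R * (2 * κ ^ 2)) := by
      rw [← map_add]
      refine (le_abs_self _).trans ((D.le_opNorm _).trans ?_)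
      exact mul_le_mul_of_nonneg_left
        (norm_le_of_abs_apply_le (abs_relPert_add_neg_le hε Θ h)) (norm_nonneg _)
    have h1 := regPrior_add_le hε hα hanti Θ h
    have h2 := regPrior_add_le hε hα hanti Θ (-h)
    rw [← sub_eq_add_neg] at h2
    have h3 := hP h rfl
    have h4 := hP (-h) (norm_neg h)
    have h5 : regPrior ε α Θ * (pertFactor α (relPert ε Θ h) + pertFactor α (relPert ε Θ (-h)) - 2)
        ≤ regPrior ε α Θ * ((‖D‖ * (R * 2) + 2 * (C * (3 * R) ^ 2)) * κ ^ 2) :=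
      mul_le_mul_of_nonneg_left (by linarith) hF0
    have h6 : regPrior ε α Θ * ((‖D‖ * (R * 2) + 2 * (C * (3 * R) ^ 2)) * κ ^ 2) ≤ C₁ * κ ^ 2 := by
      rw [hC₁, mul_assoc M]
      exact mul_le_mul_of_nonneg_right hFM (by positivity)
    have h7 : 0 ≤ 2 * M / κ₀ ^ 2 * κ ^ 2 := by positivity
    linarith
  -- For large h the trivial bound 2M is already below the quadratic term with coefficient 2M / κ₀².
  · have h1 := regPrior_le hε hα (Θ + h)
    have h2 := regPrior_le hε hα (Θ - h)
    have h3 : 2 * M ≤ 2 * M / κ₀ ^ 2 * κ ^ 2 := by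
      rw [div_mul_eq_mul_div, le_div_iff₀ (by positivity)]
      exact mul_le_mul_of_nonneg_left (pow_le_pow_left₀ hκ₀0.le (not_lt.mp hlt) 2) (by positivity)
    have h4 : 0 ≤ C₁ * κ ^ 2 := by positivity
    linarith

end MatrixPrediction

end

noncomputable section

namespace MatrixPrediction

open MeasureTheory
open scoped ENNReal

variable {r q : ℕ}

/-! ### Matrices with distinct positive singular values -/

/-- The eigenvalues of `Θ Θᵀ` are positive and distinct. -/
def HasSimpleSpectrum (Θ : Mat r q) : Prop := (∀ i, 0 < eig Θ i) ∧ Function.Injective (eig Θ)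

/-- There are only r eigenvalues counted with multiplicity, so r distinct positive ones exhaust the
spectrum. This avoids having to sort the μ_i. -/
theorem hasSimpleSpectrum_of_eigenvectors {Θ : Mat r q} {μ : Fin r → ℝ} (hμ : ∀ i, 0 < μ i)
    (hinj : Function.Injective μ)
    (h : ∀ i, ∃ v : EuclideanSpace ℝ (Fin r), v ≠ 0 ∧ gramOp Θ v = μ i • v) :
    HasSimpleSpectrum Θ := by
  choose v hv0 hv using h
  choose σ hσ using fun i => exists_eig_eq Θ (hv0 i) (hv i)
  have hσi : Function.Injective σ := fun i j hij => hinj (by rw [← hσ i, ← hσ j, hij])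
  have hσb : Function.Bijective σ := Finite.injective_iff_bijective.mp hσi
  refine ⟨fun i => ?_, fun i j hij => ?_⟩
  · obtain ⟨k, rfl⟩ := hσb.2 i
    rw [hσ]; exact hμ k
  · obtain ⟨k, rfl⟩ := hσb.2 i
    obtain ⟨l, rfl⟩ := hσb.2 j
    rw [hσ, hσ] at hij
    rw [hinj hij]

theorem rowComb_smul_left (c : ℝ) (Θ : Mat r q) (x : EuclideanSpace ℝ (Fin r)) :
    rowComb (c • Θ) x = c • rowComb Θ x := by
  ext j; simp [Finset.mul_sum, mul_left_comm]

theorem gramOp_smul_left (c : ℝ) (Θ : Mat r q) (x : EuclideanSpace ℝ (Fin r)) :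
    gramOp (c • Θ) x = c ^ 2 • gramOp Θ x := by
  ext i
  simp only [gramOp_apply, rowComb_smul_left, PiLp.smul_apply, smul_eq_mul, Finset.mul_sum]
  exact Finset.sum_congr rfl fun j _ => by ring

theorem HasSimpleSpectrum.smul {Θ : Mat r q} (h : HasSimpleSpectrum Θ) {c : ℝ} (hc : c ≠ 0) :
    HasSimpleSpectrum (c • Θ) := by
  refine hasSimpleSpectrum_of_eigenvectors (μ := fun i => c ^ 2 * eig Θ i)
    (fun i => mul_pos (by positivity) (h.1 i)) (fun i j hij => h.2 ?_)
    (fun i => ⟨eigBasis Θ i, (eigBasis Θ).orthonormal.ne_zero i, ?_⟩)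
  · exact mul_left_cancel₀ (pow_ne_zero 2 hc) hij
  · rw [gramOp_smul_left, gramOp_eigBasis, smul_smul]

theorem exists_hasSimpleSpectrum (hrq : r ≤ q) : ∃ Θ : Mat r q, HasSimpleSpectrum Θ := by
  -- The rectangular diagonal matrix with entries 1, …, r, whose squares are the eigenvalues.
  refine ⟨WithLp.toLp 2 fun p => if p.1.val = p.2.val then (p.1.val + 1 : ℝ) else 0,
    hasSimpleSpectrum_of_eigenvectors (μ := fun i => ((i.val : ℝ) + 1) ^ 2) (fun i => by positivity)
      (fun i j hij => ?_) (fun i => ⟨EuclideanSpace.single i 1, by simp, ?_⟩)⟩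
  · have := (sq_eq_sq₀ (by positivity) (by positivity)).mp hij
    exact Fin.ext (by exact_mod_cast add_right_cancel this)
  · ext k
    simp only [gramOp_apply, rowComb_apply, PiLp.single_apply, ite_mul, one_mul, zero_mul,
      PiLp.smul_apply, smul_eq_mul, mul_ite, mul_one, mul_zero]
    have hin : ∀ x : Fin q, (∑ l : Fin r, if l.val = x.val then if l = i then (l.val : ℝ) + 1
        else 0 else 0) = if i.val = x.val then (i.val : ℝ) + 1 else 0 := fun x => by
      rw [Finset.sum_eq_single i (fun l _ hl => by simp [hl]) (by simp)]; simp
    rw [Finset.sum_eq_single (Fin.castLE hrq i)]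
    · rw [hin]
      by_cases hk : k = i
      · subst hk; simp [sq]
      · simp [hk, Fin.val_inj]
    · intro j _ hj
      rw [hin, if_neg (c := i.val = j.val), mul_zero, ite_self]
      exact fun e => hj (Fin.ext e.symm)
    · simp

theorem trace_gram_pow (Θ : Mat r q) (n : ℕ) :
    ((toMatrix Θ * (toMatrix Θ).conjTranspose) ^ n).trace = ∑ i, eig Θ i ^ n := by
  have hp : ∀ i, (gramOp Θ ^ n) (eigBasis Θ i) = eig Θ i ^ n • eigBasis Θ i := fun i => by
    induction n with
    | zero => simp
    | succ n ih => rw [pow_succ, Module.End.mul_apply, gramOp_eigBasis, map_smul, ih, smul_smul,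
        pow_succ, mul_comm]
  have h1 : LinearMap.trace ℝ _ (gramOp Θ ^ n) =
      ((toMatrix Θ * (toMatrix Θ).conjTranspose) ^ n).trace := by
    rw [gramOp, ← Matrix.toLpLin_pow, Matrix.toLpLin_eq_toLin, Matrix.trace_toLin_eq]
  rw [← h1, LinearMap.trace_eq_sum_inner _ (eigBasis Θ)]
  refine Finset.sum_congr rfl fun i _ => ?_
  rw [hp, inner_smul_right]
  simp

open Polynomial in
-- Failure of simplicity is a polynomial condition in s. The determinant of the Gram matrix is the
-- product of the eigenvalues, and the determinant of the Hankel matrix `H` of their power sums is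
-- the squared Vandermonde determinant, that is, the discriminant. The product of both is nonzero at
-- s = 0, so it has finitely many roots.
theorem finite_not_hasSimpleSpectrum_line {E : Mat r q} (hE : HasSimpleSpectrum E) (Θ : Mat r q) :
    {s : ℝ | ¬ HasSimpleSpectrum (E + s • Θ)}.Finite := by
  let A : Matrix (Fin r) (Fin q) ℝ[X] :=
    Matrix.of fun i j => C (E (i, j)) + X * C (Θ (i, j))
  let S : Matrix (Fin r) (Fin r) ℝ[X] := A * A.transpose
  let H : Matrix (Fin r) (Fin r) ℝ[X] := Matrix.of fun i j => (S ^ (i.val + j.val)).trace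
  let P : ℝ[X] := S.det * H.det
  have hS : ∀ s, S.map (evalRingHom s) =
      toMatrix (E + s • Θ) * (toMatrix (E + s • Θ)).conjTranspose := fun s => by
    ext i j
    simp [S, A, Matrix.mul_apply, toMatrix, eval_finsetSum, mul_comm s]
  have hdet : ∀ s, S.det.eval s = ∏ i, eig (E + s • Θ) i := fun s => by
    rw [← coe_evalRingHom, RingHom.map_det, RingHom.mapMatrix_apply, hS]
    simpa using det_gram_add (E + s • Θ) 0
  have htr : ∀ s (n : ℕ), ((S ^ n).trace).eval s = ∑ i, eig (E + s • Θ) i ^ n := fun s n => by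
    rw [← coe_evalRingHom, AddMonoidHom.map_trace (evalRingHom s), ← RingHom.mapMatrix_apply, map_pow,
      RingHom.mapMatrix_apply, hS, trace_gram_pow]
  have hH : ∀ s, H.det.eval s = (Matrix.vandermonde (eig (E + s • Θ))).det ^ 2 := fun s => by
    rw [← coe_evalRingHom, RingHom.map_det, RingHom.mapMatrix_apply, sq]
    nth_rw 1 [← Matrix.det_transpose (Matrix.vandermonde _)]
    rw [← Matrix.det_mul]
    congr 1
    ext i j
    change ((S ^ (i.val + j.val)).trace).eval s = _
    rw [htr, Matrix.mul_apply]
    simp only [Matrix.transpose_apply, Matrix.vandermonde_apply, pow_add]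
  have hP : ∀ s, P.eval s ≠ 0 → HasSimpleSpectrum (E + s • Θ) := fun s hs => by
    rw [eval_mul, hdet, hH] at hs
    have h1 := left_ne_zero_of_mul hs
    have h2 := right_ne_zero_of_mul hs
    refine ⟨fun i => (eig_nonneg _ i).lt_of_ne' (Finset.prod_ne_zero_iff.mp h1 i (Finset.mem_univ i)), ?_⟩
    exact Matrix.det_vandermonde_ne_zero_iff.mp (pow_ne_zero_iff two_ne_zero |>.mp h2)
  have hP0 : P ≠ 0 := by
    intro h0
    have : P.eval 0 = 0 := by simp [h0]
    rw [eval_mul, hdet, hH, zero_smul, add_zero] at this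
    exact mul_ne_zero (Finset.prod_ne_zero_iff.mpr fun i _ => (hE.1 i).ne')
      (pow_ne_zero 2 (Matrix.det_vandermonde_ne_zero_iff.mpr hE.2)) this
  refine (P.roots.toFinset.finite_toSet).subset fun s hs => ?_
  simp only [Finset.mem_coe, Multiset.mem_toFinset]
  rw [mem_roots hP0, IsRoot.def]
  by_contra h
  exact hs (hP s h)

theorem isOpen_hasSimpleSpectrum : IsOpen {Θ : Mat r q | HasSimpleSpectrum Θ} := by
  have : {Θ : Mat r q | HasSimpleSpectrum Θ} =
      (⋂ i, {Θ | 0 < eig Θ i}) ∩ ⋂ i, ⋂ j, {Θ | i ≠ j → eig Θ i ≠ eig Θ j} := by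
    ext Θ
    simp only [HasSimpleSpectrum, Set.mem_ofPred_eq, Set.mem_inter_iff, Set.mem_iInter]
    refine and_congr_right fun _ => ⟨fun h i j hij he => hij (h he), fun h i j he => ?_⟩
    by_contra hij
    exact h i j hij he
  rw [this]
  refine IsOpen.inter (isOpen_iInter_of_finite fun i => isOpen_lt continuous_const (continuous_eig i))
    (isOpen_iInter_of_finite fun i => isOpen_iInter_of_finite fun j => ?_)
  by_cases hij : i = j
  · simp [hij]
  · simpa [hij] using isOpen_ne_fun (continuous_eig i) (continuous_eig j)

/-- Fubini along the direction `E`: it suffices that every line parallel to `E` meets the bad set in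
a null set. -/
theorem ae_hasSimpleSpectrum (hrq : r ≤ q) : ∀ᵐ Θ : Mat r q, HasSimpleSpectrum Θ := by
  obtain ⟨E, hE⟩ := exists_hasSimpleSpectrum hrq
  refine ae_mem_of_ae_add_linearMap_mem (LinearMap.toSpanSingleton ℝ (Mat r q) E) volume volume
    isOpen_hasSimpleSpectrum.measurableSet fun Θ => ?_
  rw [ae_iff]
  -- For t ≠ 0, Θ + tE = t (E + t⁻¹Θ) and simplicity is invariant under scaling, so the bad t are 0
  -- or inverses of bad parameters on the line through `E`.
  refine Set.Finite.measure_zero (Set.Finite.subset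
    ((Set.finite_singleton 0).union ((finite_not_hasSimpleSpectrum_line hE Θ).image fun s => s⁻¹)) ?_) _
  intro t ht
  by_cases h0 : t = 0
  · left; exact h0
  · right
    refine ⟨t⁻¹, fun h => ht ?_, inv_inv t⟩
    have := h.smul h0
    rw [smul_add, smul_smul, mul_inv_cancel₀ h0, one_smul, add_comm] at this
    exact this

/-! ### Smoothness -/

theorem contDiff_det_gram : ContDiff ℝ 2 fun p : Mat r q × ℝ =>
    (p.2 • (1 : Matrix (Fin r) (Fin r) ℝ)
      - toMatrix p.1 * (toMatrix p.1).conjTranspose).det := by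
  simp only [Matrix.det_apply, Matrix.sub_apply, Matrix.smul_apply, Matrix.mul_apply, toMatrix,
    Matrix.of_apply, Matrix.conjTranspose_apply, star_trivial, smul_eq_mul, Matrix.one_apply]
  fun_prop

/-- Implicit function theorem for the characteristic polynomial at a simple root: its derivative
there is the product of the gaps to the other eigenvalues. Continuity of `eig` identifies the
ordered eigenvalue with the implicit branch. -/
theorem HasSimpleSpectrum.contDiffAt_eig {Θ : Mat r q} (h : HasSimpleSpectrum Θ) (i : Fin r) :
    ContDiffAt ℝ 2 (fun Θ' : Mat r q => eig Θ' i) Θ := by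
  set p : Mat r q × ℝ → ℝ := fun p => (p.2 • (1 : Matrix (Fin r) (Fin r) ℝ)
      - toMatrix p.1 * (toMatrix p.1).conjTranspose).det with hp
  have hp' : ∀ Θ' x, p (Θ', x) = ∏ j, (x - eig Θ' j) := fun Θ' x => det_gram_sub Θ' x
  have cdf : ContDiffAt ℝ 2 p (Θ, eig Θ i) := contDiff_det_gram.contDiffAt
  set c := ∏ j ∈ Finset.univ.erase i, (eig Θ i - eig Θ j) with hc
  have hc0 : c ≠ 0 := Finset.prod_ne_zero_iff.mpr fun j hj =>
    sub_ne_zero.mpr fun e => (Finset.ne_of_mem_erase hj) (h.2 e).symm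
  have hder : HasDerivAt (fun x => p (Θ, x)) c (eig Θ i) := by
    have e : (fun x => p (Θ, x)) =
        fun x => (x - eig Θ i) * ∏ j ∈ Finset.univ.erase i, (x - eig Θ j) := by
      ext x
      rw [hp', Finset.mul_prod_erase _ (fun j => x - eig Θ j) (Finset.mem_univ i)]
    rw [e]
    have hd : DifferentiableAt ℝ (fun x => ∏ j ∈ Finset.univ.erase i, (x - eig Θ j)) (eig Θ i) := by
      fun_prop
    have := ((hasDerivAt_id (eig Θ i)).sub_const (eig Θ i)).mul hd.hasDerivAt
    simp only [id, one_mul, sub_self, zero_mul, add_zero] at this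
    exact this
  have if₂ : (fderiv ℝ p (Θ, eig Θ i) ∘L .inr ℝ (Mat r q) ℝ).IsInvertible := by
    refine ⟨ContinuousLinearEquiv.unitsEquivAut ℝ (Units.mk0 c hc0), ?_⟩
    have h1 : HasFDerivAt (fun x => p (Θ, x))
        (fderiv ℝ p (Θ, eig Θ i) ∘L .inr ℝ (Mat r q) ℝ) (eig Θ i) :=
      (cdf.differentiableAt (by simp)).hasFDerivAt.comp (eig Θ i)
        (hasFDerivAt_prodMk_right Θ (eig Θ i))
    have h2 := h1.hasDerivAt.unique hder
    ext
    simpa using h2.symm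
  have hψ := cdf.contDiffAt_implicitFunction (by simp) if₂
  refine hψ.congr_of_eventuallyEq ?_
  have hev := cdf.eventually_apply_eq_iff_implicitFunction (by simp) if₂
  have ht : Filter.Tendsto (fun Θ' : Mat r q => (Θ', eig Θ' i)) (nhds Θ) (nhds (Θ, eig Θ i)) :=
    (continuous_id.prodMk (continuous_eig i)).tendsto Θ
  have hz : ∀ Θ' : Mat r q, p (Θ', eig Θ' i) = 0 := fun Θ' => by
    rw [hp']; exact Finset.prod_eq_zero (Finset.mem_univ i) (sub_self _)
  filter_upwards [ht.eventually hev] with Θ' hΘ'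
  exact (hΘ'.mp (by rw [hz, hz])).symm

theorem HasSimpleSpectrum.contDiffAt_regPrior {ε : ℝ} (hε : 0 ≤ ε) (α : Fin r → ℝ) {Θ : Mat r q}
    (h : HasSimpleSpectrum Θ) : ContDiffAt ℝ 2 (regPrior ε α) Θ := by
  refine contDiffAt_prod fun i _ => ?_
  exact ((h.contDiffAt_eig i).add contDiffAt_const).rpow_const_of_ne
    (add_pos_of_pos_of_nonneg (h.1 i) hε).ne'

end MatrixPrediction

end

noncomputable section

namespace MatrixPrediction

open MeasureTheory Filter
open scoped ENNReal Topology

variable {r q : ℕ}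

/-! ### Second differences -/

/-- L'Hôpital turns the quotient into (φ'(t) - φ'(-t)) / (2t), the average of two slopes of φ' at 0;
φ' need only be differentiable at that one point. -/
theorem tendsto_second_difference {φ φ' : ℝ → ℝ} {d : ℝ}
    (h : ∀ᶠ t in 𝓝 0, HasDerivAt φ (φ' t) t) (h' : HasDerivAt φ' d 0) :
    Tendsto (fun t => (φ t + φ (-t) - 2 * φ 0) / t ^ 2) (𝓝[≠] 0) (𝓝 d) := by
  have hneg : Tendsto (fun t : ℝ => -t) (𝓝 0) (𝓝 0) := by
    simpa using (continuous_neg (G := ℝ)).tendsto 0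
  have hcont : ContinuousAt φ 0 := h.self_of_nhds.continuousAt
  refine HasDerivAt.lhopital_zero_nhdsNE (f' := fun t => φ' t - φ' (-t)) (g' := fun t => 2 * t)
    ?_ ?_ ?_ ?_ ?_ ?_
  · filter_upwards [(h.and (hneg.eventually h)).filter_mono nhdsWithin_le_nhds] with t ht
    have h2 : HasDerivAt (fun t => φ (-t)) (-φ' (-t)) t := by
      have := ht.2.comp t (hasDerivAt_neg t)
      rw [mul_neg_one] at this
      exact this
    simpa [sub_eq_add_neg] using (ht.1.add h2).sub_const (2 * φ 0)
  · exact Eventually.of_forall fun t => by simpa using hasDerivAt_pow 2 t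
  · filter_upwards [self_mem_nhdsWithin] with t ht
    exact mul_ne_zero two_ne_zero ht
  · have : Tendsto (fun t => φ t + φ (-t) - 2 * φ 0) (𝓝 0) (𝓝 (φ 0 + φ 0 - 2 * φ 0)) :=
      (hcont.tendsto.add (hcont.tendsto.comp hneg)).sub_const _
    rw [show φ 0 + φ 0 - 2 * φ 0 = 0 by ring] at this
    exact this.mono_left nhdsWithin_le_nhds
  · have : Tendsto (fun t : ℝ => t ^ 2) (𝓝 0) (𝓝 (0 ^ 2)) := (continuous_pow 2).tendsto 0
    rw [zero_pow two_ne_zero] at this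
    exact this.mono_left nhdsWithin_le_nhds
  · have h1 := h'.tendsto_slope_zero
    have h2 : Tendsto (fun t : ℝ => -t) (𝓝[≠] 0) (𝓝[≠] 0) := by
      refine tendsto_nhdsWithin_iff.mpr ⟨hneg.mono_left nhdsWithin_le_nhds, ?_⟩
      filter_upwards [self_mem_nhdsWithin] with t ht
      simpa using ht
    have h3 := ((h1.add (h1.comp h2)).div_const 2)
    rw [show (d + d) / 2 = d by ring] at h3
    refine h3.congr' ?_
    filter_upwards [self_mem_nhdsWithin] with t ht
    have ht : t ≠ 0 := ht
    simp only [Function.comp, zero_add, smul_eq_mul]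
    field_simp
    ring

theorem _root_.ContDiffAt.tendsto_second_difference {E : Type*} [NormedAddCommGroup E]
    [NormedSpace ℝ E] {f : E → ℝ} {x : E} (hf : ContDiffAt ℝ 2 f x) (e : E) :
    Tendsto (fun t : ℝ => (f (x + t • e) + f (x - t • e) - 2 * f x) / t ^ 2) (𝓝[≠] 0)
      (𝓝 (iteratedFDeriv ℝ 2 f x ![e, e])) := by
  have hline : ∀ t : ℝ, HasDerivAt (fun t : ℝ => x + t • e) e t := fun t => by
    simpa using ((hasDerivAt_id t).smul_const e).const_add x
  have htend : Tendsto (fun t : ℝ => x + t • e) (𝓝 0) (𝓝 x) := by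
    simpa using (hline 0).continuousAt.tendsto
  have hd : ∀ᶠ y in 𝓝 x, DifferentiableAt ℝ f y := by
    filter_upwards [hf.eventually (by simp)] with y hy using hy.differentiableAt (by simp)
  have h1 : ∀ᶠ t in 𝓝 (0 : ℝ), HasDerivAt (fun t : ℝ => f (x + t • e))
      (fderiv ℝ f (x + t • e) e) t := by
    filter_upwards [htend.eventually hd] with t ht
    exact ht.hasFDerivAt.comp_hasDerivAt t (hline t)
  have hd2 : HasFDerivAt (fderiv ℝ f) (fderiv ℝ (fderiv ℝ f) x) (x + (0 : ℝ) • e) := by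
    rw [zero_smul, add_zero]
    exact ((hf.fderiv_right (m := 1) (by norm_num)).differentiableAt (by simp)).hasFDerivAt
  have h2 : HasDerivAt (fun t : ℝ => fderiv ℝ f (x + t • e) e)
      (fderiv ℝ (fderiv ℝ f) x e e) 0 :=
    (ContinuousLinearMap.apply ℝ ℝ e).hasFDerivAt.comp_hasDerivAt (0 : ℝ)
      (hd2.comp_hasDerivAt (0 : ℝ) (hline 0))
  have h3 := MatrixPrediction.tendsto_second_difference h1 h2
  rw [iteratedFDeriv_two_apply]
  change Tendsto _ _ (𝓝 (fderiv ℝ (fderiv ℝ f) x e e))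
  simpa only [zero_smul, add_zero, neg_smul, ← sub_eq_add_neg] using h3

/-! ### Eigenvalues along the lines spanned by singular vectors -/

/-- The matrix `u vᵀ`. -/
def outer (u : EuclideanSpace ℝ (Fin r)) (v : EuclideanSpace ℝ (Fin q)) : Mat r q :=
  WithLp.toLp 2 fun p => u p.1 * v p.2

theorem inner_outer (u u' : EuclideanSpace ℝ (Fin r)) (v v' : EuclideanSpace ℝ (Fin q)) :
    inner ℝ (outer u v) (outer u' v') = inner ℝ u u' * inner ℝ v v' := by
  simp only [PiLp.inner_apply, RCLike.inner_apply, conj_trivial, outer, Fintype.sum_prod_type,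
    Finset.sum_mul_sum]
  exact Finset.sum_congr rfl fun _ _ => Finset.sum_congr rfl fun _ _ => by ring

theorem rowComb_outer (u x : EuclideanSpace ℝ (Fin r)) (v : EuclideanSpace ℝ (Fin q)) :
    rowComb (outer u v) x = inner ℝ u x • v := by
  ext j
  simp only [rowComb_apply, outer, PiLp.smul_apply, smul_eq_mul, PiLp.inner_apply,
    RCLike.inner_apply, conj_trivial, Finset.sum_mul]
  exact Finset.sum_congr rfl fun _ _ => by ring

theorem orthonormal_outer (u : OrthonormalBasis (Fin r) ℝ (EuclideanSpace ℝ (Fin r)))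
    (v : OrthonormalBasis (Fin q) ℝ (EuclideanSpace ℝ (Fin q))) :
    Orthonormal ℝ fun p : Fin r × Fin q => outer (u p.1) (v p.2) := by
  rw [orthonormal_iff_ite]
  rintro ⟨i, j⟩ ⟨k, l⟩
  rw [inner_outer, orthonormal_iff_ite.mp u.orthonormal, orthonormal_iff_ite.mp v.orthonormal]
  by_cases h1 : i = k <;> by_cases h2 : j = l <;> simp [h1, h2]

/-- The orthonormal basis `uᵢ vⱼᵀ` of the space of matrices. -/
def outerBasis (u : OrthonormalBasis (Fin r) ℝ (EuclideanSpace ℝ (Fin r)))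
    (v : OrthonormalBasis (Fin q) ℝ (EuclideanSpace ℝ (Fin q))) :
    OrthonormalBasis (Fin r × Fin q) ℝ (Mat r q) :=
  OrthonormalBasis.mk (orthonormal_outer u v)
    ((orthonormal_outer u v).linearIndependent.span_eq_top_of_card_eq_finrank' (by simp)).ge

@[simp] theorem outerBasis_apply (u : OrthonormalBasis (Fin r) ℝ (EuclideanSpace ℝ (Fin r)))
    (v : OrthonormalBasis (Fin q) ℝ (EuclideanSpace ℝ (Fin q))) (p : Fin r × Fin q) :
    outerBasis u v p = outer (u p.1) (v p.2) := by
  simp [outerBasis]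

/-- Basis independence of the Laplacian allows the summation over singular directions. -/
theorem laplacian_eq_sum_orthonormalBasis (f : Mat r q → ℝ) (Θ : Mat r q)
    (b : OrthonormalBasis (Fin r × Fin q) ℝ (Mat r q)) :
    laplacian f Θ = ∑ i, ∑ j, iteratedFDeriv ℝ 2 f Θ ![b (i, j), b (i, j)] := by
  rw [← Fintype.sum_prod_type' (f := fun i j => iteratedFDeriv ℝ 2 f Θ ![b (i, j), b (i, j)])]
  have h1 := congrFun (InnerProductSpace.laplacian_eq_iteratedFDeriv_orthonormalBasis f b) Θ
  have h2 := congrFun (InnerProductSpace.laplacian_eq_iteratedFDeriv_orthonormalBasis f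
    (EuclideanSpace.basisFun (Fin r × Fin q) ℝ)) Θ
  rw [← h1, h2, laplacian, Fintype.sum_prod_type]
  simp

/-- Right singular vectors. -/
theorem HasSimpleSpectrum.exists_right_basis (hrq : r ≤ q) {Θ : Mat r q} (h : HasSimpleSpectrum Θ) :
    ∃ v : OrthonormalBasis (Fin q) ℝ (EuclideanSpace ℝ (Fin q)),
      ∀ k, rowComb Θ (eigBasis Θ k) = √(eig Θ k) • v (Fin.castLE hrq k) := by
  classical
  -- The first r vectors are the normalized images of the left singular vectors; the value 0 at the
  -- other indices is irrelevant, since only the restriction to j < r is extended to a basis.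
  let w : Fin q → EuclideanSpace ℝ (Fin q) := fun j =>
    if hj : j.val < r then (√(eig Θ ⟨j, hj⟩))⁻¹ • rowComb Θ (eigBasis Θ ⟨j, hj⟩) else 0
  have hw : Orthonormal ℝ (({j : Fin q | j.val < r} : Set (Fin q)).domRestrict w) := by
    rw [orthonormal_iff_ite]
    rintro ⟨j, hj⟩ ⟨l, hl⟩
    have hj' : j.val < r := hj
    have hl' : l.val < r := hl
    change inner ℝ (w j) (w l) = _
    simp only [w, dif_pos hj', dif_pos hl', inner_smul_left, inner_smul_right,
      inner_rowComb_eigBasis, Subtype.mk.injEq, Fin.ext_iff]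
    split_ifs with e
    · have e' : j = l := Fin.ext e
      subst e'
      have := Real.mul_self_sqrt (h.1 ⟨j, hj'⟩).le
      have h0 := (Real.sqrt_pos.mpr (h.1 ⟨j, hj'⟩)).ne'
      rw [conj_trivial]
      field_simp
      rw [sq, this]
    · simp
  obtain ⟨v, hv⟩ := hw.exists_orthonormalBasis_extension_of_card_eq (by simp)
  refine ⟨v, fun k => ?_⟩
  rw [hv (Fin.castLE hrq k) k.2]
  simp only [w, Fin.val_castLE, k.2, dif_pos, Fin.eta, smul_smul]
  rw [mul_inv_cancel₀ (Real.sqrt_pos.mpr (h.1 k)).ne', one_smul]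

theorem rowComb_sum_smul {ι : Type*} [Fintype ι] (Θ : Mat r q) (c : ι → ℝ)
    (u : ι → EuclideanSpace ℝ (Fin r)) :
    rowComb Θ (∑ m, c m • u m) = ∑ m, c m • rowComb Θ (u m) := by
  ext j
  simp only [rowComb_apply, WithLp.ofLp_sum, Finset.sum_apply, Finset.mul_sum,
    Finset.sum_mul, WithLp.ofLp_smul, Pi.smul_apply, smul_eq_mul]
  rw [Finset.sum_comm]
  exact Finset.sum_congr rfl fun _ _ => Finset.sum_congr rfl fun _ _ => by ring

/-- The eigenvalue equation of the perturbed Gram matrix in the unperturbed eigenbasis, with c the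
coordinates of an eigenvector. A rank-one perturbation u_i v_jᵀ couples only the index i with the
index equal to j, if there is one; every other coordinate decouples. -/
theorem eigen_equation {Θ : Mat r q} {hrq : r ≤ q}
    {v : OrthonormalBasis (Fin q) ℝ (EuclideanSpace ℝ (Fin q))}
    (hv : ∀ k, rowComb Θ (eigBasis Θ k) = √(eig Θ k) • v (Fin.castLE hrq k))
    (i : Fin r) (j : Fin q) (t : ℝ) (k : Fin r) :
    ∃ c : Fin r → ℝ, c ≠ 0 ∧ ∀ l,
      eig Θ l * c l + (if Fin.castLE hrq l = j then t * √(eig Θ l) * c i else 0)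
        + (if l = i then t * (∑ m, if Fin.castLE hrq m = j then √(eig Θ m) * c m else 0)
            + t ^ 2 * c i else 0)
      = eig (Θ + t • outer (eigBasis Θ i) (v j)) k * c l := by
  set Θ' := Θ + t • outer (eigBasis Θ i) (v j) with hΘ'
  set w := eigBasis Θ' k with hw
  let c : Fin r → ℝ := fun l => inner ℝ (eigBasis Θ l) w
  have hwc : w = ∑ l, c l • eigBasis Θ l := ((eigBasis Θ).sum_repr' w).symm
  refine ⟨c, fun h0 => ?_, fun l => ?_⟩
  · refine (eigBasis Θ').orthonormal.ne_zero k ?_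
    change w = 0
    rw [hwc]; simp [h0]
  have hrow : ∀ x, rowComb Θ' x = rowComb Θ x + (t * inner ℝ (eigBasis Θ i) x) • v j := fun x => by
    rw [hΘ', rowComb_add_left, rowComb_smul_left, rowComb_outer, smul_smul]
  have h1 : inner ℝ (rowComb Θ' w) (rowComb Θ' (eigBasis Θ l)) = eig Θ' k * c l := by
    rw [← inner_gramOp, hw, gramOp_eigBasis, inner_smul_left, real_inner_comm]; rfl
  have h2 : inner ℝ (rowComb Θ w) (rowComb Θ (eigBasis Θ l)) = eig Θ l * c l := by
    rw [real_inner_comm, ← inner_gramOp, gramOp_eigBasis, inner_smul_left]; rfl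
  have h3 : inner ℝ (rowComb Θ w) (v j) =
      ∑ m, if Fin.castLE hrq m = j then √(eig Θ m) * c m else 0 := by
    rw [hwc, rowComb_sum_smul, sum_inner]
    refine Finset.sum_congr rfl fun m _ => ?_
    rw [hv, inner_smul_left, inner_smul_left, orthonormal_iff_ite.mp v.orthonormal]
    split_ifs <;> simp [mul_comm]
  have h4 : inner ℝ (v j) (rowComb Θ (eigBasis Θ l)) =
      if Fin.castLE hrq l = j then √(eig Θ l) else 0 := by
    rw [hv, inner_smul_right, orthonormal_iff_ite.mp v.orthonormal]
    simp [eq_comm]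
  rw [← h1, hrow, hrow, inner_add_left, inner_add_right, inner_add_right, h2, inner_smul_left,
    inner_smul_right, inner_smul_left, inner_smul_right, h3, h4,
    orthonormal_iff_ite.mp (eigBasis Θ).orthonormal, orthonormal_iff_ite.mp v.orthonormal]
  simp only [conj_trivial, if_true]
  rw [show inner ℝ (eigBasis Θ i) w = c i from rfl]
  by_cases h5 : l = i
  · subst h5
    simp only [if_true]
    split_ifs <;> ring
  · simp only [h5, Ne.symm h5, if_false]
    split_ifs <;> ring

end MatrixPrediction

end

/-! ### Second derivatives of the prior in the singular directions. -/

noncomputable section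

namespace MatrixPrediction

open MeasureTheory Filter
open scoped ENNReal Topology

variable {r q d : ℕ}

/-- The increment of `a` is of order t², so a first-order expansion of φ is enough; `dslope` avoids
dividing by a possibly vanishing increment. -/
theorem tendsto_comp_sub_div_sq {φ a : ℝ → ℝ} {x₀ φ' c : ℝ} (hφ : HasDerivAt φ φ' x₀)
    (ha : Tendsto (fun t => (a t - x₀) / t ^ 2) (𝓝[≠] 0) (𝓝 c)) :
    Tendsto (fun t => (φ (a t) - φ x₀) / t ^ 2) (𝓝[≠] 0) (𝓝 (c * φ')) := by
  have hsq : Tendsto (fun t : ℝ => t ^ 2) (𝓝[≠] 0) (𝓝 0) := by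
    have : Tendsto (fun t : ℝ => t ^ 2) (𝓝 0) (𝓝 (0 ^ 2)) := (continuous_pow 2).tendsto 0
    rw [zero_pow two_ne_zero] at this
    exact this.mono_left nhdsWithin_le_nhds
  have ha0 : Tendsto a (𝓝[≠] 0) (𝓝 x₀) := by
    have := (ha.mul hsq).add_const x₀
    rw [mul_zero, zero_add] at this
    refine this.congr' ?_
    filter_upwards [self_mem_nhdsWithin] with t ht
    have ht : t ≠ 0 := ht
    field_simp
    ring
  have hds : Tendsto (fun t => dslope φ x₀ (a t)) (𝓝[≠] 0) (𝓝 φ') := by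
    have h1 : ContinuousAt (dslope φ x₀) x₀ := continuousAt_dslope_same.mpr hφ.differentiableAt
    have h2 := h1.tendsto.comp ha0
    rwa [dslope_same, hφ.deriv] at h2
  refine (ha.mul hds).congr fun t => ?_
  have := sub_smul_dslope φ x₀ (a t)
  rw [smul_eq_mul] at this
  rw [← this]; ring

theorem tendsto_neg_punctured : Tendsto (fun t : ℝ => -t) (𝓝[≠] 0) (𝓝[≠] 0) := by
  refine tendsto_nhdsWithin_iff.mpr ⟨?_, ?_⟩
  · have : Tendsto (fun t : ℝ => -t) (𝓝 0) (𝓝 (-0)) := (continuous_neg (G := ℝ)).tendsto 0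
    rw [neg_zero] at this
    exact this.mono_left nhdsWithin_le_nhds
  · filter_upwards [self_mem_nhdsWithin] with t ht
    simpa using ht

theorem tendsto_line (Θ e : Mat r q) : Tendsto (fun t : ℝ => Θ + t • e) (𝓝 0) (𝓝 Θ) := by
  have : Continuous fun t : ℝ => Θ + t • e := by fun_prop
  simpa using this.tendsto 0

/-- For directions in which the eigenvalues have no first-order term. The logarithm of the prior
then moves by -t²/2 · ∑ α_k c_k / (λ_k + ε), and the second derivative is twice the coefficient of
t². -/
theorem HasSimpleSpectrum.iteratedFDeriv_of_tendsto {ε : ℝ} (hε : 0 ≤ ε) (α : Fin r → ℝ)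
    {Θ : Mat r q} (h : HasSimpleSpectrum Θ) {e : Mat r q} {c : Fin r → ℝ}
    (hc : ∀ k, Tendsto (fun t : ℝ => (eig (Θ + t • e) k - eig Θ k) / t ^ 2) (𝓝[≠] 0) (𝓝 (c k))) :
    iteratedFDeriv ℝ 2 (regPrior ε α) Θ ![e, e] =
      -(regPrior ε α Θ * ∑ k, α k * c k / (eig Θ k + ε)) := by
  have hpos : ∀ k, 0 < eig Θ k + ε := fun k => add_pos_of_pos_of_nonneg (h.1 k) hε
  have h1 : ∀ k, Tendsto (fun t : ℝ => (Real.log (eig (Θ + t • e) k + ε) -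
      Real.log (eig Θ k + ε)) / t ^ 2) (𝓝[≠] 0) (𝓝 (c k * (eig Θ k + ε)⁻¹)) := fun k => by
    have hd : HasDerivAt (fun x => Real.log (x + ε)) (eig Θ k + ε)⁻¹ (eig Θ k) := by
      simpa using ((hasDerivAt_id (eig Θ k)).add_const ε).log (hpos k).ne'
    exact tendsto_comp_sub_div_sq (φ := fun x => Real.log (x + ε)) hd (hc k)
  set S := ∑ k, α k * (c k * (eig Θ k + ε)⁻¹) with hS
  have h2 : Tendsto (fun t : ℝ => (-(∑ k, α k * Real.log (eig (Θ + t • e) k + ε)) / 2 -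
      -(∑ k, α k * Real.log (eig Θ k + ε)) / 2) / t ^ 2) (𝓝[≠] 0) (𝓝 (-S / 2)) := by
    have := ((tendsto_finsetSum Finset.univ fun k _ => (h1 k).const_mul (α k)).neg).div_const 2
    refine this.congr fun t => ?_
    simp only [mul_div_assoc', mul_sub, sub_div, Finset.sum_sub_distrib, ← Finset.sum_div]
    ring
  have h3 := tendsto_comp_sub_div_sq (Real.hasDerivAt_exp _) h2
  have h4 : Tendsto (fun t : ℝ => (regPrior ε α (Θ + t • e) - regPrior ε α Θ) / t ^ 2) (𝓝[≠] 0)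
      (𝓝 (-S / 2 * regPrior ε α Θ)) := by
    rw [regPrior_eq_exp α hpos]
    refine h3.congr' ?_
    have hev := (tendsto_line Θ e).eventually (isOpen_hasSimpleSpectrum.mem_nhds h)
    filter_upwards [hev.filter_mono nhdsWithin_le_nhds] with t ht
    rw [regPrior_eq_exp α fun k => add_pos_of_pos_of_nonneg (ht.1 k) hε]
  have h5 := h4.add (h4.comp tendsto_neg_punctured)
  have h6 := (h.contDiffAt_regPrior hε α).tendsto_second_difference e
  have h7 : -(regPrior ε α Θ * ∑ k, α k * c k / (eig Θ k + ε)) =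
      -S / 2 * regPrior ε α Θ + -S / 2 * regPrior ε α Θ := by
    rw [hS]
    simp only [div_eq_mul_inv, mul_assoc]
    ring
  rw [h7]
  refine tendsto_nhds_unique h6 (h5.congr fun t => ?_)
  simp only [Function.comp, neg_smul, sub_eq_add_neg, even_two.neg_pow]
  ring

/-- The candidates have distinct limits and `eig` is continuous, so for small t only the k-th
candidate can be the k-th eigenvalue. -/
theorem HasSimpleSpectrum.eventually_eig_eq {Θ : Mat r q} (h : HasSimpleSpectrum Θ) {e : Mat r q}
    {cand : Fin r → ℝ → ℝ} (hc : ∀ l, Tendsto (cand l) (𝓝 0) (𝓝 (eig Θ l)))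
    (hex : ∀ t k, ∃ l, eig (Θ + t • e) k = cand l t) (k : Fin r) :
    ∀ᶠ t in 𝓝 0, eig (Θ + t • e) k = cand k t := by
  have hk : Tendsto (fun t : ℝ => eig (Θ + t • e) k) (𝓝 0) (𝓝 (eig Θ k)) :=
    ((continuous_eig k).tendsto Θ).comp (tendsto_line Θ e)
  have hne : ∀ᶠ t in 𝓝 0, ∀ l, l ≠ k → eig (Θ + t • e) k ≠ cand l t := by
    rw [eventually_all]
    intro l
    by_cases hl : l = k
    · simp [hl]
    · filter_upwards [(hk.sub (hc l)).eventually_ne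
        (sub_ne_zero.mpr fun e' => hl (h.2 e').symm)] with t ht _ using sub_ne_zero.mp ht
  filter_upwards [hne] with t ht
  obtain ⟨l, hl⟩ := hex t k
  by_cases hlk : l = k
  · rw [hl, hlk]
  · exact absurd hl (ht l hlk)

section Lines

variable {Θ : Mat r (r + d)} (h : HasSimpleSpectrum Θ)
  {v : OrthonormalBasis (Fin (r + d)) ℝ (EuclideanSpace ℝ (Fin (r + d)))}
  (hv : ∀ k, rowComb Θ (eigBasis Θ k) = √(eig Θ k) • v (Fin.castLE (r.le_add_right d) k))
  {ε : ℝ} (hε : 0 ≤ ε) (α : Fin r → ℝ)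

theorem castLE_eq_castAdd (l i : Fin r) :
    Fin.castLE (r.le_add_right d) l = Fin.castAdd d i ↔ l = i := by
  simp [Fin.ext_iff]

theorem castLE_ne_natAdd (l : Fin r) (j : Fin d) :
    Fin.castLE (r.le_add_right d) l ≠ Fin.natAdd r j := by
  have := l.2
  simp only [ne_eq, Fin.ext_iff, Fin.val_castLE, Fin.val_natAdd]
  omega

-- In this direction the singular value σ_i becomes σ_i + t and the others stay fixed. The
-- eigenvalue has a first-order term here, so the one-variable function ((σ + t)² + ε)^p is
-- differentiated twice directly.
include h hv hε in
theorem iteratedFDeriv_outer_same (i : Fin r) :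
    iteratedFDeriv ℝ 2 (regPrior ε α) Θ
      ![outer (eigBasis Θ i) (v (Fin.castAdd d i)), outer (eigBasis Θ i) (v (Fin.castAdd d i))] =
    regPrior ε α Θ * (-(α i) / (eig Θ i + ε)
      + α i * (α i + 2) * eig Θ i / (eig Θ i + ε) ^ 2) := by
  set e := outer (eigBasis Θ i) (v (Fin.castAdd d i)) with he
  set σ := √(eig Θ i) with hσ
  have hσ0 : 0 < σ := Real.sqrt_pos.mpr (h.1 i)
  have hσσ : σ ^ 2 = eig Θ i := Real.sq_sqrt (h.1 i).le
  have hm : 0 < eig Θ i + ε := add_pos_of_pos_of_nonneg (h.1 i) hε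
  have hev := fun k => h.eventually_eig_eq (e := e)
    (cand := fun l t => if l = i then (σ + t) ^ 2 else eig Θ l) (fun l => by
      by_cases hl : l = i
      · simp only [hl, if_true]
        have : Continuous fun t : ℝ => (σ + t) ^ 2 := by fun_prop
        simpa [hσσ] using this.tendsto 0
      · simpa only [hl, if_false] using tendsto_const_nhds) (fun t k => by
      obtain ⟨c, hc0, hc⟩ := eigen_equation hv i (Fin.castAdd d i) t k
      obtain ⟨l, hl⟩ := Function.ne_iff.mp hc0
      refine ⟨l, ?_⟩
      have := hc l
      simp only [castLE_eq_castAdd, Finset.sum_ite_eq', Finset.mem_univ, if_true] at this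
      by_cases hli : l = i
      · subst hli
        simp only [if_true] at this ⊢
        refine mul_right_cancel₀ hl (this.symm.trans ?_)
        rw [← hσ, ← hσσ]; ring
      · simp only [hli, if_false] at this ⊢
        exact mul_right_cancel₀ hl (by linarith)) k
  set K := ∏ k ∈ Finset.univ.erase i, (eig Θ k + ε) ^ (-(α k) / 2) with hK
  set p := -(α i) / 2 with hp
  have hF : ∀ᶠ t : ℝ in 𝓝 0, regPrior ε α (Θ + t • e) = ((σ + t) ^ 2 + ε) ^ p * K := by
    filter_upwards [eventually_all.mpr hev] with t ht
    rw [regPrior, ← Finset.mul_prod_erase _ _ (Finset.mem_univ i), ht i, if_pos rfl]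
    congr 1
    exact Finset.prod_congr rfl fun k hk => by rw [ht k, if_neg (Finset.ne_of_mem_erase hk)]
  have hF0 : regPrior ε α Θ = (eig Θ i + ε) ^ p * K := by
    rw [regPrior, ← Finset.mul_prod_erase _ _ (Finset.mem_univ i)]
  have hbase : ∀ᶠ t : ℝ in 𝓝 0, 0 < (σ + t) ^ 2 + ε := by
    have hcont : Continuous fun t : ℝ => (σ + t) ^ 2 + ε := by fun_prop
    exact hcont.continuousAt.eventually (lt_mem_nhds (by simpa [hσσ] using hm))
  have hb : ∀ t, HasDerivAt (fun t : ℝ => (σ + t) ^ 2 + ε) (2 * (σ + t)) t := fun t => by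
    simpa using ((((hasDerivAt_id t).const_add σ).pow 2).add_const ε)
  have hd1 : ∀ᶠ t : ℝ in 𝓝 0, HasDerivAt (fun t : ℝ => ((σ + t) ^ 2 + ε) ^ p)
      (2 * (σ + t) * p * ((σ + t) ^ 2 + ε) ^ (p - 1)) t := by
    filter_upwards [hbase] with t ht
    exact (hb t).rpow_const (Or.inl ht.ne')
  have hd2 : HasDerivAt (fun t : ℝ => 2 * (σ + t) * p * ((σ + t) ^ 2 + ε) ^ (p - 1))
      (2 * p * (eig Θ i + ε) ^ (p - 1) + 2 * σ * p *
        (2 * σ * (p - 1) * (eig Θ i + ε) ^ (p - 1 - 1))) 0 := by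
    have h1 : HasDerivAt (fun t : ℝ => 2 * (σ + t) * p) (2 * p) 0 := by
      simpa using (((hasDerivAt_id (0 : ℝ)).const_add σ).const_mul 2).mul_const p
    have h2 : HasDerivAt (fun t : ℝ => ((σ + t) ^ 2 + ε) ^ (p - 1))
        (2 * (σ + 0) * (p - 1) * ((σ + 0) ^ 2 + ε) ^ (p - 1 - 1)) 0 :=
      (hb 0).rpow_const (Or.inl hbase.self_of_nhds.ne')
    have h3 := h1.mul h2
    simp only [add_zero, hσσ] at h3
    exact h3
  have h6 := (h.contDiffAt_regPrior hε α).tendsto_second_difference e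
  have h7 := (tendsto_second_difference hd1 hd2).mul_const K
  have h8 : (2 * p * (eig Θ i + ε) ^ (p - 1) + 2 * σ * p *
        (2 * σ * (p - 1) * (eig Θ i + ε) ^ (p - 1 - 1))) * K = regPrior ε α Θ *
      (-(α i) / (eig Θ i + ε) + α i * (α i + 2) * eig Θ i / (eig Θ i + ε) ^ 2) := by
    rw [hF0, show α i = -2 * p by rw [hp]; ring]
    simp only [Real.rpow_sub_one hm.ne']
    rw [← hσσ]
    rw [← hσσ] at hm
    field_simp
    ring
  rw [← h8]
  refine tendsto_nhds_unique h6 (h7.congr' ?_)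
  have hneg : Tendsto (fun t : ℝ => -t) (𝓝 0) (𝓝 0) := by
    simpa using (continuous_neg (G := ℝ)).tendsto 0
  filter_upwards [(hF.and (hneg.eventually hF)).filter_mono nhdsWithin_le_nhds] with t ht
  rw [sub_eq_add_neg Θ, ← neg_smul, ht.1, ht.2, hF0, add_zero, hσσ]
  ring

-- The direction v_j is orthogonal to the row space, so λ_i becomes λ_i + t² and nothing else moves.
include h hv hε in
theorem iteratedFDeriv_outer_natAdd (i : Fin r) (j : Fin d) :
    iteratedFDeriv ℝ 2 (regPrior ε α) Θ
      ![outer (eigBasis Θ i) (v (Fin.natAdd r j)), outer (eigBasis Θ i) (v (Fin.natAdd r j))] =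
    -(regPrior ε α Θ * (α i / (eig Θ i + ε))) := by
  set e := outer (eigBasis Θ i) (v (Fin.natAdd r j)) with he
  have hev := fun k => h.eventually_eig_eq (e := e)
    (cand := fun l t => eig Θ l + if l = i then t ^ 2 else 0) (fun l => by
      by_cases hl : l = i
      · simp only [hl, if_true]
        have : Continuous fun t : ℝ => eig Θ i + t ^ 2 := by fun_prop
        simpa using this.tendsto 0
      · simpa only [hl, if_false, add_zero] using tendsto_const_nhds) (fun t k => by
      obtain ⟨c, hc0, hc⟩ := eigen_equation hv i (Fin.natAdd r j) t k
      obtain ⟨l, hl⟩ := Function.ne_iff.mp hc0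
      refine ⟨l, ?_⟩
      have := hc l
      simp only [castLE_ne_natAdd, if_false, Finset.sum_const_zero, mul_zero, zero_add,
        add_zero] at this
      by_cases hli : l = i
      · subst hli
        simp only [if_true] at this ⊢
        exact mul_right_cancel₀ hl (by linarith)
      · simp only [hli, if_false] at this ⊢
        exact mul_right_cancel₀ hl (by linarith)) k
  rw [h.iteratedFDeriv_of_tendsto hε α (e := e) (c := fun k => if k = i then 1 else 0) fun k => ?_]
  · simp [ite_div]
  · refine tendsto_const_nhds.congr' ?_
    filter_upwards [(hev k).filter_mono nhdsWithin_le_nhds, self_mem_nhdsWithin] with t ht ht0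
    have ht0 : t ≠ 0 := ht0
    rw [ht]
    split_ifs <;> simp [ht0]

-- Only the coordinates i and l interact, and their two eigenvalues solve (μ - λ_i)(μ - λ_l) = t² μ.
-- Hence λ_i moves by t² λ_i / (λ_i - λ_l) to leading order, and λ_l symmetrically.
include h hv hε in
theorem iteratedFDeriv_outer_castAdd {i l : Fin r} (hil : l ≠ i) :
    iteratedFDeriv ℝ 2 (regPrior ε α) Θ
      ![outer (eigBasis Θ i) (v (Fin.castAdd d l)), outer (eigBasis Θ i) (v (Fin.castAdd d l))] =
    -(regPrior ε α Θ * (α i * (eig Θ i / (eig Θ i - eig Θ l)) / (eig Θ i + ε)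
      + α l * (eig Θ l / (eig Θ l - eig Θ i)) / (eig Θ l + ε))) := by
  set e := outer (eigBasis Θ i) (v (Fin.castAdd d l)) with he
  have hex : ∀ t k, (∃ m, m ≠ i ∧ m ≠ l ∧ eig (Θ + t • e) k = eig Θ m) ∨
      (eig (Θ + t • e) k - eig Θ i) * (eig (Θ + t • e) k - eig Θ l) =
        t ^ 2 * eig (Θ + t • e) k := by
    intro t k
    obtain ⟨c, hc0, hc⟩ := eigen_equation hv i (Fin.castAdd d l) t k
    simp only [castLE_eq_castAdd, Finset.sum_ite_eq', Finset.mem_univ, if_true] at hc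
    change ∀ m, _ = eig (Θ + t • e) k * c m at hc
    set μ := eig (Θ + t • e) k
    by_cases hm : ∃ m, m ≠ i ∧ m ≠ l ∧ c m ≠ 0
    · obtain ⟨m, hmi, hml, hm0⟩ := hm
      refine Or.inl ⟨m, hmi, hml, ?_⟩
      have := hc m
      simp only [hmi, hml, if_false] at this
      exact mul_right_cancel₀ hm0 (by linarith)
    · right
      push Not at hm
      have hi := hc i
      have hl := hc l
      simp only [hil, hil.symm, if_false, if_true] at hi hl
      have hs : √(eig Θ l) ^ 2 = eig Θ l := Real.sq_sqrt (h.1 l).le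
      set σ := √(eig Θ l)
      -- Cramer's rule: the determinant of the 2 × 2 system annihilates both unknowns, so it
      -- vanishes unless the eigenvector is zero.
      have k1 : c i * ((μ - eig Θ i) * (μ - eig Θ l) - t ^ 2 * μ) = 0 := by
        linear_combination (eig Θ l - μ) * hi - t * σ * hl + t ^ 2 * c i * hs
      have k2 : c l * ((μ - eig Θ i) * (μ - eig Θ l) - t ^ 2 * μ) = 0 := by
        linear_combination (eig Θ i + t ^ 2 - μ) * hl - t * σ * hi + t ^ 2 * c l * hs
      by_contra hne
      have hne' := sub_ne_zero.mpr hne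
      refine hc0 (funext fun m => ?_)
      by_cases hmi : m = i
      · rw [hmi]; exact (mul_eq_zero.mp k1).resolve_right hne'
      by_cases hml : m = l
      · rw [hml]; exact (mul_eq_zero.mp k2).resolve_right hne'
      exact hm m hmi hml
  have htend : ∀ k, Tendsto (fun t : ℝ => eig (Θ + t • e) k) (𝓝 0) (𝓝 (eig Θ k)) := fun k =>
    ((continuous_eig k).tendsto Θ).comp (tendsto_line Θ e)
  have hne : ∀ k, ∀ᶠ t in 𝓝 (0 : ℝ), ∀ m, m ≠ k → eig (Θ + t • e) k ≠ eig Θ m := fun k => by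
    rw [eventually_all]
    intro m
    by_cases hm : m = k
    · simp [hm]
    · filter_upwards [(htend k).eventually_ne fun e' => hm (h.2 e').symm] with t ht _ using ht
  have hquad : ∀ k m : Fin r, k ≠ m → (∀ᶠ t in 𝓝 (0 : ℝ), (eig (Θ + t • e) k - eig Θ k) *
      (eig (Θ + t • e) k - eig Θ m) = t ^ 2 * eig (Θ + t • e) k) →
      Tendsto (fun t : ℝ => (eig (Θ + t • e) k - eig Θ k) / t ^ 2) (𝓝[≠] 0)
        (𝓝 (eig Θ k / (eig Θ k - eig Θ m))) := by
    intro k m hkm hq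
    have hkm' : eig Θ k - eig Θ m ≠ 0 := sub_ne_zero.mpr fun e' => hkm (h.2 e')
    have h1 := ((htend k).div ((htend k).sub_const (eig Θ m)) hkm').mono_left
      (nhdsWithin_le_nhds (s := {0}ᶜ))
    refine h1.congr' ?_
    filter_upwards [(hq.and (hne k)).filter_mono nhdsWithin_le_nhds, self_mem_nhdsWithin]
      with t ht ht0
    have ht0 : t ≠ 0 := ht0
    have hm0 : eig (Θ + t • e) k - eig Θ m ≠ 0 := sub_ne_zero.mpr (ht.2 m hkm.symm)
    rw [Pi.div_apply, div_eq_div_iff hm0 (pow_ne_zero 2 ht0)]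
    linarith [ht.1]
  rw [h.iteratedFDeriv_of_tendsto hε α (e := e) (c := fun k =>
    if k = i then eig Θ i / (eig Θ i - eig Θ l) else
      if k = l then eig Θ l / (eig Θ l - eig Θ i) else 0) fun k => ?_]
  · congr 2
    rw [Finset.sum_eq_add i l hil.symm]
    · simp [hil]
    · rintro m - ⟨hmi, hml⟩
      simp [hmi, hml]
    · simp
    · simp
  · by_cases hki : k = i
    · subst hki
      simp only [if_true]
      refine hquad k l hil.symm ?_
      filter_upwards [hne k] with t ht
      rcases hex t k with ⟨m, hm1, -, hm⟩ | hq
      · exact absurd hm (ht m hm1)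
      · exact hq
    by_cases hkl : k = l
    · subst hkl
      simp only [hki, if_false, if_true]
      refine hquad k i hil ?_
      filter_upwards [hne k] with t ht
      rcases hex t k with ⟨m, -, hm1, hm⟩ | hq
      · exact absurd hm (ht m hm1)
      · rw [mul_comm]; exact hq
    · simp only [hki, hkl, if_false]
      refine tendsto_const_nhds.congr' ?_
      -- For k other than i and l the quadratic relation fails in the limit, so the k-th eigenvalue
      -- must be one of the unperturbed ones, hence the k-th.
      have hz : Tendsto (fun t : ℝ => (eig (Θ + t • e) k - eig Θ i) * (eig (Θ + t • e) k - eig Θ l)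
          - t ^ 2 * eig (Θ + t • e) k) (𝓝 0)
          (𝓝 ((eig Θ k - eig Θ i) * (eig Θ k - eig Θ l) - 0 ^ 2 * eig Θ k)) :=
        (((htend k).sub_const _).mul ((htend k).sub_const _)).sub
          (((continuous_pow 2).tendsto (0 : ℝ)).mul (htend k))
      have hz0 : (eig Θ k - eig Θ i) * (eig Θ k - eig Θ l) - 0 ^ 2 * eig Θ k ≠ 0 := by
        rw [zero_pow two_ne_zero, zero_mul, sub_zero]
        exact mul_ne_zero (sub_ne_zero.mpr fun e' => hki (h.2 e'))
          (sub_ne_zero.mpr fun e' => hkl (h.2 e'))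
      filter_upwards [((hz.eventually_ne hz0).and (hne k)).filter_mono nhdsWithin_le_nhds] with t ht
      rcases hex t k with ⟨m, -, -, hm⟩ | hq
      · by_cases hmk : m = k
        · rw [hm, hmk]; simp
        · exact absurd hm (ht.2 m hmk)
      · exact absurd (sub_eq_zero.mpr hq) ht.1

end Lines

end MatrixPrediction

end

/-! ### The exponent inequality and the sign of the Laplacian. -/

noncomputable section

namespace MatrixPrediction

open MeasureTheory Filter
open scoped ENNReal Topology

variable {r q d : ℕ}

theorem sq_le_two_mul_sum_max {n : ℕ} {t : ℝ} (h0 : 0 ≤ t) (hn : t ≤ n) :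
    t ^ 2 ≤ 2 * ∑ k ∈ Finset.range n, max 0 (t - k) := by
  induction n with
  | zero =>
    have : t = 0 := le_antisymm (by simpa using hn) h0
    simp [this]
  | succ n ih =>
    rw [Finset.sum_range_succ]
    by_cases h : t ≤ n
    · have := ih h
      have := le_max_left 0 (t - n)
      linarith
    · push Not at h
      have h1 : ∑ k ∈ Finset.range n, max 0 (t - k) = ∑ k ∈ Finset.range n, (t - k) :=
        Finset.sum_congr rfl fun k hk => max_eq_right (by
          have : (k : ℝ) < n := by exact_mod_cast Finset.mem_range.mp hk
          linarith)
      have h2 : ∀ m : ℕ, 2 * ∑ k ∈ Finset.range m, (t - k) = m * (2 * t - m + 1) := fun m => by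
        induction m with
        | zero => simp
        | succ m ih => rw [Finset.sum_range_succ, mul_add, ih]; push_cast; ring
      rw [h1, max_eq_right (by linarith), mul_add, h2]
      push_cast at hn
      -- On n < t ≤ n + 1 the difference of the two sides is (t - n)(n + 1 - t) + t.
      nlinarith [mul_nonneg (sub_nonneg.mpr h.le) (sub_nonneg.mpr hn)]

theorem sum_fin_gt_eq (n : ℕ) (i : Fin n) (g : ℕ → ℝ) :
    (∑ l : Fin n, if i < l then g (n - 1 - l) else 0) = ∑ k ∈ Finset.range (n - 1 - i), g k := by
  rw [← Equiv.sum_comp Fin.revPerm]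
  have : ∀ l : Fin n, (if i < Fin.revPerm l then g (n - 1 - (Fin.revPerm l).val) else 0) =
      (fun k : ℕ => if k < n - 1 - i then g k else 0) l := fun l => by
    have hl := l.2
    have hi := i.2
    simp only [Fin.revPerm_apply, Fin.lt_def, Fin.val_rev]
    have e : n - 1 - (n - (l.val + 1)) = l := by omega
    rw [e]
    congr 1
    simp only [eq_iff_iff]
    omega
  rw [Finset.sum_congr rfl fun l _ => this l, Fin.sum_univ_eq_sum_range
    (fun k : ℕ => if k < n - 1 - i then g k else 0), ← Finset.sum_filter]
  congr 1
  ext k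
  simp only [Finset.mem_filter, Finset.mem_range]
  omega

/-- The inequality between the exponents behind the superharmonicity of the prior. -/
theorem exponent_inequality {α : Fin r → ℝ} (hα : ∀ i, 0 ≤ α i) (hanti : Antitone α)
    (hle : ∀ i : Fin r, α i ≤ ((r + d : ℕ) + (r : ℝ) - 2 * ((i : ℝ) + 1) - 1) / 2) (i : Fin r) :
    α i * (α i + 1 - d) ≤ 2 * ∑ l, if i < l then α i - α l else 0 := by
  have hpos : ∀ l, i < l → 0 ≤ α i - α l := fun l hl => sub_nonneg.mpr (hanti hl.le)
  have hr : 0 < r := i.pos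
  -- The constraint on the last exponent reads α ≤ (d - 1)/2; with α ≥ 0 it forces d ≥ 1.
  have hD : (0 : ℝ) ≤ (d : ℝ) - 1 := by
    have h1 := hle ⟨r - 1, by omega⟩
    have h2 := hα ⟨r - 1, by omega⟩
    simp only [Nat.cast_sub hr] at h1
    push_cast at h1
    linarith
  set D : ℝ := (d : ℝ) - 1 with hDdef
  set t := α i - D / 2 with ht
  have hlhs : α i * (α i + 1 - d) = t ^ 2 - D ^ 2 / 4 := by
    rw [ht, show (d : ℝ) = D + 1 by rw [hDdef]; ring]; ring
  rw [hlhs]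
  have hsum0 : 0 ≤ ∑ l, if i < l then α i - α l else 0 :=
    Finset.sum_nonneg fun l _ => by split_ifs with h; exacts [hpos l h, le_rfl]
  by_cases ht0 : t ≤ 0
  · have := hα i
    nlinarith
  · push Not at ht0
    have hcast : ∀ l : Fin r, ((r - 1 - l.val : ℕ) : ℝ) = r - 1 - l := fun l => by
      have := l.2
      rw [Nat.cast_sub (by omega), Nat.cast_sub (by omega)]
      push_cast; ring
    have hub : ∀ l : Fin r, α l ≤ D / 2 + ((r - 1 - l.val : ℕ) : ℝ) := fun l => by
      have := hle l
      rw [hcast]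
      push_cast at this
      linarith
    have h1 := sq_le_two_mul_sum_max ht0.le (n := r - 1 - i) (by linarith [hub i])
    rw [← sum_fin_gt_eq r i fun k => max 0 (t - k)] at h1
    have h2 : (∑ l : Fin r, if i < l then max 0 (t - ((r - 1 - l.val : ℕ) : ℝ)) else 0) ≤
        ∑ l, if i < l then α i - α l else 0 := Finset.sum_le_sum fun l _ => by
      split_ifs with h
      · exact max_le (hpos l h) (by linarith [hub l])
      · exact le_rfl
    nlinarith [sq_nonneg D]

theorem pair_inequality {a b x y ε : ℝ} (ha : b ≤ a) (hb : 0 ≤ b) (hy : 0 < y) (hxy : y < x)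
    (hε : 0 ≤ ε) :
    (a - b) / (x + ε) ≤ a * (x / (x - y)) / (x + ε) + b * (y / (y - x)) / (y + ε) := by
  have hx : 0 < x + ε := by linarith
  have hy' : 0 < y + ε := by linarith
  have hxy' : 0 < x - y := by linarith
  rw [show y - x = -(x - y) by ring, div_neg, mul_neg, neg_div, ← sub_eq_add_neg, ← sub_nonneg]
  have : a * (x / (x - y)) / (x + ε) - b * (y / (x - y)) / (y + ε) - (a - b) / (x + ε) =
      ((a - b) * y * (y + ε) + b * (ε * (x - y))) / ((x + ε) * (y + ε) * (x - y)) := by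
    field_simp
    ring
  rw [this]
  have := sub_nonneg.mpr ha
  positivity

theorem HasSimpleSpectrum.laplacian_regPrior_nonpos (hrq : r ≤ q) {ε : ℝ} (hε : 0 ≤ ε)
    {α : Fin r → ℝ} (hα : ∀ i, 0 ≤ α i) (hanti : Antitone α)
    (hle : ∀ i : Fin r, α i ≤ ((q : ℝ) + (r : ℝ) - 2 * ((i : ℝ) + 1) - 1) / 2)
    {Θ : Mat r q} (h : HasSimpleSpectrum Θ) : laplacian (regPrior ε α) Θ ≤ 0 := by
  obtain ⟨d, rfl⟩ := Nat.exists_eq_add_of_le hrq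
  obtain ⟨v, hv⟩ := h.exists_right_basis hrq
  have hF := regPrior_nonneg hε α Θ
  rw [laplacian_eq_sum_orthonormalBasis _ _ (outerBasis (eigBasis Θ) v)]
  simp only [outerBasis_apply, Fin.sum_univ_add]
  simp only [iteratedFDeriv_outer_natAdd h hv hε]
  set m : Fin r → ℝ := fun k => eig Θ k + ε with hm
  have hm0 : ∀ k, 0 < m k := fun k => add_pos_of_pos_of_nonneg (h.1 k) hε
  set T : Fin r → Fin r → ℝ := fun i l => if l = i then 0 else
    α i * (eig Θ i / (eig Θ i - eig Θ l)) / m i + α l * (eig Θ l / (eig Θ l - eig Θ i)) / m l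
    with hT
  set W : Fin r → Fin r → ℝ := fun i l => if i < l then (α i - α l) / m i else 0 with hW
  have hTW : ∀ i l, W i l + W l i ≤ T i l := by
    intro i l
    rcases lt_trichotomy i l with hil | hil | hil
    · have hlt : eig Θ l < eig Θ i := lt_of_le_of_ne (eig_antitone Θ hil.le) fun e => hil.ne' (h.2 e)
      simp only [hW, hT, hil, hil.ne', hil.not_gt, if_true, if_false, add_zero]
      exact pair_inequality (hanti hil.le) (hα l) (h.1 l) hlt hε
    · simp [hW, hT, hil]
    · have hlt : eig Θ i < eig Θ l := lt_of_le_of_ne (eig_antitone Θ hil.le) fun e => hil.ne' (h.2 e.symm).symm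
      simp only [hW, hT, hil, hil.ne, hil.not_gt, if_true, if_false, zero_add]
      rw [add_comm]
      exact pair_inequality (hanti hil.le) (hα i) (h.1 i) hlt hε
  have hrow : ∀ i, (∑ l, iteratedFDeriv ℝ 2 (regPrior ε α) Θ
        ![outer (eigBasis Θ i) (v (Fin.castAdd d l)), outer (eigBasis Θ i) (v (Fin.castAdd d l))])
        = regPrior ε α Θ * (-(α i) / m i + α i * (α i + 2) * eig Θ i / m i ^ 2 - ∑ l, T i l) := by
    intro i
    rw [← Finset.add_sum_erase _ _ (Finset.mem_univ i), iteratedFDeriv_outer_same h hv hε,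
      ← Finset.add_sum_erase _ (T i) (Finset.mem_univ i)]
    have h0 : T i i = 0 := by simp [hT]
    rw [h0, zero_add, mul_sub, sub_eq_add_neg, Finset.mul_sum, ← Finset.sum_neg_distrib]
    congr 1
    refine Finset.sum_congr rfl fun l hl => ?_
    have hli := Finset.ne_of_mem_erase hl
    rw [iteratedFDeriv_outer_castAdd h hv hε α hli]
    simp [hT, hli, hm]
  simp only [hrow]
  have hfac : ∑ i, (regPrior ε α Θ * (-(α i) / m i + α i * (α i + 2) * eig Θ i / m i ^ 2
      - ∑ l, T i l) + ∑ _j : Fin d, -(regPrior ε α Θ * (α i / (eig Θ i + ε)))) =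
      regPrior ε α Θ * (∑ i, (-(α i) / m i + α i * (α i + 2) * eig Θ i / m i ^ 2 - d * (α i / m i))
        - ∑ i, ∑ l, T i l) := by
    rw [← Finset.sum_sub_distrib, Finset.mul_sum]
    refine Finset.sum_congr rfl fun i _ => ?_
    simp only [Finset.sum_const, Finset.card_univ, Fintype.card_fin, nsmul_eq_mul, hm]
    ring
  rw [hfac]
  refine mul_nonpos_of_nonneg_of_nonpos hF ?_
  have h1 : ∑ i, ∑ l, (W i l + W l i) ≤ ∑ i, ∑ l, T i l :=
    Finset.sum_le_sum fun i _ => Finset.sum_le_sum fun l _ => hTW i l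
  have h2 : ∑ i, ∑ l, (W i l + W l i) = ∑ i, 2 * ∑ l, W i l := by
    simp only [Finset.sum_add_distrib]
    rw [Finset.sum_comm (f := fun i l => W l i), ← Finset.mul_sum]
    ring
  have h3 : ∑ i, (-(α i) / m i + α i * (α i + 2) * eig Θ i / m i ^ 2 - d * (α i / m i)) ≤
      ∑ i, 2 * ∑ l, W i l := by
    refine Finset.sum_le_sum fun i _ => ?_
    have k1 := exponent_inequality (d := d) hα hanti hle i
    have k2 : ∑ l, W i l = (∑ l, if i < l then α i - α l else 0) / m i := by
      rw [Finset.sum_div]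
      exact Finset.sum_congr rfl fun l _ => by simp only [hW]; split_ifs <;> simp
    have k3 : α i * (α i + 2) * eig Θ i / m i ^ 2 ≤ α i * (α i + 2) / m i := by
      have := hα i
      have := hm0 i
      rw [div_le_div_iff₀ (by positivity) (by positivity), sq, mul_assoc (α i * (α i + 2))]
      refine mul_le_mul_of_nonneg_left ?_ (by positivity)
      exact mul_le_mul_of_nonneg_right (by simp [hm, hε]) (by positivity)
    have k4 := div_le_div_of_nonneg_right k1 (hm0 i).le
    rw [k2]
    have k5 : -(α i) / m i + α i * (α i + 2) / m i - d * (α i / m i) =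
        α i * (α i + 1 - d) / m i := by ring
    rw [mul_div_assoc (2 : ℝ)] at k4
    linarith
  linarith

theorem dense_hasSimpleSpectrum (hrq : r ≤ q) : Dense {Θ : Mat r q | HasSimpleSpectrum Θ} :=
  Measure.dense_of_ae (ae_hasSimpleSpectrum hrq)

theorem laplacian_priorST_nonpos (hrq : r ≤ q)
    {α : Fin r → ℝ} (hα : ∀ i, 0 ≤ α i) (hanti : Antitone α)
    (hle : ∀ i : Fin r, α i ≤ ((q : ℝ) + (r : ℝ) - 2 * ((i : ℝ) + 1) - 1) / 2)
    {Θ : Mat r q} (h : ContDiffAt ℝ 2 (priorST α) Θ) : laplacian (priorST α) Θ ≤ 0 := by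
  have hc : ContinuousAt (fun Θ' : Mat r q => laplacian (priorST α) Θ') Θ := by
    unfold laplacian
    have h1 : ContinuousAt (iteratedFDeriv ℝ 2 (priorST α : Mat r q → ℝ)) Θ :=
      (h.iteratedFDeriv_right (m := 0) (i := 2) (by norm_num)).continuousAt
    refine tendsto_finsetSum _ fun i _ => tendsto_finsetSum _ fun j _ => ?_
    exact ((ContinuousMultilinearMap.apply ℝ _ ℝ
      ![EuclideanSpace.single (i, j) (1 : ℝ), EuclideanSpace.single (i, j) (1 : ℝ)]).continuous.tendsto _).comp h1
  have : (𝓝[{Θ : Mat r q | HasSimpleSpectrum Θ}] Θ).NeBot :=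
    mem_closure_iff_nhdsWithin_neBot.mp (dense_hasSimpleSpectrum hrq Θ)
  refine le_of_tendsto (hc.mono_left (nhdsWithin_le_nhds (s := {Θ | HasSimpleSpectrum Θ}))) ?_
  filter_upwards [self_mem_nhdsWithin] with Θ' hΘ'
  have := HasSimpleSpectrum.laplacian_regPrior_nonpos hrq le_rfl hα hanti hle (Θ := Θ') hΘ'
  rwa [regPrior_zero] at this

end MatrixPrediction

end

noncomputable section

namespace MatrixPrediction

open MeasureTheory Filter
open scoped ENNReal Topology

variable {r q : ℕ}

/-! ### The Gaussian kernel -/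

theorem normalDensity_pos {v : ℝ} (hv : 0 < v) (Θ X : Mat r q) : 0 < normalDensity v Θ X :=
  mul_pos (Real.rpow_pos_of_pos (by positivity) _) (Real.exp_pos _)

theorem normalDensity_comm (v : ℝ) (Θ X : Mat r q) : normalDensity v Θ X = normalDensity v X Θ := by
  rw [normalDensity, normalDensity, norm_sub_rev]

theorem normalDensity_eq_sub (v : ℝ) (Θ X : Mat r q) :
    normalDensity v Θ X = normalDensity v 0 (X - Θ) := by
  rw [normalDensity, normalDensity, sub_zero]

theorem normalDensity_neg (v : ℝ) (X : Mat r q) : normalDensity v 0 (-X) = normalDensity v 0 X := by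
  simp [normalDensity]

theorem continuous_normalDensity_left (v : ℝ) (X : Mat r q) :
    Continuous fun Θ : Mat r q => normalDensity v Θ X := by
  unfold normalDensity
  fun_prop

theorem continuous_normalDensity_right (v : ℝ) (Θ : Mat r q) :
    Continuous fun X : Mat r q => normalDensity v Θ X := by
  unfold normalDensity
  fun_prop

theorem measurable_normalDensity_comp {β : Type*} [MeasurableSpace β] {f g : β → Mat r q}
    (hf : Measurable f) (hg : Measurable g) (v : ℝ) :
    Measurable fun x => normalDensity v (f x) (g x) := by
  unfold normalDensity
  fun_prop

theorem integral_normalDensity {v : ℝ} (hv : 0 < v) (Θ : Mat r q) :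
    ∫ X, normalDensity v Θ X = 1 := by
  simp_rw [normalDensity_eq_sub v Θ]
  rw [integral_sub_right_eq_self (fun X => normalDensity v (0 : Mat r q) X)]
  unfold normalDensity
  rw [integral_const_mul]
  have h := GaussianFourier.integral_rexp_neg_mul_sq_norm (V := Mat r q) (b := (2 * v)⁻¹)
    (by positivity)
  have e : ∀ X : Mat r q, -‖X - 0‖ ^ 2 / (2 * v) = -(2 * v)⁻¹ * ‖X‖ ^ 2 := fun X => by
    rw [sub_zero]; ring
  simp_rw [e]
  rw [h, finrank_euclideanSpace, Fintype.card_prod, Fintype.card_fin, Fintype.card_fin, div_inv_eq_mul,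
    show Real.pi * (2 * v) = 2 * Real.pi * v by ring, neg_div]
  push_cast
  rw [← Real.rpow_add (by positivity), neg_add_cancel, Real.rpow_zero]

theorem integrable_normalDensity {v : ℝ} (hv : 0 < v) (Θ : Mat r q) :
    Integrable fun X => normalDensity v Θ X := by
  by_contra h
  have := integral_normalDensity hv Θ
  rw [integral_undef h] at this
  exact zero_ne_one this

theorem lintegral_normalDensity {v : ℝ} (hv : 0 < v) (Θ : Mat r q) :
    ∫⁻ X, ENNReal.ofReal (normalDensity v Θ X) = 1 := by
  rw [← ofReal_integral_eq_lintegral_ofReal (integrable_normalDensity hv Θ)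
    (ae_of_all _ fun X => (normalDensity_pos hv Θ X).le), integral_normalDensity hv,
    ENNReal.ofReal_one]

theorem lintegral_normalDensity_left {v : ℝ} (hv : 0 < v) (X : Mat r q) :
    ∫⁻ Θ, ENNReal.ofReal (normalDensity v Θ X) = 1 := by
  simpa only [normalDensity_comm v _ X] using lintegral_normalDensity hv X

theorem normalDensity_mul {u v : ℝ} (hu : 0 < u) (hv : 0 < v) (Θ X Y : Mat r q) :
    normalDensity u Θ X * normalDensity v Θ Y =
      normalDensity (u + v) X Y *
        normalDensity (u * v / (u + v)) Θ ((v / (u + v)) • X + (u / (u + v)) • Y) := by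
  have huv : 0 < u + v := add_pos hu hv
  unfold normalDensity
  set p := -((r : ℝ) * (q : ℝ)) / 2
  have h1 : (2 * Real.pi * u) ^ p * (2 * Real.pi * v) ^ p =
      (2 * Real.pi * (u + v)) ^ p * (2 * Real.pi * (u * v / (u + v))) ^ p := by
    rw [← Real.mul_rpow (by positivity) (by positivity),
      ← Real.mul_rpow (by positivity) (by positivity)]
    congr 1
    field_simp
  have h2 : -‖X - Θ‖ ^ 2 / (2 * u) + -‖Y - Θ‖ ^ 2 / (2 * v) = -‖Y - X‖ ^ 2 / (2 * (u + v)) +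
      -‖(v / (u + v)) • X + (u / (u + v)) • Y - Θ‖ ^ 2 / (2 * (u * v / (u + v))) := by
    have e1 : Y - X = (Y - Θ) - (X - Θ) := by abel
    have e2 : (v / (u + v)) • X + (u / (u + v)) • Y - Θ =
        (v / (u + v)) • (X - Θ) + (u / (u + v)) • (Y - Θ) := by
      rw [smul_sub, smul_sub]
      have : Θ = (v / (u + v)) • Θ + (u / (u + v)) • Θ := by
        rw [← add_smul, ← add_div, add_comm v u, div_self huv.ne', one_smul]
      nth_rw 1 [this]
      abel
    rw [e1, e2]
    generalize X - Θ = a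
    generalize Y - Θ = b
    rw [norm_sub_sq_real, norm_add_sq_real, inner_smul_left, inner_smul_right, norm_smul,
      norm_smul, real_inner_comm, Real.norm_of_nonneg (by positivity),
      Real.norm_of_nonneg (by positivity)]
    simp only [conj_trivial]
    field_simp
    ring
  rw [mul_mul_mul_comm, h1, ← Real.exp_add, h2, Real.exp_add]
  ring

theorem lintegral_normalDensity_mul {u v : ℝ} (hu : 0 < u) (hv : 0 < v) (X Y : Mat r q) :
    ∫⁻ Θ, ENNReal.ofReal (normalDensity u Θ X) * ENNReal.ofReal (normalDensity v Θ Y) =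
      ENNReal.ofReal (normalDensity (u + v) X Y) := by
  have huv : 0 < u + v := add_pos hu hv
  simp_rw [← ENNReal.ofReal_mul (normalDensity_pos hu _ X).le, normalDensity_mul hu hv,
    ENNReal.ofReal_mul (normalDensity_pos huv X Y).le]
  rw [lintegral_const_mul' _ _ ENNReal.ofReal_ne_top,
    lintegral_normalDensity_left (by positivity), mul_one]

theorem integral_normalDensity_mul {u v : ℝ} (hu : 0 < u) (hv : 0 < v) (X Y : Mat r q) :
    ∫ Θ, normalDensity u Θ X * normalDensity v Θ Y = normalDensity (u + v) X Y := by
  simp_rw [normalDensity_mul hu hv, integral_const_mul, normalDensity_comm _ _ (_ + _)]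
  rw [integral_normalDensity (div_pos (mul_pos hu hv) (add_pos hu hv)), mul_one]

theorem normalDensity_smul {v c : ℝ} (hv : 0 < v) (hc : 0 < c) (X : Mat r q) :
    normalDensity (c ^ 2 * v) 0 (c • X) = c ^ (-((r : ℝ) * q)) * normalDensity v 0 X := by
  unfold normalDensity
  rw [show 2 * Real.pi * (c ^ 2 * v) = c ^ 2 * (2 * Real.pi * v) by ring,
    Real.mul_rpow (by positivity) (by positivity), ← Real.rpow_natCast c 2, ← Real.rpow_mul hc.le,
    mul_assoc]
  congr 1
  · congr 1; push_cast; ring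
  · congr 2
    rw [sub_zero, sub_zero, norm_smul, Real.norm_of_nonneg hc.le, Real.rpow_natCast]
    field_simp

/-- The Gaussian average, as an integral against the standard Gaussian density. -/
theorem integral_normalDensity_mul_eq {s : ℝ} (hs : 0 < s) (f : Mat r q → ℝ) (x : Mat r q) :
    ∫ y, normalDensity s x y * f y = ∫ z, normalDensity 1 0 z * f (x + √s • z) := by
  have hc : 0 < √s := Real.sqrt_pos.mpr hs
  have h1 : ∫ y, normalDensity s x y * f y = ∫ y, normalDensity s 0 y * f (x + y) := by
    rw [← integral_add_left_eq_self _ x]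
    simp_rw [normalDensity_eq_sub s x, add_sub_cancel_left]
  have h2 := Measure.integral_comp_smul_of_nonneg (μ := (volume : Measure (Mat r q)))
    (fun y => normalDensity s 0 y * f (x + y)) (√s) (hR := hc.le)
  rw [h1]
  have h3 : ∀ z : Mat r q, normalDensity s 0 (√s • z) = (√s) ^ (-((r : ℝ) * q)) *
      normalDensity 1 0 z := fun z => by
    have := normalDensity_smul one_pos hc z
    rwa [mul_one, Real.sq_sqrt hs.le] at this
  simp_rw [h3, mul_assoc] at h2
  rw [integral_const_mul, finrank_euclideanSpace, Fintype.card_prod, Fintype.card_fin,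
    Fintype.card_fin, smul_eq_mul, Real.rpow_neg hc.le, ← Nat.cast_mul, Real.rpow_natCast] at h2
  exact (mul_left_cancel₀ (inv_ne_zero (pow_ne_zero _ hc.ne')) h2).symm

/-! ### Moments -/

theorem normalDensity_one_eq_prod (z : Mat r q) :
    normalDensity 1 0 z = ∏ p, ProbabilityTheory.gaussianPDFReal 0 1 (z p) := by
  simp only [ProbabilityTheory.gaussianPDFReal_def, Finset.prod_mul_distrib, Finset.prod_const,
    Finset.card_univ, Fintype.card_prod, Fintype.card_fin, ← Real.exp_sum, normalDensity, sub_zero,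
    EuclideanSpace.real_norm_sq_eq, NNReal.coe_one, mul_one]
  congr 1
  · rw [Real.sqrt_eq_rpow, ← Real.rpow_neg (by positivity), ← Real.rpow_natCast,
      ← Real.rpow_mul (by positivity)]
    congr 1; push_cast; ring
  · rw [← Finset.sum_neg_distrib, Finset.sum_div]

theorem integrable_pow_mul_gaussianPDFReal (k : ℕ) :
    Integrable fun x : ℝ => ProbabilityTheory.gaussianPDFReal 0 1 x * x ^ k := by
  have h := (ProbabilityTheory.memLp_id_gaussianReal (μ := 0) (v := 1) k).integrable_norm_pow'
  rw [ProbabilityTheory.gaussianReal_of_var_ne_zero 0 one_ne_zero] at h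
  rw [integrable_withDensity_iff (ProbabilityTheory.measurable_gaussianPDF 0 1)
    (ae_of_all _ fun _ => ProbabilityTheory.gaussianPDF_lt_top)] at h
  refine h.mono' ?_ (ae_of_all _ fun x => ?_)
  · exact ((ProbabilityTheory.measurable_gaussianPDFReal 0 1).mul
      (measurable_id.pow_const k)).aestronglyMeasurable
  · rw [ProbabilityTheory.toReal_gaussianPDF, norm_mul, norm_pow,
      Real.norm_of_nonneg (ProbabilityTheory.gaussianPDFReal_nonneg 0 1 x), mul_comm]
    exact le_rfl

theorem integrable_prod_pow_mul_normalDensity (k : Fin r × Fin q → ℕ) :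
    Integrable fun z : Mat r q => normalDensity 1 0 z * ∏ p, z p ^ k p := by
  simp_rw [normalDensity_one_eq_prod, ← Finset.prod_mul_distrib]
  have := Integrable.fintype_prod (f := fun p (x : ℝ) =>
    ProbabilityTheory.gaussianPDFReal 0 1 x * x ^ k p) (μ := fun _ => volume)
    fun p : Fin r × Fin q => integrable_pow_mul_gaussianPDFReal (k p)
  rw [← volume_pi] at this
  exact ((EuclideanSpace.volume_preserving_symm_measurableEquiv_toLp
    (Fin r × Fin q)).integrable_comp_emb (MeasurableEquiv.measurableEmbedding _)).mpr this

theorem integral_prod_pow_mul_normalDensity (k : Fin r × Fin q → ℕ) :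
    ∫ z : Mat r q, normalDensity 1 0 z * ∏ p, z p ^ k p =
      ∏ p, ∫ x : ℝ, ProbabilityTheory.gaussianPDFReal 0 1 x * x ^ k p := by
  simp_rw [normalDensity_one_eq_prod, ← Finset.prod_mul_distrib]
  rw [← integral_fintype_prod_volume_eq_prod (fun p (x : ℝ) =>
    ProbabilityTheory.gaussianPDFReal 0 1 x * x ^ k p)]
  exact (EuclideanSpace.volume_preserving_symm_measurableEquiv_toLp
    (Fin r × Fin q)).integral_comp (MeasurableEquiv.measurableEmbedding _)
      (fun w : Fin r × Fin q → ℝ => ∏ p, ProbabilityTheory.gaussianPDFReal 0 1 (w p) * w p ^ k p)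

theorem gaussian_moment_zero : ∫ x : ℝ, ProbabilityTheory.gaussianPDFReal 0 1 x * x ^ 0 = 1 := by
  simpa using ProbabilityTheory.integral_gaussianPDFReal_eq_one 0 one_ne_zero

theorem gaussian_moment_one : ∫ x : ℝ, ProbabilityTheory.gaussianPDFReal 0 1 x * x ^ 1 = 0 := by
  have := ProbabilityTheory.integral_id_gaussianReal (μ := 0) (v := 1)
  rw [ProbabilityTheory.integral_gaussianReal_eq_integral_smul one_ne_zero] at this
  simpa using this

theorem gaussian_moment_two : ∫ x : ℝ, ProbabilityTheory.gaussianPDFReal 0 1 x * x ^ 2 = 1 := by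
  have := ProbabilityTheory.variance_fun_id_gaussianReal (μ := 0) (v := 1)
  rw [ProbabilityTheory.variance_of_integral_eq_zero (by fun_prop)
    ProbabilityTheory.integral_id_gaussianReal,
    ProbabilityTheory.integral_gaussianReal_eq_integral_smul one_ne_zero] at this
  simpa using this

theorem mul_eq_prod_pow (z : Mat r q) (a b : Fin r × Fin q) :
    z a * z b = ∏ p, z p ^ ((if p = a then 1 else 0) + (if p = b then 1 else 0)) := by
  simp only [pow_add, Finset.prod_mul_distrib, pow_ite, pow_one, pow_zero, Finset.prod_ite_eq',
    Finset.mem_univ, if_true]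

theorem integrable_normalDensity_mul_apply (a b : Fin r × Fin q) :
    Integrable fun z : Mat r q => normalDensity 1 0 z * (z a * z b) := by
  simp_rw [mul_eq_prod_pow]
  exact integrable_prod_pow_mul_normalDensity _

theorem integral_normalDensity_mul_apply (a b : Fin r × Fin q) :
    ∫ z : Mat r q, normalDensity 1 0 z * (z a * z b) = if a = b then 1 else 0 := by
  simp_rw [mul_eq_prod_pow]
  rw [integral_prod_pow_mul_normalDensity]
  split_ifs with h
  · subst h
    refine Finset.prod_eq_one fun p _ => ?_
    by_cases hp : p = a
    · simpa [hp] using gaussian_moment_two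
    · simpa [hp] using gaussian_moment_zero
  · refine Finset.prod_eq_zero (Finset.mem_univ a) ?_
    simpa [h] using gaussian_moment_one

theorem integrable_normalDensity_mul_norm_sq :
    Integrable fun z : Mat r q => normalDensity 1 0 z * ‖z‖ ^ 2 := by
  simp_rw [EuclideanSpace.real_norm_sq_eq, Finset.mul_sum, sq]
  exact integrable_finsetSum _ fun a _ => integrable_normalDensity_mul_apply a a

/-- The Gaussian average of a quadratic form is its trace. -/
theorem integral_normalDensity_mul_bilin (B : Mat r q →L[ℝ] Mat r q →L[ℝ] ℝ) :
    Integrable (fun z : Mat r q => normalDensity 1 0 z * B z z) ∧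
    ∫ z : Mat r q, normalDensity 1 0 z * B z z =
      ∑ a, B (EuclideanSpace.single a 1) (EuclideanSpace.single a 1) := by
  have hz : ∀ z : Mat r q, B z z = ∑ a, ∑ b, (z a * z b) *
      B (EuclideanSpace.single a 1) (EuclideanSpace.single b 1) := fun z => by
    have e : z = ∑ a, z a • EuclideanSpace.single a (1 : ℝ) := by
      ext p; simp [Finset.sum_apply, Pi.single_apply]
    conv_lhs => rw [e]
    simp only [map_sum, _root_.sum_apply, map_smul, _root_.smul_apply,
      smul_eq_mul, Finset.mul_sum]
    rw [Finset.sum_comm]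
    exact Finset.sum_congr rfl fun _ _ => Finset.sum_congr rfl fun _ _ => by ring
  simp_rw [hz, Finset.mul_sum, ← mul_assoc _ (_ * _)]
  have hi : ∀ a b : Fin r × Fin q, Integrable fun z : Mat r q => normalDensity 1 0 z * (z a * z b) *
      B (EuclideanSpace.single a 1) (EuclideanSpace.single b 1) := fun a b =>
    (integrable_normalDensity_mul_apply a b).mul_const _
  refine ⟨integrable_finsetSum _ fun a _ => integrable_finsetSum _ fun b _ => hi a b, ?_⟩
  rw [integral_finsetSum _ fun a _ => integrable_finsetSum _ fun b _ => hi a b]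
  refine Finset.sum_congr rfl fun a _ => ?_
  rw [integral_finsetSum _ fun b _ => hi a b]
  simp_rw [integral_mul_const, integral_normalDensity_mul_apply, ite_mul, one_mul, zero_mul]
  simp

end MatrixPrediction

end

noncomputable section

namespace MatrixPrediction

open MeasureTheory Filter
open scoped ENNReal Topology

variable {r q : ℕ}

/-! ### The heat semigroup -/

/-- The Gaussian average of a nonnegative function, with variance `s`. -/
def lheat (s : ℝ) (F : Mat r q → ℝ≥0∞) (x : Mat r q) : ℝ≥0∞ :=
  ∫⁻ y, ENNReal.ofReal (normalDensity s x y) * F y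

theorem lheat_lheat {s t : ℝ} (hs : 0 < s) (ht : 0 < t) {F : Mat r q → ℝ≥0∞} (hF : Measurable F)
    (x : Mat r q) : lheat s (lheat t F) x = lheat (s + t) F x := by
  unfold lheat
  have hm1 : Measurable fun p : Mat r q × Mat r q =>
      ENNReal.ofReal (normalDensity s x p.1) * (ENNReal.ofReal (normalDensity t p.1 p.2) * F p.2) :=
    (measurable_normalDensity_comp measurable_const measurable_fst s).ennreal_ofReal.mul
      ((measurable_normalDensity_comp measurable_fst measurable_snd t).ennreal_ofReal.mul
        (hF.comp measurable_snd))
  have h1 : ∀ y, ENNReal.ofReal (normalDensity s x y) *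
      ∫⁻ w, ENNReal.ofReal (normalDensity t y w) * F w =
      ∫⁻ w, ENNReal.ofReal (normalDensity s x y) * (ENNReal.ofReal (normalDensity t y w) * F w) :=
    fun y => (lintegral_const_mul' _ _ ENNReal.ofReal_ne_top).symm
  simp_rw [h1]
  rw [lintegral_lintegral_swap hm1.aemeasurable]
  refine lintegral_congr fun w => ?_
  simp_rw [← mul_assoc]
  rw [lintegral_mul_const _ (by
    exact ((continuous_normalDensity_right s x).measurable.ennreal_ofReal).mul
      (continuous_normalDensity_left t w).measurable.ennreal_ofReal)]
  congr 1
  simp_rw [normalDensity_comm s x]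
  exact lintegral_normalDensity_mul hs ht x w

/-- The Gaussian average of a function, with variance `s`. -/
def heat (s : ℝ) (f : Mat r q → ℝ) (x : Mat r q) : ℝ := ∫ y, normalDensity s x y * f y

theorem integrable_normalDensity_mul {s : ℝ} (hs : 0 < s) {f : Mat r q → ℝ} (hf : Measurable f)
    {M : ℝ} (hM : ∀ x, |f x| ≤ M) (x : Mat r q) :
    Integrable fun y => normalDensity s x y * f y :=
  (integrable_normalDensity hs x).mul_bdd (c := M) hf.aestronglyMeasurable
    (ae_of_all _ fun y => by simpa using hM y)

theorem ofReal_heat {s : ℝ} (hs : 0 < s) {f : Mat r q → ℝ} (hf : Measurable f) (h0 : ∀ x, 0 ≤ f x)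
    {M : ℝ} (hM : ∀ x, |f x| ≤ M) (x : Mat r q) :
    ENNReal.ofReal (heat s f x) = lheat s (fun y => ENNReal.ofReal (f y)) x := by
  rw [heat, ofReal_integral_eq_lintegral_ofReal (integrable_normalDensity_mul hs hf hM x)
    (ae_of_all _ fun y => mul_nonneg (normalDensity_pos hs x y).le (h0 y))]
  exact lintegral_congr fun y => ENNReal.ofReal_mul (normalDensity_pos hs x y).le

theorem heat_nonneg {s : ℝ} (hs : 0 < s) {f : Mat r q → ℝ} (h0 : ∀ x, 0 ≤ f x) (x : Mat r q) :
    0 ≤ heat s f x :=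
  integral_nonneg fun y => mul_nonneg (normalDensity_pos hs x y).le (h0 y)

theorem heat_le {s : ℝ} (hs : 0 < s) {f : Mat r q → ℝ} (hf : Measurable f)
    {M : ℝ} (hM : ∀ x, |f x| ≤ M) (x : Mat r q) : heat s f x ≤ M := by
  have : heat s f x ≤ ∫ y, normalDensity s x y * M := by
    refine integral_mono (integrable_normalDensity_mul hs hf hM x)
      ((integrable_normalDensity hs x).mul_const M) fun y => ?_
    exact mul_le_mul_of_nonneg_left ((le_abs_self _).trans (hM y)) (normalDensity_pos hs x y).le
  rwa [integral_mul_const, integral_normalDensity hs, one_mul] at this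

theorem measurable_heat (s : ℝ) {f : Mat r q → ℝ} (hf : Measurable f) : Measurable (heat s f) := by
  have h : Measurable fun p : Mat r q × Mat r q => normalDensity s p.1 p.2 * f p.2 :=
    (measurable_normalDensity_comp measurable_fst measurable_snd s).mul (hf.comp measurable_snd)
  exact h.stronglyMeasurable.integral_prod_right'.measurable

theorem heat_heat {s t : ℝ} (hs : 0 < s) (ht : 0 < t) {f : Mat r q → ℝ} (hf : Measurable f)
    (h0 : ∀ x, 0 ≤ f x) {M : ℝ} (hM : ∀ x, |f x| ≤ M) (x : Mat r q) :
    heat s (heat t f) x = heat (s + t) f x := by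
  have hM' : ∀ y, |heat t f y| ≤ M := fun y => by
    rw [abs_of_nonneg (heat_nonneg ht h0 y)]; exact heat_le ht hf hM y
  rw [← ENNReal.ofReal_eq_ofReal_iff (heat_nonneg hs (heat_nonneg ht h0) x)
    (heat_nonneg (add_pos hs ht) h0 x), ofReal_heat hs (measurable_heat t hf) (heat_nonneg ht h0) hM',
    ofReal_heat (add_pos hs ht) hf h0 hM, ← lheat_lheat hs ht hf.ennreal_ofReal]
  simp_rw [ofReal_heat ht hf h0 hM]

/-- Bounded, semiconcave functions that are superharmonic almost everywhere. -/
structure IsSemiconcaveSuperharmonic (f : Mat r q → ℝ) : Prop where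
  continuous : Continuous f
  nonneg : ∀ x, 0 ≤ f x
  bounded : ∃ M, ∀ x, |f x| ≤ M
  semiconcave : ∃ C, 0 ≤ C ∧ ∀ x h, f (x + h) + f (x - h) - 2 * f x ≤ C * ‖h‖ ^ 2
  superharmonic : ∀ᵐ x, ContDiffAt ℝ 2 f x ∧ laplacian f x ≤ 0

namespace IsSemiconcaveSuperharmonic

variable {f : Mat r q → ℝ}

theorem heat_sq_sub (hf : IsSemiconcaveSuperharmonic f) {t : ℝ} (ht : 0 < t) (x : Mat r q) :
    heat (t ^ 2) f x - f x =
      t ^ 2 / 2 * ∫ z, normalDensity 1 0 z * ((f (x + t • z) + f (x - t • z) - 2 * f x) / t ^ 2) := by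
  obtain ⟨M, hM⟩ := hf.bounded
  have hfm := hf.continuous.measurable
  have h1 : heat (t ^ 2) f x = ∫ z, normalDensity 1 0 z * f (x + t • z) := by
    rw [heat, integral_normalDensity_mul_eq (by positivity), Real.sqrt_sq ht.le]
  have h2 : heat (t ^ 2) f x = ∫ z, normalDensity 1 0 z * f (x - t • z) := by
    rw [h1, ← integral_neg_eq_self]
    simp_rw [normalDensity_neg, smul_neg, sub_eq_add_neg]
  have h3 : f x = ∫ z : Mat r q, normalDensity 1 0 z * f x := by
    rw [integral_mul_const, integral_normalDensity one_pos, one_mul]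
  have i1 : Integrable fun z : Mat r q => normalDensity 1 0 z * f (x + t • z) :=
    integrable_normalDensity_mul one_pos (hfm.comp (by fun_prop)) (M := M) (fun z => hM _) 0
  have i2 : Integrable fun z : Mat r q => normalDensity 1 0 z * f (x - t • z) :=
    integrable_normalDensity_mul one_pos (hfm.comp (by fun_prop)) (M := M) (fun z => hM _) 0
  have i3 : Integrable fun z : Mat r q => normalDensity 1 0 z * f x :=
    (integrable_normalDensity one_pos 0).mul_const _
  have h4 : ∫ z, normalDensity 1 0 z * ((f (x + t • z) + f (x - t • z) - 2 * f x) / t ^ 2) =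
      (∫ z, normalDensity 1 0 z * f (x + t • z) + normalDensity 1 0 z * f (x - t • z)
        - 2 * (normalDensity 1 0 z * f x)) / t ^ 2 := by
    rw [← integral_div]
    congr 1; ext z; ring
  have i12 : Integrable fun z : Mat r q => normalDensity 1 0 z * f (x + t • z) +
      normalDensity 1 0 z * f (x - t • z) := i1.add i2
  rw [h4, integral_sub i12 (i3.const_mul 2), integral_add i1 i2, integral_const_mul, ← h1,
    ← h2, ← h3]
  field_simp
  ring

theorem integrable_quotient (hf : IsSemiconcaveSuperharmonic f) {t : ℝ} (ht : 0 < t) (x : Mat r q) :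
    Integrable fun z : Mat r q => normalDensity 1 0 z *
      ((f (x + t • z) + f (x - t • z) - 2 * f x) / t ^ 2) := by
  obtain ⟨M, hM⟩ := hf.bounded
  have hfc := hf.continuous
  have h1 : Continuous fun z : Mat r q => f (x + t • z) := hfc.comp (by fun_prop)
  have h2 : Continuous fun z : Mat r q => f (x - t • z) := hfc.comp (by fun_prop)
  refine integrable_normalDensity_mul one_pos
    (f := fun z => (f (x + t • z) + f (x - t • z) - 2 * f x) / t ^ 2)
    (((h1.add h2).sub continuous_const).div_const _).measurable (M := 4 * M / t ^ 2) (fun z => ?_) 0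
  rw [abs_div, abs_of_pos (show 0 < t ^ 2 by positivity)]
  refine div_le_div_of_nonneg_right ?_ (by positivity)
  have h1 := hM (x + t • z)
  have h2 := hM (x - t • z)
  have h3 := hM x
  rw [abs_le] at *
  constructor <;> linarith

theorem tendsto_max_heat_quotient (hf : IsSemiconcaveSuperharmonic f) {x : Mat r q}
    (hx : ContDiffAt ℝ 2 f x) (hlap : laplacian f x ≤ 0) :
    Tendsto (fun t => max 0 ((heat (t ^ 2) f x - f x) / t ^ 2)) (𝓝[>] 0) (𝓝 0) := by
  obtain ⟨M, hM⟩ := hf.bounded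
  obtain ⟨C, hC, hsc⟩ := hf.semiconcave
  have hfc := hf.continuous
  set B := fderiv ℝ (fderiv ℝ f) x with hB
  have hBz : ∀ z, iteratedFDeriv ℝ 2 f x ![z, z] = B z z := fun z => by
    rw [iteratedFDeriv_two_apply]; rfl
  obtain ⟨hBi, hBt⟩ := integral_normalDensity_mul_bilin B
  have htr : ∫ z : Mat r q, normalDensity 1 0 z * B z z = laplacian f x := by
    rw [hBt, laplacian, Fintype.sum_prod_type]
    simp_rw [hBz]
  set Q : ℝ → Mat r q → ℝ := fun t z => (f (x + t • z) + f (x - t • z) - 2 * f x) / t ^ 2 with hQ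
  set G : ℝ → Mat r q → ℝ := fun t z => max 0 (normalDensity 1 0 z * (Q t z - B z z)) with hG
  have hQc : ∀ t, Continuous (Q t) := fun t => by
    have h1 : Continuous fun z : Mat r q => f (x + t • z) := hfc.comp (by fun_prop)
    have h2 : Continuous fun z : Mat r q => f (x - t • z) := hfc.comp (by fun_prop)
    exact ((h1.add h2).sub continuous_const).div_const _
  have hBc : Continuous fun z : Mat r q => B z z := by fun_prop
  have hNc : Continuous fun z : Mat r q => normalDensity 1 0 z := continuous_normalDensity_right 1 0
  have hN : ∀ z : Mat r q, 0 ≤ normalDensity 1 0 z := fun z => (normalDensity_pos one_pos _ _).le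
  have hlim : Tendsto (fun t => ∫ z, G t z) (𝓝[>] 0) (𝓝 (∫ _z : Mat r q, (0 : ℝ))) := by
    refine tendsto_integral_filter_of_dominated_convergence
      (fun z => (C + ‖B‖) * (normalDensity 1 0 z * ‖z‖ ^ 2)) ?_ ?_
      (integrable_normalDensity_mul_norm_sq.const_mul _) ?_
    · exact Eventually.of_forall fun t =>
        (continuous_const.max (hNc.mul ((hQc t).sub hBc))).aestronglyMeasurable
    · filter_upwards [self_mem_nhdsWithin] with t ht
      refine ae_of_all _ fun z => ?_
      have ht : (0 : ℝ) < t := ht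
      have h1 : Q t z ≤ C * ‖z‖ ^ 2 := by
        rw [hQ]
        simp only
        rw [div_le_iff₀ (by positivity)]
        refine (hsc x (t • z)).trans_eq ?_
        rw [norm_smul, Real.norm_of_nonneg ht.le]; ring
      have h2 : -(B z z) ≤ ‖B‖ * ‖z‖ ^ 2 := by
        refine (neg_le_abs _).trans ((B.le_opNorm₂ z z).trans_eq ?_)
        ring
      rw [hG, Real.norm_of_nonneg (le_max_left _ _)]
      refine max_le (mul_nonneg (add_nonneg hC (norm_nonneg B)) (mul_nonneg (hN z) (by positivity))) ?_
      have := mul_le_mul_of_nonneg_left (add_le_add h1 h2) (hN z)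
      linarith
    · refine ae_of_all _ fun z => ?_
      have h1 : Tendsto (fun t => Q t z) (𝓝[>] 0) (𝓝 (B z z)) := by
        rw [← hBz]
        exact (hx.tendsto_second_difference z).mono_left
          (nhdsWithin_mono _ fun t ht => ne_of_gt ht)
      have h2 := (tendsto_const_nhds (x := (0 : ℝ))).max ((h1.sub_const (B z z)).const_mul (normalDensity 1 0 z))
      simpa using h2
  rw [integral_zero] at hlim
  refine squeeze_zero' (Eventually.of_forall fun t => le_max_left _ _) ?_ hlim
  filter_upwards [self_mem_nhdsWithin] with t ht
  have ht : (0 : ℝ) < t := ht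
  have hGnn : 0 ≤ ∫ z, G t z := integral_nonneg fun z => le_max_left _ _
  refine max_le hGnn ?_
  rw [hf.heat_sq_sub ht]
  have hQi : Integrable fun z => normalDensity 1 0 z * Q t z := hf.integrable_quotient ht x
  have hQBi : Integrable fun z => normalDensity 1 0 z * (Q t z - B z z) := by
    simp_rw [mul_sub]; exact hQi.sub hBi
  have hGi : Integrable (G t) := (integrable_zero _ _ _).sup hQBi
  have h1 : ∫ z, normalDensity 1 0 z * Q t z ≤ ∫ z, G t z := by
    have h2 : ∫ z, normalDensity 1 0 z * (Q t z - B z z) ≤ ∫ z, G t z :=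
      integral_mono hQBi hGi fun z => le_max_right _ _
    simp_rw [mul_sub] at h2
    rw [integral_sub hQi hBi, htr] at h2
    linarith
  rw [div_le_iff₀ (by positivity)]
  change t ^ 2 / 2 * ∫ z, normalDensity 1 0 z * Q t z ≤ _
  have ht2 : 0 < t ^ 2 := by positivity
  nlinarith

theorem exists_heat_quotient_le (hf : IsSemiconcaveSuperharmonic f) :
    ∃ C, ∀ t > 0, ∀ x, (heat (t ^ 2) f x - f x) / t ^ 2 ≤ C := by
  obtain ⟨M, hM⟩ := hf.bounded
  obtain ⟨C, hC, hsc⟩ := hf.semiconcave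
  refine ⟨C * (∫ z : Mat r q, normalDensity 1 0 z * ‖z‖ ^ 2) / 2, fun t ht x => ?_⟩
  have h1 : ∫ z, normalDensity 1 0 z * ((f (x + t • z) + f (x - t • z) - 2 * f x) / t ^ 2) ≤
      ∫ z : Mat r q, C * (normalDensity 1 0 z * ‖z‖ ^ 2) := by
    refine integral_mono (hf.integrable_quotient ht x)
      (integrable_normalDensity_mul_norm_sq.const_mul C) fun z => ?_
    have h2 : (f (x + t • z) + f (x - t • z) - 2 * f x) / t ^ 2 ≤ C * ‖z‖ ^ 2 := by
      rw [div_le_iff₀ (by positivity)]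
      refine (hsc x (t • z)).trans_eq ?_
      rw [norm_smul, Real.norm_of_nonneg ht.le]; ring
    calc _ ≤ normalDensity 1 0 z * (C * ‖z‖ ^ 2) :=
          mul_le_mul_of_nonneg_left h2 (normalDensity_pos one_pos _ _).le
      _ = _ := by ring
  rw [integral_const_mul] at h1
  rw [hf.heat_sq_sub ht, div_le_iff₀ (by positivity)]
  have ht2 : 0 < t ^ 2 := by positivity
  nlinarith

theorem continuous_integral_add_smul (hf : IsSemiconcaveSuperharmonic f) (x : Mat r q) :
    Continuous fun s : ℝ => ∫ z, normalDensity 1 0 z * f (x + √s • z) := by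
  obtain ⟨M, hM⟩ := hf.bounded
  have hfc := hf.continuous
  refine continuous_of_dominated (bound := fun z : Mat r q => normalDensity 1 0 z * M)
    (fun s => ?_) (fun s => ae_of_all _ fun z => ?_) ((integrable_normalDensity one_pos 0).mul_const M)
    (ae_of_all _ fun z => ?_)
  · have h1 : Continuous fun z : Mat r q => f (x + √s • z) := hfc.comp (by fun_prop)
    exact ((continuous_normalDensity_right 1 0).mul h1).aestronglyMeasurable
  · rw [norm_mul, Real.norm_of_nonneg (normalDensity_pos one_pos _ _).le]
    exact mul_le_mul_of_nonneg_left (hM _) (normalDensity_pos one_pos _ _).le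
  · exact continuous_const.mul (hfc.comp (by fun_prop))

theorem heat_antitone (hf : IsSemiconcaveSuperharmonic f) (x : Mat r q) {a b : ℝ} (ha : 0 < a)
    (hab : a ≤ b) : heat b f x ≤ heat a f x := by
  obtain ⟨M, hM⟩ := hf.bounded
  obtain ⟨C, hC⟩ := hf.exists_heat_quotient_le
  have hfm := hf.continuous.measurable
  have hcont : ContinuousOn (fun s => heat s f x) (Set.Icc a b) :=
    (hf.continuous_integral_add_smul x).continuousOn.congr fun s hs =>
      integral_normalDensity_mul_eq (ha.trans_le hs.1) f x
  refine image_le_of_liminf_slope_right_le_deriv_boundary (B := fun _ => heat a f x)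
    (B' := fun _ => 0) hcont le_rfl continuousOn_const (fun s _ => hasDerivWithinAt_const _ _ _) ?_
    (Set.right_mem_Icc.mpr hab)
  intro s hs ρ hρ
  have hs0 : 0 < s := ha.trans_le hs.1
  set K : ℝ → Mat r q → ℝ := fun t y =>
    normalDensity s x y * max 0 ((heat (t ^ 2) f y - f y) / t ^ 2) with hK
  have hN : ∀ y : Mat r q, 0 ≤ normalDensity s x y := fun y => (normalDensity_pos hs0 x y).le
  have hmeas : ∀ t, Measurable fun y => max 0 ((heat (t ^ 2) f y - f y) / t ^ 2) := fun t =>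
    measurable_const.max (((measurable_heat _ hfm).sub hfm).div_const _)
  have hbd : ∀ t > 0, ∀ y, |max 0 ((heat (t ^ 2) f y - f y) / t ^ 2)| ≤ max 0 C := fun t ht y => by
    rw [abs_of_nonneg (le_max_left _ _)]
    exact max_le_max le_rfl (hC t ht y)
  have hlim : Tendsto (fun t => ∫ y, K t y) (𝓝[>] 0) (𝓝 (∫ _y : Mat r q, (0 : ℝ))) := by
    refine tendsto_integral_filter_of_dominated_convergence
      (fun y => normalDensity s x y * max 0 C) ?_ ?_ ((integrable_normalDensity hs0 x).mul_const _) ?_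
    · exact Eventually.of_forall fun t =>
        ((continuous_normalDensity_right s x).measurable.mul (hmeas t)).aestronglyMeasurable
    · filter_upwards [self_mem_nhdsWithin] with t ht
      refine ae_of_all _ fun y => ?_
      rw [hK, norm_mul, Real.norm_of_nonneg (hN y)]
      exact mul_le_mul_of_nonneg_left (hbd t ht y) (hN y)
    · filter_upwards [hf.superharmonic] with y hy
      simpa using (hf.tendsto_max_heat_quotient hy.1 hy.2).const_mul (normalDensity s x y)
  rw [integral_zero] at hlim
  have hsqrt : Tendsto (fun z => √(z - s)) (𝓝[>] s) (𝓝[>] 0) := by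
    refine tendsto_nhdsWithin_iff.mpr ⟨?_, ?_⟩
    · have : Continuous fun z => √(z - s) := by fun_prop
      simpa using (this.tendsto s).mono_left nhdsWithin_le_nhds
    · filter_upwards [self_mem_nhdsWithin] with z hz
      exact Real.sqrt_pos.mpr (sub_pos.mpr hz)
  refine Eventually.frequently ?_
  filter_upwards [(hlim.comp hsqrt).eventually_lt_const hρ, self_mem_nhdsWithin] with z hz hsz
  have hsz : 0 < z - s := sub_pos.mpr hsz
  refine lt_of_le_of_lt ?_ hz
  set t := √(z - s) with ht
  have ht0 : 0 < t := Real.sqrt_pos.mpr hsz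
  have ht2 : t ^ 2 = z - s := Real.sq_sqrt hsz.le
  have hM' : ∀ y, |heat (t ^ 2) f y| ≤ M := fun y => by
    rw [abs_of_nonneg (heat_nonneg (by positivity) hf.nonneg y)]
    exact heat_le (by positivity) hfm hM y
  have hz' : heat z f x = heat s (heat (t ^ 2) f) x := by
    rw [heat_heat hs0 (by positivity) hfm hf.nonneg hM, ht2, add_sub_cancel]
  have i1 := integrable_normalDensity_mul hs0 (measurable_heat (t ^ 2) hfm) hM' x
  have i2 := integrable_normalDensity_mul hs0 hfm hM x
  have hslope : slope (fun s => heat s f x) s z =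
      ∫ y, normalDensity s x y * ((heat (t ^ 2) f y - f y) / t ^ 2) := by
    rw [slope_def_field, hz', heat, heat, ← integral_sub i1 i2, ← ht2, ← integral_div]
    congr 1; ext y; ring
  rw [hslope]
  refine integral_mono ?_ (integrable_normalDensity_mul hs0 (hmeas t) (hbd t ht0) x) fun y =>
    mul_le_mul_of_nonneg_left (le_max_right _ _) (hN y)
  refine ((i1.sub i2).div_const (t ^ 2)).congr (ae_of_all _ fun y => ?_)
  simp only [Pi.sub_apply]; ring

theorem heat_le_self (hf : IsSemiconcaveSuperharmonic f) (x : Mat r q) {s : ℝ} (hs : 0 < s) :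
    heat s f x ≤ f x := by
  have h1 : Tendsto (fun a : ℝ => ∫ z, normalDensity 1 0 z * f (x + √a • z)) (𝓝[>] 0) (𝓝 (f x)) := by
    have := ((hf.continuous_integral_add_smul x).tendsto 0).mono_left (nhdsWithin_le_nhds (s := Set.Ioi 0))
    simpa [integral_mul_const, integral_normalDensity one_pos] using this
  refine ge_of_tendsto h1 ?_
  filter_upwards [Ioc_mem_nhdsGT hs] with a ha
  rw [← integral_normalDensity_mul_eq ha.1]
  exact hf.heat_antitone x ha.1 ha.2

end IsSemiconcaveSuperharmonic

end MatrixPrediction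

end

noncomputable section

namespace MatrixPrediction

open MeasureTheory Filter
open scoped ENNReal Topology

variable {r q : ℕ}

/-! ### The shrinkage prior under the heat semigroup -/

theorem isSemiconcaveSuperharmonic_regPrior (hrq : r ≤ q) {ε : ℝ} (hε : 0 < ε)
    {α : Fin r → ℝ} (hα : ∀ i, 0 ≤ α i) (hanti : Antitone α)
    (hle : ∀ i : Fin r, α i ≤ ((q : ℝ) + (r : ℝ) - 2 * ((i : ℝ) + 1) - 1) / 2) :
    IsSemiconcaveSuperharmonic (regPrior ε α : Mat r q → ℝ) where
  continuous := continuous_regPrior hε α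
  nonneg := regPrior_nonneg hε.le α
  bounded := ⟨_, fun Θ => (abs_of_nonneg (regPrior_nonneg hε.le α Θ)).trans_le (regPrior_le hε hα Θ)⟩
  semiconcave := exists_regPrior_semiconcave hε hα hanti
  superharmonic := (ae_hasSimpleSpectrum hrq).mono fun _ h =>
    ⟨h.contDiffAt_regPrior hε.le α, h.laplacian_regPrior_nonpos hrq hε.le hα hanti hle⟩

theorem priorST_nonneg (α : Fin r → ℝ) (Θ : Mat r q) : 0 ≤ priorST α Θ := by
  rw [← regPrior_zero]; exact regPrior_nonneg le_rfl α Θ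

theorem HasSimpleSpectrum.priorST_pos (α : Fin r → ℝ) {Θ : Mat r q} (h : HasSimpleSpectrum Θ) :
    0 < priorST α Θ := by
  rw [← regPrior_zero]; exact regPrior_pos α (by simpa using h.1)

theorem measurable_priorST (α : Fin r → ℝ) : Measurable (priorST α : Mat r q → ℝ) :=
  Finset.measurable_fun_prod _ fun i _ => (continuous_eig i).measurable.pow_const _

theorem regPrior_le_priorST {ε : ℝ} (hε : 0 ≤ ε) {α : Fin r → ℝ} (hα : ∀ i, 0 ≤ α i) {Θ : Mat r q}
    (h : HasSimpleSpectrum Θ) : regPrior ε α Θ ≤ priorST α Θ := by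
  rw [← regPrior_zero]; exact regPrior_anti hε hα (by simpa using h.1)

theorem tendsto_regPrior_nat (α : Fin r → ℝ) {Θ : Mat r q} (h : HasSimpleSpectrum Θ) :
    Tendsto (fun k : ℕ => regPrior (1 / ((k : ℝ) + 1)) α Θ) atTop (𝓝 (priorST α Θ)) :=
  (tendsto_regPrior α h.1).comp tendsto_one_div_add_atTop_nhds_zero_nat

theorem tendsto_lheat_regPrior (hrq : r ≤ q) {α : Fin r → ℝ} (hα : ∀ i, 0 ≤ α i) (s : ℝ)
    (x : Mat r q) :
    Tendsto (fun k : ℕ => lheat s (fun y => ENNReal.ofReal (regPrior (1 / ((k : ℝ) + 1)) α y)) x)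
      atTop (𝓝 (lheat s (fun y => ENNReal.ofReal (priorST α y)) x)) := by
  refine lintegral_tendsto_of_tendsto_of_monotone (fun k => ?_) ?_ ?_
  · exact ((continuous_normalDensity_right s x).measurable.ennreal_ofReal.mul
      (continuous_regPrior (by positivity) α).measurable.ennreal_ofReal).aemeasurable
  · filter_upwards [ae_hasSimpleSpectrum hrq] with y hy k l hkl
    refine mul_le_mul_right (ENNReal.ofReal_le_ofReal (regPrior_anti ?_ hα fun i => ?_)) _
    · exact one_div_le_one_div_of_le (by positivity) (by gcongr)
    · exact add_pos (hy.1 i) (by positivity)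
  · filter_upwards [ae_hasSimpleSpectrum hrq] with y hy
    exact ENNReal.Tendsto.const_mul (ENNReal.tendsto_ofReal (tendsto_regPrior_nat α hy))
      (Or.inr ENNReal.ofReal_ne_top)

section

variable {α : Fin r → ℝ}

theorem lheat_regPrior (hrq : r ≤ q) {ε : ℝ} (hε : 0 < ε) (hα : ∀ i, 0 ≤ α i) (hanti : Antitone α)
    (hle : ∀ i : Fin r, α i ≤ ((q : ℝ) + (r : ℝ) - 2 * ((i : ℝ) + 1) - 1) / 2)
    {s : ℝ} (hs : 0 < s) (x : Mat r q) :
    lheat s (fun y => ENNReal.ofReal (regPrior ε α y)) x = ENNReal.ofReal (heat s (regPrior ε α) x) := by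
  have hf := isSemiconcaveSuperharmonic_regPrior (q := q) hrq hε hα hanti hle
  obtain ⟨M, hM⟩ := hf.bounded
  exact (ofReal_heat hs hf.continuous.measurable hf.nonneg hM x).symm

theorem lheat_priorST_anti (hrq : r ≤ q) (hα : ∀ i, 0 ≤ α i) (hanti : Antitone α)
    (hle : ∀ i : Fin r, α i ≤ ((q : ℝ) + (r : ℝ) - 2 * ((i : ℝ) + 1) - 1) / 2)
    {u v : ℝ} (hu : 0 < u) (huv : u ≤ v) (x : Mat r q) :
    lheat v (fun y => ENNReal.ofReal (priorST α y)) x ≤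
      lheat u (fun y => ENNReal.ofReal (priorST α y)) x := by
  refine le_of_tendsto_of_tendsto' (tendsto_lheat_regPrior hrq hα v x)
    (tendsto_lheat_regPrior hrq hα u x) fun k => ?_
  have hε : (0 : ℝ) < 1 / ((k : ℝ) + 1) := by positivity
  rw [lheat_regPrior hrq hε hα hanti hle (hu.trans_le huv), lheat_regPrior hrq hε hα hanti hle hu]
  exact ENNReal.ofReal_le_ofReal
    ((isSemiconcaveSuperharmonic_regPrior hrq hε hα hanti hle).heat_antitone x hu huv)

theorem lheat_priorST_le (hrq : r ≤ q) (hα : ∀ i, 0 ≤ α i) (hanti : Antitone α)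
    (hle : ∀ i : Fin r, α i ≤ ((q : ℝ) + (r : ℝ) - 2 * ((i : ℝ) + 1) - 1) / 2)
    {v : ℝ} (hv : 0 < v) {x : Mat r q} (hx : HasSimpleSpectrum x) :
    lheat v (fun y => ENNReal.ofReal (priorST α y)) x ≤ ENNReal.ofReal (priorST α x) := by
  refine le_of_tendsto' (tendsto_lheat_regPrior hrq hα v x) fun k => ?_
  have hε : (0 : ℝ) < 1 / ((k : ℝ) + 1) := by positivity
  rw [lheat_regPrior hrq hε hα hanti hle hv]
  exact ENNReal.ofReal_le_ofReal
    (((isSemiconcaveSuperharmonic_regPrior hrq hε hα hanti hle).heat_le_self x hv).trans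
      (regPrior_le_priorST hε.le hα hx))

end

/-- Comparison of Gaussian densities with different centers. -/
theorem normalDensity_le_mul {v : ℝ} (hv : 0 < v) (W X Θ : Mat r q) :
    normalDensity v W Θ ≤
      2 ^ (((r : ℝ) * q) / 2) * Real.exp (‖W - X‖ ^ 2 / (2 * v)) * normalDensity (2 * v) X Θ := by
  unfold normalDensity
  have h1 : (2 * Real.pi * (2 * v)) ^ (-((r : ℝ) * (q : ℝ)) / 2) =
      2 ^ (-((r : ℝ) * (q : ℝ)) / 2) * (2 * Real.pi * v) ^ (-((r : ℝ) * (q : ℝ)) / 2) := by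
    rw [← Real.mul_rpow (by positivity) (by positivity)]; congr 1; ring
  have h2 : (2 : ℝ) ^ (((r : ℝ) * q) / 2) * 2 ^ (-((r : ℝ) * (q : ℝ)) / 2) = 1 := by
    rw [← Real.rpow_add two_pos, neg_div, add_neg_cancel, Real.rpow_zero]
  have h3 : ‖Θ - X‖ ^ 2 ≤ 2 * ‖Θ - W‖ ^ 2 + 2 * ‖W - X‖ ^ 2 := by
    have := norm_add_le (Θ - W) (W - X)
    rw [sub_add_sub_cancel] at this
    nlinarith [norm_nonneg (Θ - X), sq_nonneg (‖Θ - W‖ - ‖W - X‖)]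
  have h4 : Real.exp (-‖Θ - W‖ ^ 2 / (2 * v)) ≤
      Real.exp (‖W - X‖ ^ 2 / (2 * v)) * Real.exp (-‖Θ - X‖ ^ 2 / (2 * (2 * v))) := by
    rw [← Real.exp_add, Real.exp_le_exp, div_add_div _ _ (by positivity) (by positivity),
      div_le_div_iff₀ (by positivity) (by positivity)]
    have hv3 : 0 < v ^ 3 := by positivity
    have : 0 ≤ v ^ 2 * (2 * ‖Θ - W‖ ^ 2 + 2 * ‖W - X‖ ^ 2 - ‖Θ - X‖ ^ 2) :=
      mul_nonneg (by positivity) (by linarith)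
    nlinarith
  rw [h1]
  calc _ ≤ (2 * Real.pi * v) ^ (-((r : ℝ) * (q : ℝ)) / 2) *
        (Real.exp (‖W - X‖ ^ 2 / (2 * v)) * Real.exp (-‖Θ - X‖ ^ 2 / (2 * (2 * v)))) := by gcongr
    _ = ((2 : ℝ) ^ (((r : ℝ) * q) / 2) * 2 ^ (-((r : ℝ) * (q : ℝ)) / 2)) *
        ((2 * Real.pi * v) ^ (-((r : ℝ) * (q : ℝ)) / 2) *
        (Real.exp (‖W - X‖ ^ 2 / (2 * v)) * Real.exp (-‖Θ - X‖ ^ 2 / (2 * (2 * v))))) := by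
        rw [h2, one_mul]
    _ = _ := by ring

/-- Nonnegative functions whose Gaussian averages are finite and decrease with the variance. -/
structure IsHeatDecreasing (f : Mat r q → ℝ) : Prop where
  measurable : Measurable f
  nonneg : ∀ Θ, 0 ≤ f Θ
  ae_pos : ∀ᵐ Θ, 0 < f Θ
  integrable : ∀ v > 0, ∀ X, Integrable fun Θ => normalDensity v Θ X * f Θ
  marginal_anti : ∀ u v, 0 < u → u ≤ v → ∀ X, marginal f v X ≤ marginal f u X

theorem isHeatDecreasing_priorST (hrq : r ≤ q) {α : Fin r → ℝ} (hα : ∀ i, 0 ≤ α i)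
    (hanti : Antitone α)
    (hle : ∀ i : Fin r, α i ≤ ((q : ℝ) + (r : ℝ) - 2 * ((i : ℝ) + 1) - 1) / 2) :
    IsHeatDecreasing (priorST α : Mat r q → ℝ) := by
  have hmeas := measurable_priorST (q := q) α
  have hnn : ∀ v > 0, ∀ X Θ : Mat r q, 0 ≤ normalDensity v Θ X * priorST α Θ := fun v hv X Θ =>
    mul_nonneg (normalDensity_pos hv Θ X).le (priorST_nonneg α Θ)
  have hl : ∀ v > 0, ∀ X : Mat r q, ∫⁻ Θ, ENNReal.ofReal (normalDensity v Θ X * priorST α Θ) =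
      lheat v (fun y => ENNReal.ofReal (priorST α y)) X := fun v hv X => by
    refine lintegral_congr fun Θ => ?_
    rw [ENNReal.ofReal_mul (normalDensity_pos hv Θ X).le, normalDensity_comm]
  have hfin : ∀ v > 0, ∀ X : Mat r q, lheat v (fun y => ENNReal.ofReal (priorST α y)) X < ∞ := by
    intro v hv W
    obtain ⟨X, hX⟩ := exists_hasSimpleSpectrum hrq
    set c := 2 ^ (((r : ℝ) * q) / 2) * Real.exp (‖W - X‖ ^ 2 / (2 * v)) with hc
    have hc0 : 0 ≤ c := by positivity
    calc lheat v (fun y => ENNReal.ofReal (priorST α y)) W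
        ≤ ENNReal.ofReal c * lheat (2 * v) (fun y => ENNReal.ofReal (priorST α y)) X := by
          unfold lheat
          rw [← lintegral_const_mul' _ _ ENNReal.ofReal_ne_top]
          refine lintegral_mono fun Θ => ?_
          simp only
          rw [← mul_assoc, ← ENNReal.ofReal_mul hc0]
          gcongr
          exact normalDensity_le_mul hv W X Θ
      _ ≤ ENNReal.ofReal c * ENNReal.ofReal (priorST α X) := by
          gcongr
          exact lheat_priorST_le hrq hα hanti hle (by positivity) hX
      _ < ∞ := ENNReal.mul_lt_top ENNReal.ofReal_lt_top ENNReal.ofReal_lt_top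
  have hint : ∀ v > 0, ∀ X : Mat r q, Integrable fun Θ => normalDensity v Θ X * priorST α Θ := by
    intro v hv X
    refine ⟨((continuous_normalDensity_left v X).measurable.mul hmeas).aestronglyMeasurable, ?_⟩
    rw [hasFiniteIntegral_iff_ofReal (ae_of_all _ (hnn v hv X)), hl v hv]
    exact hfin v hv X
  refine ⟨hmeas, priorST_nonneg α, (ae_hasSimpleSpectrum hrq).mono fun _ h => h.priorST_pos α, hint,
    fun u v hu huv X => ?_⟩
  have hv := hu.trans_le huv
  rw [marginal, marginal, ← ENNReal.ofReal_le_ofReal_iff (integral_nonneg (hnn u hu X)),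
    ofReal_integral_eq_lintegral_ofReal (hint v hv X) (ae_of_all _ (hnn v hv X)),
    ofReal_integral_eq_lintegral_ofReal (hint u hu X) (ae_of_all _ (hnn u hu X)), hl u hu, hl v hv]
  exact lheat_priorST_anti hrq hα hanti hle hu huv X

theorem IsHeatDecreasing.locallyIntegrable {f : Mat r q → ℝ} (hf : IsHeatDecreasing f) :
    LocallyIntegrable f := by
  rw [locallyIntegrable_iff]
  intro K hK
  have h1 : Continuous fun Θ : Mat r q => (normalDensity 1 Θ 0)⁻¹ :=
    (continuous_normalDensity_left 1 0).inv₀ fun Θ => (normalDensity_pos one_pos Θ 0).ne'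
  refine ((hf.integrable 1 one_pos 0).integrableOn.continuousOn_mul h1.continuousOn hK).congr_fun
    (fun Θ _ => ?_) hK.measurableSet
  exact inv_mul_cancel_left₀ (normalDensity_pos one_pos Θ 0).ne' _

end MatrixPrediction

end

noncomputable section

namespace MatrixPrediction

open MeasureTheory Filter
open scoped ENNReal Topology

variable {r q : ℕ}

/-! ### Superharmonicity in the sense of distributions -/

/-- The second difference quotients of `f` along the coordinate directions, added up. -/
def secondDifference (t : ℝ) (f : Mat r q → ℝ) (x : Mat r q) : ℝ :=
  ∑ p, (f (x + t • EuclideanSpace.single p 1) + f (x - t • EuclideanSpace.single p 1) - 2 * f x) / t ^ 2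

theorem continuous_secondDifference (t : ℝ) {f : Mat r q → ℝ} (hf : Continuous f) :
    Continuous (secondDifference t f) := by
  refine continuous_finsetSum _ fun p _ => ?_
  have h1 : Continuous fun z : Mat r q => f (z + t • EuclideanSpace.single p 1) := hf.comp (by fun_prop)
  have h2 : Continuous fun z : Mat r q => f (z - t • EuclideanSpace.single p 1) := hf.comp (by fun_prop)
  exact ((h1.add h2).sub (continuous_const.mul hf)).div_const _

theorem tendsto_secondDifference {f : Mat r q → ℝ} {x : Mat r q} (hf : ContDiffAt ℝ 2 f x) :
    Tendsto (fun t => secondDifference t f x) (𝓝[>] 0) (𝓝 (laplacian f x)) := by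
  unfold secondDifference laplacian
  rw [← Fintype.sum_prod_type' (f := fun i j => iteratedFDeriv ℝ 2 f x
    ![EuclideanSpace.single (i, j) 1, EuclideanSpace.single (i, j) 1])]
  exact tendsto_finsetSum _ fun p _ => (hf.tendsto_second_difference _).mono_left
    (nhdsWithin_mono _ fun t ht => ne_of_gt ht)

theorem secondDifference_le {f : Mat r q → ℝ} {C : ℝ} {x : Mat r q}
    (h : ∀ h, f (x + h) + f (x - h) - 2 * f x ≤ C * ‖h‖ ^ 2) {t : ℝ} (ht : 0 < t) :
    secondDifference t f x ≤ (r * q) * C := by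
  have : secondDifference t f x ≤ ∑ _p : Fin r × Fin q, C := by
    refine Finset.sum_le_sum fun p _ => ?_
    rw [div_le_iff₀ (by positivity)]
    refine (h _).trans_eq ?_
    rw [norm_smul, PiLp.norm_single, norm_one, mul_one, Real.norm_of_nonneg ht.le]
  simpa using this

theorem secondDifference_neg (t : ℝ) (f : Mat r q → ℝ) (x : Mat r q) :
    secondDifference t (fun y => -f y) x = -secondDifference t f x := by
  rw [secondDifference, secondDifference, ← Finset.sum_neg_distrib]
  exact Finset.sum_congr rfl fun p _ => by ring

theorem exists_abs_second_difference_le {E : Type*} [NormedAddCommGroup E] [NormedSpace ℝ E]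
    {g : E → ℝ} (hg : ContDiff ℝ 2 g) (hc : HasCompactSupport g) :
    ∃ C, 0 ≤ C ∧ ∀ x h, |g (x + h) + g (x - h) - 2 * g x| ≤ C * ‖h‖ ^ 2 := by
  obtain ⟨L, hL⟩ := ContDiff.lipschitzWith_of_hasCompactSupport (hc.fderiv ℝ)
    (hg.fderiv_right (m := 1) (by norm_num)) one_ne_zero
  refine ⟨2 * L, by positivity, fun x h => ?_⟩
  have hd : ∀ y, HasFDerivAt g (fderiv ℝ g y) y := fun y =>
    (hg.differentiable (by norm_num) y).hasFDerivAt
  have hk : ∀ k : E, HasFDerivAt (fun k => g (x + k) + g (x - k))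
      (fderiv ℝ g (x + k) - fderiv ℝ g (x - k)) k := fun k => by
    have h1 : HasFDerivAt (fun k => g (x + k)) (fderiv ℝ g (x + k)) k := by
      exact ((hd (x + k)).comp k ((hasFDerivAt_id k).const_add x)).congr_fderiv
        (ContinuousLinearMap.comp_id _)
    have h2 : HasFDerivAt (fun k => g (x - k)) (-fderiv ℝ g (x - k)) k := by
      exact ((hd (x - k)).comp k ((hasFDerivAt_id k).const_sub x)).congr_fderiv (by ext v; simp)
    rw [sub_eq_add_neg]
    exact h1.add h2
  have hb : ∀ k ∈ Metric.closedBall (0 : E) ‖h‖,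
      ‖fderiv ℝ g (x + k) - fderiv ℝ g (x - k)‖ ≤ L * (2 * ‖h‖) := fun k hk => by
    refine (hL.norm_sub_le _ _).trans ?_
    gcongr
    rw [show x + k - (x - k) = (2 : ℝ) • k by rw [two_smul]; abel, norm_smul, Real.norm_two]
    gcongr
    simpa using hk
  have := (convex_closedBall (0 : E) ‖h‖).norm_image_sub_le_of_norm_hasFDerivWithin_le
    (fun k _ => (hk k).hasFDerivWithinAt) hb (Metric.mem_closedBall_self (norm_nonneg h))
    (by simp : h ∈ _)
  simp only [add_zero, sub_zero, Real.norm_eq_abs] at this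
  rw [two_mul (g x)]
  refine this.trans_eq (by ring)

theorem integral_mul_secondDifference {f g : Mat r q → ℝ} (hf : Continuous f) (hg : Continuous g)
    (hc : HasCompactSupport g) (t : ℝ) :
    ∫ x, f x * secondDifference t g x = ∫ x, g x * secondDifference t f x := by
  have hi : ∀ v : Mat r q, Integrable fun x => f x * g (x + v) := fun v =>
    (hf.mul (hg.comp (by fun_prop))).integrable_of_hasCompactSupport
      ((hc.comp_homeomorph (Homeomorph.addRight v)).mul_left)
  have hi' : ∀ v : Mat r q, Integrable fun x => g x * f (x + v) := fun v =>
    (hg.mul (hf.comp (by fun_prop))).integrable_of_hasCompactSupport hc.mul_right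
  have hs : ∀ v : Mat r q, ∫ x, f x * g (x + v) = ∫ x, g x * f (x + -v) := fun v => by
    rw [← integral_add_right_eq_self (fun x => g x * f (x + -v)) v]
    congr 1; ext x; rw [add_neg_cancel_right, mul_comm]
  have key : ∀ a b : Mat r q → ℝ, (∀ v, Integrable fun x => a x * b (x + v)) → 
      ∫ x, a x * secondDifference t b x =
        ∑ p, ((∫ x, a x * b (x + t • EuclideanSpace.single p 1)) +
          (∫ x, a x * b (x + -(t • EuclideanSpace.single p 1))) - 2 * ∫ x, a x * b (x + 0)) / t ^ 2 := by
    intro a b h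
    have h2 : ∀ p, Integrable fun x => (a x * b (x + t • EuclideanSpace.single p 1) +
        a x * b (x + -(t • EuclideanSpace.single p 1)) - 2 * (a x * b (x + 0))) / t ^ 2 := fun p =>
      (((h _).add (h _)).sub ((h 0).const_mul 2)).div_const _
    calc ∫ x, a x * secondDifference t b x = ∫ x, ∑ p : Fin r × Fin q,
          (a x * b (x + t • EuclideanSpace.single p 1) +
          a x * b (x + -(t • EuclideanSpace.single p 1)) - 2 * (a x * b (x + 0))) / t ^ 2 := by
          congr 1; ext x
          rw [secondDifference, Finset.mul_sum]
          refine Finset.sum_congr rfl fun p _ => ?_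
          rw [add_zero, ← sub_eq_add_neg]; ring
      _ = _ := by
          rw [integral_finsetSum _ fun p _ => h2 p]
          refine Finset.sum_congr rfl fun p _ => ?_
          have h3 : Integrable fun x => a x * b (x + t • EuclideanSpace.single p 1) +
            a x * b (x + -(t • EuclideanSpace.single p 1)) := (h _).add (h _)
          rw [integral_div, integral_sub h3 ((h 0).const_mul 2), integral_add (h _) (h _),
            integral_const_mul]
  rw [key f g hi, key g f hi']
  refine Finset.sum_congr rfl fun p _ => ?_
  rw [hs, hs, hs, neg_neg, neg_zero, add_comm (∫ x, g x * f (x + -_))]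

theorem HasCompactSupport.laplacian {g : Mat r q → ℝ} (hc : HasCompactSupport g) :
    HasCompactSupport (laplacian g) := by
  refine (hc.iteratedFDeriv (𝕜 := ℝ) 2).mono fun x hx h => hx ?_
  simp only [Function.mem_support, MatrixPrediction.laplacian] at *
  simp [h]

theorem continuous_laplacian {g : Mat r q → ℝ} (hg : ContDiff ℝ 2 g) : Continuous (laplacian g) := by
  unfold laplacian
  have h1 : Continuous (iteratedFDeriv ℝ 2 g) := hg.continuous_iteratedFDeriv le_rfl
  refine continuous_finsetSum _ fun i _ => continuous_finsetSum _ fun j _ => ?_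
  exact h1.eval_const _

theorem IsSemiconcaveSuperharmonic.integral_mul_laplacian_nonpos {f g : Mat r q → ℝ}
    (hf : IsSemiconcaveSuperharmonic f) (hg : ContDiff ℝ 2 g) (hc : HasCompactSupport g)
    (hg0 : ∀ x, 0 ≤ g x) : ∫ x, f x * laplacian g x ≤ 0 := by
  obtain ⟨C, hC0, hC⟩ := hf.semiconcave
  obtain ⟨D, hD0, hD⟩ := exists_abs_second_difference_le hg hc
  have hfc := hf.continuous
  set K := Metric.cthickening 1 (tsupport g) with hK
  have hKc : IsCompact K := hc.isCompact.cthickening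
  have h1 : Tendsto (fun t => ∫ x, f x * secondDifference t g x) (𝓝[>] 0)
      (𝓝 (∫ x, f x * laplacian g x)) := by
    refine tendsto_integral_filter_of_dominated_convergence
      (K.indicator fun x => |f x| * (r * q * D)) ?_ ?_ ?_ ?_
    · exact Eventually.of_forall fun t =>
        (hfc.mul (continuous_secondDifference t hg.continuous)).aestronglyMeasurable
    · filter_upwards [Ioc_mem_nhdsGT one_pos] with t ht
      refine ae_of_all _ fun x => ?_
      by_cases hx : x ∈ K
      · rw [Set.indicator_of_mem hx, norm_mul, Real.norm_eq_abs, Real.norm_eq_abs]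
        gcongr
        refine abs_le'.mpr ⟨secondDifference_le (fun h => (abs_le.mp (hD x h)).2) ht.1, ?_⟩
        rw [← secondDifference_neg]
        exact secondDifference_le (fun h => by linarith [(abs_le.mp (hD x h)).1]) ht.1
      · rw [Set.indicator_of_notMem hx]
        have hz : ∀ v : Mat r q, ‖v‖ ≤ 1 → g (x + v) = 0 := fun v hv => by
          by_contra hne
          refine hx (Metric.mem_cthickening_of_dist_le x (x + v) 1 _ (subset_tsupport g hne) ?_)
          simpa using hv
        have : secondDifference t g x = 0 := by
          refine Finset.sum_eq_zero fun p _ => ?_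
          have hn : ‖t • EuclideanSpace.single p (1 : ℝ)‖ ≤ 1 := by
            rw [norm_smul, PiLp.norm_single, norm_one, mul_one, Real.norm_of_nonneg ht.1.le]
            exact ht.2
          have h0 := hz 0 (by simp)
          rw [add_zero] at h0
          rw [sub_eq_add_neg x, hz _ hn, hz _ (by rwa [norm_neg]), h0]
          simp
        simp [this]
    · rw [integrable_indicator_iff hKc.measurableSet]
      exact ((hfc.abs.mul continuous_const).continuousOn).integrableOn_compact hKc
    · exact ae_of_all _ fun x => (tendsto_secondDifference hg.contDiffAt).const_mul _
  have h2 : Tendsto (fun t => ∫ x, max 0 (g x * secondDifference t f x)) (𝓝[>] 0)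
      (𝓝 (∫ _x : Mat r q, (0 : ℝ))) := by
    refine tendsto_integral_filter_of_dominated_convergence (fun x => g x * (r * q * C)) ?_ ?_ ?_ ?_
    · exact Eventually.of_forall fun t => (continuous_const.max
        (hg.continuous.mul (continuous_secondDifference t hfc))).aestronglyMeasurable
    · filter_upwards [self_mem_nhdsWithin] with t ht
      refine ae_of_all _ fun x => ?_
      rw [Real.norm_of_nonneg (le_max_left _ _)]
      exact max_le (mul_nonneg (hg0 x) (by positivity))
        (mul_le_mul_of_nonneg_left (secondDifference_le (hC x) ht) (hg0 x))
    · exact (hg.continuous.integrable_of_hasCompactSupport hc).mul_const _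
    · filter_upwards [hf.superharmonic] with x hx
      have := (tendsto_const_nhds (x := (0 : ℝ))).max ((tendsto_secondDifference hx.1).const_mul (g x))
      rwa [max_eq_left (mul_nonpos_of_nonneg_of_nonpos (hg0 x) hx.2)] at this
  rw [integral_zero] at h2
  refine le_of_tendsto_of_tendsto' h1 h2 fun t => ?_
  rw [integral_mul_secondDifference hfc hg.continuous hc]
  have hi : Integrable fun x => g x * secondDifference t f x :=
    (hg.continuous.mul (continuous_secondDifference t hfc)).integrable_of_hasCompactSupport hc.mul_right
  exact integral_mono hi ((integrable_zero _ _ _).sup hi) fun x => le_max_right _ _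

theorem isDistribSuperharmonic_priorST (hrq : r ≤ q) {α : Fin r → ℝ} (hα : ∀ i, 0 ≤ α i)
    (hanti : Antitone α)
    (hle : ∀ i : Fin r, α i ≤ ((q : ℝ) + (r : ℝ) - 2 * ((i : ℝ) + 1) - 1) / 2) :
    IsDistribSuperharmonic (priorST α : Mat r q → ℝ) := by
  have hloc := (isHeatDecreasing_priorST hrq hα hanti hle).locallyIntegrable
  refine ⟨hloc, fun g hg hc hg0 => ?_⟩
  have hg2 : ContDiff ℝ 2 g := by exact_mod_cast contDiff_infty.mp hg 2
  have hlap := continuous_laplacian hg2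
  have h1 : Tendsto (fun k : ℕ => ∫ x, regPrior (1 / ((k : ℝ) + 1)) α x * laplacian g x) atTop
      (𝓝 (∫ x, priorST α x * laplacian g x)) := by
    refine tendsto_integral_of_dominated_convergence (fun x => priorST α x * |laplacian g x|)
      (fun k => ?_) ?_ (fun k => ?_) ?_
    · exact ((continuous_regPrior (by positivity) α).mul hlap).aestronglyMeasurable
    · exact hloc.integrable_smul_right_of_hasCompactSupport hlap.abs
        ((HasCompactSupport.laplacian hc).comp_left abs_zero)
    · filter_upwards [ae_hasSimpleSpectrum hrq] with x hx
      have hε : (0 : ℝ) ≤ 1 / ((k : ℝ) + 1) := by positivity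
      rw [norm_mul, Real.norm_of_nonneg (regPrior_nonneg hε α x)]
      exact mul_le_mul_of_nonneg_right (regPrior_le_priorST hε hα hx) (abs_nonneg _)
    · filter_upwards [ae_hasSimpleSpectrum hrq] with x hx
      exact (tendsto_regPrior_nat α hx).mul_const _
  refine le_of_tendsto' h1 fun k => ?_
  exact (isSemiconcaveSuperharmonic_regPrior hrq (by positivity) hα hanti
    hle).integral_mul_laplacian_nonpos hg2 hc hg0

end MatrixPrediction

end

noncomputable section

namespace MatrixPrediction

open MeasureTheory Filter
open scoped ENNReal Topology

variable {r q : ℕ}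

/-! ### Gaussian second moments and the Kullback–Leibler loss between Gaussians -/

theorem integrable_normalDensity_mul_iff {s : ℝ} (hs : 0 < s) (f : Mat r q → ℝ) (x : Mat r q) :
    (Integrable fun y => normalDensity s x y * f y) ↔
      Integrable fun z => normalDensity 1 0 z * f (x + √s • z) := by
  have hc : 0 < √s := Real.sqrt_pos.mpr hs
  have h3 : ∀ z : Mat r q, normalDensity s 0 (√s • z) = (√s) ^ (-((r : ℝ) * q)) *
      normalDensity 1 0 z := fun z => by
    have := normalDensity_smul one_pos hc z
    rwa [mul_one, Real.sq_sqrt hs.le] at this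
  have h4 : (√s) ^ (-((r : ℝ) * q)) ≠ 0 := (Real.rpow_pos_of_pos hc _).ne'
  rw [← integrable_const_mul_iff (IsUnit.mk0 _ h4) (fun z => normalDensity 1 0 z * f (x + √s • z))]
  simp_rw [← mul_assoc, ← h3]
  rw [integrable_comp_smul_iff volume (fun z => normalDensity s 0 z * f (x + z)) hc.ne',
    ← (measurePreserving_add_left volume x).integrable_comp_emb (measurableEmbedding_addLeft x)]
  simp only [Function.comp_def, normalDensity_eq_sub s x, add_sub_cancel_left]

theorem integral_normalDensity_mul_norm_sq :
    ∫ z : Mat r q, normalDensity 1 0 z * ‖z‖ ^ 2 = r * q := by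
  simp_rw [EuclideanSpace.real_norm_sq_eq, Finset.mul_sum, sq]
  rw [integral_finsetSum _ fun a _ => integrable_normalDensity_mul_apply a a]
  simp [integral_normalDensity_mul_apply]

theorem integrable_normalDensity_mul_inner (c : Mat r q) :
    Integrable fun z : Mat r q => normalDensity 1 0 z * inner ℝ c z := by
  refine (((integrable_normalDensity one_pos 0).add
    integrable_normalDensity_mul_norm_sq).const_mul ‖c‖).mono' ?_ (ae_of_all _ fun z => ?_)
  · exact ((continuous_normalDensity_right 1 0).mul (by fun_prop)).aestronglyMeasurable
  · have hN := (normalDensity_pos one_pos 0 z).le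
    rw [norm_mul, Real.norm_of_nonneg hN]
    have h1 : ‖inner ℝ c z‖ ≤ ‖c‖ * (1 + ‖z‖ ^ 2) := by
      refine (norm_inner_le_norm c z).trans ?_
      gcongr
      nlinarith [sq_nonneg (‖z‖ - 1), norm_nonneg z]
    calc _ ≤ normalDensity 1 0 z * (‖c‖ * (1 + ‖z‖ ^ 2)) := mul_le_mul_of_nonneg_left h1 hN
      _ = _ := by simp only [Pi.add_apply]; ring

theorem integral_normalDensity_mul_inner (c : Mat r q) :
    ∫ z : Mat r q, normalDensity 1 0 z * inner ℝ c z = 0 := by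
  have h := integral_neg_eq_self (fun z : Mat r q => normalDensity 1 0 z * inner ℝ c z) volume
  simp_rw [normalDensity_neg, inner_neg_right, mul_neg, integral_neg] at h
  linarith

theorem normalDensity_second_moment {v : ℝ} (hv : 0 < v) (Θ m : Mat r q) :
    (Integrable fun X => normalDensity v Θ X * ‖X - m‖ ^ 2) ∧
      ∫ X, normalDensity v Θ X * ‖X - m‖ ^ 2 = r * q * v + ‖Θ - m‖ ^ 2 := by
  have e : ∀ z : Mat r q, normalDensity 1 0 z * ‖Θ + √v • z - m‖ ^ 2 =
      normalDensity 1 0 z * ‖Θ - m‖ ^ 2 + 2 * √v * (normalDensity 1 0 z * inner ℝ (Θ - m) z) +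
        v * (normalDensity 1 0 z * ‖z‖ ^ 2) := fun z => by
    rw [add_sub_right_comm, norm_add_sq_real, inner_smul_right, norm_smul, mul_pow,
      Real.norm_eq_abs, sq_abs, Real.sq_sqrt hv.le]
    ring
  have i1 : Integrable fun z : Mat r q => normalDensity 1 0 z * ‖Θ - m‖ ^ 2 :=
    (integrable_normalDensity one_pos 0).mul_const _
  have i2 := (integrable_normalDensity_mul_inner (Θ - m)).const_mul (2 * √v)
  have i3 := (integrable_normalDensity_mul_norm_sq (r := r) (q := q)).const_mul v
  have i12 : Integrable fun z : Mat r q => normalDensity 1 0 z * ‖Θ - m‖ ^ 2 +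
    2 * √v * (normalDensity 1 0 z * inner ℝ (Θ - m) z) := i1.add i2
  constructor
  · rw [integrable_normalDensity_mul_iff hv (fun X => ‖X - m‖ ^ 2)]
    simp_rw [e]
    exact i12.add i3
  · rw [integral_normalDensity_mul_eq hv (fun X => ‖X - m‖ ^ 2)]
    simp_rw [e]
    rw [integral_add i12 i3, integral_add i1 i2, integral_mul_const, integral_const_mul,
      integral_const_mul, integral_normalDensity one_pos, integral_normalDensity_mul_inner,
      integral_normalDensity_mul_norm_sq]
    ring

theorem log_normalDensity {v : ℝ} (hv : 0 < v) (Θ X : Mat r q) :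
    Real.log (normalDensity v Θ X) =
      -((r : ℝ) * q) / 2 * Real.log (2 * Real.pi * v) - ‖X - Θ‖ ^ 2 / (2 * v) := by
  rw [normalDensity, Real.log_mul (Real.rpow_pos_of_pos (by positivity) _).ne' (Real.exp_ne_zero _),
    Real.log_exp, Real.log_rpow (by positivity)]
  ring

theorem log_normalDensity_div {v w : ℝ} (hv : 0 < v) (hw : 0 < w) (Θ m Y : Mat r q) :
    Real.log (normalDensity v Θ Y / normalDensity w m Y) =
      (r : ℝ) * q / 2 * Real.log (w / v) - ‖Y - Θ‖ ^ 2 / (2 * v) + ‖Y - m‖ ^ 2 / (2 * w) := by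
  rw [Real.log_div (normalDensity_pos hv _ _).ne' (normalDensity_pos hw _ _).ne',
    log_normalDensity hv, log_normalDensity hw, Real.log_div hw.ne' hv.ne',
    Real.log_mul (by positivity) hw.ne', Real.log_mul (by positivity) hv.ne']
  ring

/-- The Kullback–Leibler divergence of two Gaussians. -/
def gaussianKL (r q : ℕ) (v w d : ℝ) : ℝ :=
  (r : ℝ) * q / 2 * Real.log (w / v) + (r * q * v + d) / (2 * w) - r * q / 2

theorem integrable_mul_log_normalDensity_div {v w : ℝ} (hv : 0 < v) (hw : 0 < w) (Θ m : Mat r q) :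
    (Integrable fun Y =>
      normalDensity v Θ Y * Real.log (normalDensity v Θ Y / normalDensity w m Y)) ∧
    ∫ Y, normalDensity v Θ Y * Real.log (normalDensity v Θ Y / normalDensity w m Y) =
      gaussianKL r q v w (‖Θ - m‖ ^ 2) := by
  obtain ⟨i1, e1⟩ := normalDensity_second_moment hv Θ Θ
  obtain ⟨i2, e2⟩ := normalDensity_second_moment hv Θ m
  have i3 := integrable_normalDensity hv Θ
  have e : ∀ Y, normalDensity v Θ Y * Real.log (normalDensity v Θ Y / normalDensity w m Y) =
      normalDensity v Θ Y * ((r : ℝ) * q / 2 * Real.log (w / v)) -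
        normalDensity v Θ Y * ‖Y - Θ‖ ^ 2 / (2 * v) + normalDensity v Θ Y * ‖Y - m‖ ^ 2 / (2 * w) :=
    fun Y => by rw [log_normalDensity_div hv hw]; ring
  have i12 := (i3.mul_const ((r : ℝ) * q / 2 * Real.log (w / v))).sub (i1.div_const (2 * v))
  simp only [Pi.sub_def] at i12
  simp_rw [e]
  refine ⟨i12.add (i2.div_const _), ?_⟩
  rw [integral_add i12 (i2.div_const _), integral_sub (i3.mul_const _) (i1.div_const _),
    integral_div, integral_div, integral_mul_const, integral_normalDensity hv, e1, e2, gaussianKL,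
    sub_self, norm_zero]
  field_simp
  ring

theorem klLoss_normalDensity {v w : ℝ} (hv : 0 < v) (hw : 0 < w) (Θ m : Mat r q) :
    klLoss v Θ (normalDensity w m) = ENNReal.ofReal (gaussianKL r q v w (‖Θ - m‖ ^ 2)) := by
  obtain ⟨h1, h2⟩ := integrable_mul_log_normalDensity_div hv hw Θ m
  rw [klLoss, if_pos ⟨ae_of_all _ fun Y => normalDensity_pos hw m Y, h1⟩, h2]

/-- Gibbs' inequality. -/
theorem integral_mul_log_div_nonneg {v : ℝ} (hv : 0 < v) {Θ : Mat r q} {f : Mat r q → ℝ}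
    (hf : ∀ Y, 0 < f Y) (hfi : Integrable f) (hf1 : ∫ Y, f Y = 1)
    (hint : Integrable fun Y => normalDensity v Θ Y * Real.log (normalDensity v Θ Y / f Y)) :
    0 ≤ ∫ Y, normalDensity v Θ Y * Real.log (normalDensity v Θ Y / f Y) := by
  have h : ∫ Y, (normalDensity v Θ Y - f Y) ≤
      ∫ Y, normalDensity v Θ Y * Real.log (normalDensity v Θ Y / f Y) := by
    refine integral_mono ((integrable_normalDensity hv Θ).sub hfi) hint fun Y => ?_
    have hp := normalDensity_pos hv Θ Y
    have h1 := Real.one_sub_inv_le_log_of_pos (div_pos hp (hf Y))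
    have h2 := mul_le_mul_of_nonneg_left h1 hp.le
    rwa [inv_div, mul_sub, mul_one, mul_div_cancel₀ _ hp.ne'] at h2
  rwa [integral_sub (integrable_normalDensity hv Θ) hfi, integral_normalDensity hv, hf1,
    sub_self] at h

theorem gaussianKL_nonneg {v w : ℝ} (hv : 0 < v) (hw : 0 < w) (Θ m : Mat r q) :
    0 ≤ gaussianKL r q v w (‖Θ - m‖ ^ 2) := by
  obtain ⟨h1, h2⟩ := integrable_mul_log_normalDensity_div hv hw Θ m
  rw [← h2]
  exact integral_mul_log_div_nonneg hv (normalDensity_pos hw m) (integrable_normalDensity hw m)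
    (integral_normalDensity hw m) h1

/-- The mean divergence of Gaussians, when the difference of the centers is Gaussian. -/
theorem lintegral_gaussianKL {v u : ℝ} (hv : 0 < v) (hu : 0 < u) (m : Mat r q) :
    ∫⁻ X, ENNReal.ofReal (normalDensity u m X) *
        ENNReal.ofReal (gaussianKL r q v (v + u) (‖X - m‖ ^ 2)) =
      ENNReal.ofReal ((r : ℝ) * q / 2 * Real.log ((v + u) / v)) := by
  have huv := add_pos hv hu
  obtain ⟨i1, e1⟩ := normalDensity_second_moment hu m m
  simp_rw [← ENNReal.ofReal_mul (normalDensity_pos hu m _).le]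
  have e : ∀ X, normalDensity u m X * gaussianKL r q v (v + u) (‖X - m‖ ^ 2) =
      normalDensity u m X * gaussianKL r q v (v + u) 0 +
        normalDensity u m X * ‖X - m‖ ^ 2 / (2 * (v + u)) := fun X => by
    rw [gaussianKL, gaussianKL]; ring
  have i2 := (integrable_normalDensity hu m).mul_const (gaussianKL r q v (v + u) 0)
  rw [← ofReal_integral_eq_lintegral_ofReal]
  · congr 1
    simp_rw [e]
    rw [integral_add i2 (i1.div_const _), integral_mul_const, integral_div, e1,
      integral_normalDensity hu, sub_self, norm_zero, gaussianKL]
    field_simp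
    ring
  · simp_rw [e]
    exact i2.add (i1.div_const _)
  · exact ae_of_all _ fun X => mul_nonneg (normalDensity_pos hu m X).le (gaussianKL_nonneg hv huv X m)

/-- The comparison of the losses of two predictive densities. -/
theorem klLoss_add_one_le {v : ℝ} (hv : 0 < v) {Θ : Mat r q} {f g : Mat r q → ℝ}
    (hf : ∀ Y, 0 < f Y) (hfi : Integrable f) (hf1 : ∫ Y, f Y = 1) (hfm : Measurable f)
    (hint : Integrable fun Y => normalDensity v Θ Y * Real.log (normalDensity v Θ Y / f Y))
    (hg : ∀ Y, 0 ≤ g Y) (hgm : Measurable g) :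
    klLoss v Θ f + 1 ≤
      klLoss v Θ g + ∫⁻ Y, ENNReal.ofReal (normalDensity v Θ Y * (g Y / f Y)) := by
  have hA := integral_mul_log_div_nonneg hv hf hfi hf1 hint
  rw [klLoss, if_pos ⟨ae_of_all _ hf, hint⟩]
  rw [klLoss]
  split_ifs with hcond
  swap
  · rw [top_add]; exact le_top
  obtain ⟨hpos, hgi⟩ := hcond
  have hJnn : ∀ Y, 0 ≤ normalDensity v Θ Y * (g Y / f Y) := fun Y =>
    mul_nonneg (normalDensity_pos hv Θ Y).le (div_nonneg (hg Y) (hf Y).le)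
  by_cases hJ : ∫⁻ Y, ENNReal.ofReal (normalDensity v Θ Y * (g Y / f Y)) = ∞
  · rw [hJ, add_top]; exact le_top
  have hJi : Integrable fun Y => normalDensity v Θ Y * (g Y / f Y) := by
    refine ⟨((continuous_normalDensity_right v Θ).measurable.mul
      (hgm.div hfm)).aestronglyMeasurable, ?_⟩
    rw [hasFiniteIntegral_iff_ofReal (ae_of_all _ hJnn)]
    exact lt_top_iff_ne_top.mpr hJ
  rw [← ofReal_integral_eq_lintegral_ofReal hJi (ae_of_all _ hJnn), ← ENNReal.ofReal_one,
    ← ENNReal.ofReal_add hA zero_le_one]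
  refine le_trans (ENNReal.ofReal_le_ofReal ?_) ENNReal.ofReal_add_le
  rw [← integral_normalDensity hv Θ, ← integral_add hint (integrable_normalDensity hv Θ),
    ← integral_add hgi hJi]
  refine integral_mono_ae (hint.add (integrable_normalDensity hv Θ)) (hgi.add hJi) ?_
  filter_upwards [hpos] with Y hY
  have hp := normalDensity_pos hv Θ Y
  have h1 := Real.log_le_sub_one_of_pos (div_pos hY (hf Y))
  have h2 : Real.log (normalDensity v Θ Y / f Y) + 1 ≤
      Real.log (normalDensity v Θ Y / g Y) + g Y / f Y := by
    rw [Real.log_div hY.ne' (hf Y).ne'] at h1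
    rw [Real.log_div hp.ne' hY.ne', Real.log_div hp.ne' (hf Y).ne']
    linarith
  have h3 := mul_le_mul_of_nonneg_left h2 hp.le
  linarith

end MatrixPrediction

end

noncomputable section

namespace MatrixPrediction

open MeasureTheory Filter
open scoped ENNReal Topology

variable {r q : ℕ}

/-! ### The lower bound on the maximal risk -/

theorem measurable_gaussianKL_comp {β : Type*} [MeasurableSpace β] (v w : ℝ) {f : β → Mat r q}
    (hf : Measurable f) : Measurable fun x => gaussianKL r q v w (‖f x‖ ^ 2) := by
  unfold gaussianKL
  fun_prop

/-- The joint law of a Gaussian parameter and its observation, disintegrated both ways. -/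
theorem lintegral_lintegral_normalDensity {s v : ℝ} (hs : 0 < s) (hv : 0 < v)
    {K : Mat r q × Mat r q → ℝ≥0∞} (hK : Measurable K) :
    ∫⁻ Θ, ENNReal.ofReal (normalDensity s 0 Θ) *
        ∫⁻ X, ENNReal.ofReal (normalDensity v Θ X) * K (Θ, X) =
      ∫⁻ X, ENNReal.ofReal (normalDensity (s + v) 0 X) *
        ∫⁻ Θ, ENNReal.ofReal (normalDensity (s * v / (s + v)) ((s / (s + v)) • X) Θ) * K (Θ, X) := by
  have hm : Measurable fun z : Mat r q × Mat r q => ENNReal.ofReal (normalDensity s 0 z.1) *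
      (ENNReal.ofReal (normalDensity v z.1 z.2) * K z) :=
    (measurable_normalDensity_comp measurable_const measurable_fst s).ennreal_ofReal.mul
      ((measurable_normalDensity_comp measurable_fst measurable_snd v).ennreal_ofReal.mul hK)
  simp_rw [← lintegral_const_mul' _ _ ENNReal.ofReal_ne_top]
  rw [lintegral_lintegral_swap hm.aemeasurable]
  refine lintegral_congr fun X => lintegral_congr fun Θ => ?_
  rw [← mul_assoc, ← mul_assoc, ← ENNReal.ofReal_mul (normalDensity_pos hs _ _).le,
    ← ENNReal.ofReal_mul (normalDensity_pos (add_pos hs hv) _ _).le, normalDensity_comm s 0 Θ,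
    normalDensity_mul hs hv, smul_zero, zero_add, normalDensity_comm _ Θ]

theorem le_iSup_klRisk_of_variance {s vx vy : ℝ} (hs : 0 < s) (hvx : 0 < vx) (hvy : 0 < vy)
    {p : Mat r q → Mat r q → ℝ} (hp : IsPredictiveDensity p) :
    ENNReal.ofReal ((r : ℝ) * q / 2 * Real.log ((vy + s * vx / (s + vx)) / vy)) ≤
      ⨆ Θ, klRisk vx vy Θ p := by
  set τ := s * vx / (s + vx) with hτ
  set a := s / (s + vx) with ha
  have hτ0 : 0 < τ := by positivity
  have hw : 0 < vy + τ := by positivity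
  set c := ENNReal.ofReal ((r : ℝ) * q / 2 * Real.log ((vy + τ) / vy)) with hc
  set k : Mat r q × Mat r q → ℝ≥0∞ := fun z =>
    ENNReal.ofReal (gaussianKL r q vy (vy + τ) (‖z.1 - a • z.2‖ ^ 2)) with hk
  set J : Mat r q × Mat r q → ℝ≥0∞ := fun z => ∫⁻ Y, ENNReal.ofReal
    (normalDensity vy z.1 Y * (p z.2 Y / normalDensity (vy + τ) (a • z.2) Y)) with hJ
  have hkm : Measurable k := (measurable_gaussianKL_comp _ _ (by fun_prop)).ennreal_ofReal
  have hJm : Measurable J := by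
    refine Measurable.lintegral_prod_right' (f := fun z : (Mat r q × Mat r q) × Mat r q =>
      ENNReal.ofReal (normalDensity vy z.1.1 z.2 *
        (p z.1.2 z.2 / normalDensity (vy + τ) (a • z.1.2) z.2))) ?_
    refine Measurable.ennreal_ofReal ?_
    refine (measurable_normalDensity_comp (by fun_prop) (by fun_prop) _).mul (Measurable.div ?_
      (measurable_normalDensity_comp (by fun_prop) (by fun_prop) _))
    exact hp.measurable.comp (f := fun z : (Mat r q × Mat r q) × Mat r q => (z.1.2, z.2))
      (by fun_prop)
  have hpt : ∀ Θ X, k (Θ, X) + 1 ≤ klLoss vy Θ (p X) + J (Θ, X) := fun Θ X => by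
    rw [hk]
    simp only
    rw [← klLoss_normalDensity hvy hw]
    exact klLoss_add_one_le hvy (normalDensity_pos hw _) (integrable_normalDensity hw _)
      (integral_normalDensity hw _) (continuous_normalDensity_right _ _).measurable
      (integrable_mul_log_normalDensity_div hvy hw _ _).1 (hp.nonneg X)
      (hp.measurable.comp measurable_prodMk_left)
  have hL : ∫⁻ Θ, ENNReal.ofReal (normalDensity s 0 Θ) *
      ∫⁻ X, ENNReal.ofReal (normalDensity vx Θ X) * (k (Θ, X) + 1) = c + 1 := by
    rw [lintegral_lintegral_normalDensity hs hvx (K := fun z => k z + 1) (hkm.add measurable_const)]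
    have h1 : ∀ X : Mat r q, ∫⁻ Θ, ENNReal.ofReal (normalDensity τ (a • X) Θ) * (k (Θ, X) + 1) =
        c + 1 := fun X => by
      simp_rw [mul_add, mul_one]
      rw [lintegral_add_right _ (continuous_normalDensity_right _ _).measurable.ennreal_ofReal,
        lintegral_gaussianKL hvy hτ0, lintegral_normalDensity hτ0]
    simp_rw [← hτ, ← ha, h1]
    rw [lintegral_mul_const _ (continuous_normalDensity_right _ _).measurable.ennreal_ofReal,
      lintegral_normalDensity (by positivity), one_mul]
  have hR : ∫⁻ Θ, ENNReal.ofReal (normalDensity s 0 Θ) *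
      ∫⁻ X, ENNReal.ofReal (normalDensity vx Θ X) * J (Θ, X) = 1 := by
    rw [lintegral_lintegral_normalDensity hs hvx hJm]
    have h1 : ∀ X : Mat r q, ∫⁻ Θ, ENNReal.ofReal (normalDensity τ (a • X) Θ) * J (Θ, X) = 1 := by
      intro X
      have hpX : Measurable (p X) := hp.measurable.comp measurable_prodMk_left
      have hm : Measurable fun z : Mat r q × Mat r q => ENNReal.ofReal (normalDensity τ (a • X) z.1) *
          ENNReal.ofReal (normalDensity vy z.1 z.2 * (p X z.2 / normalDensity (vy + τ) (a • X) z.2)) := by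
        refine (measurable_normalDensity_comp measurable_const measurable_fst _).ennreal_ofReal.mul
          (Measurable.ennreal_ofReal ?_)
        exact (measurable_normalDensity_comp measurable_fst measurable_snd _).mul
          ((hpX.comp measurable_snd).div
            (measurable_normalDensity_comp measurable_const measurable_snd _))
      simp_rw [hJ, ← lintegral_const_mul' _ _ ENNReal.ofReal_ne_top]
      rw [lintegral_lintegral_swap hm.aemeasurable, ← hp.lintegral_eq_one X]
      refine lintegral_congr fun Y => ?_
      simp_rw [ENNReal.ofReal_mul (normalDensity_pos hvy _ _).le, ← mul_assoc]
      rw [lintegral_mul_const _ (by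
        exact ((continuous_normalDensity_right _ _).measurable.ennreal_ofReal).mul
          (continuous_normalDensity_left _ _).measurable.ennreal_ofReal)]
      simp_rw [normalDensity_comm τ]
      rw [lintegral_normalDensity_mul hτ0 hvy, add_comm τ vy,
        ← ENNReal.ofReal_mul (normalDensity_pos hw _ _).le,
        mul_div_cancel₀ _ (normalDensity_pos hw _ _).ne']
    simp_rw [← hτ, ← ha, h1, mul_one]
    exact lintegral_normalDensity (by positivity) 0
  clear_value J k c
  have hNJ : ∀ Θ, Measurable fun X => ENNReal.ofReal (normalDensity vx Θ X) * J (Θ, X) := fun Θ =>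
    (continuous_normalDensity_right vx Θ).measurable.ennreal_ofReal.mul
      (hJm.comp measurable_prodMk_left)
  have hmain : c + 1 ≤ (⨆ Θ, klRisk vx vy Θ p) + 1 := by
    calc c + 1 = ∫⁻ Θ, ENNReal.ofReal (normalDensity s 0 Θ) *
          ∫⁻ X, ENNReal.ofReal (normalDensity vx Θ X) * (k (Θ, X) + 1) := hL.symm
      _ ≤ ∫⁻ Θ, (ENNReal.ofReal (normalDensity s 0 Θ) * (⨆ Θ, klRisk vx vy Θ p) +
          ENNReal.ofReal (normalDensity s 0 Θ) *
          ∫⁻ X, ENNReal.ofReal (normalDensity vx Θ X) * J (Θ, X)) := by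
          refine lintegral_mono fun Θ => ?_
          simp only
          rw [← mul_add]
          gcongr
          refine le_trans (lintegral_mono fun X => mul_le_mul_right (hpt Θ X) _) ?_
          simp_rw [mul_add]
          rw [lintegral_add_right _ (hNJ Θ)]
          gcongr
          exact le_iSup (fun Θ => klRisk vx vy Θ p) Θ
      _ = (⨆ Θ, klRisk vx vy Θ p) + 1 := by
          rw [lintegral_add_left, hR, lintegral_mul_const, lintegral_normalDensity hs, one_mul]
          · exact (continuous_normalDensity_right _ _).measurable.ennreal_ofReal
          · exact (continuous_normalDensity_right _ _).measurable.ennreal_ofReal.mul_const _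
  exact (ENNReal.add_le_add_iff_right ENNReal.one_ne_top).mp hmain

theorem le_iSup_klRisk {vx vy : ℝ} (hvx : 0 < vx) (hvy : 0 < vy)
    {p : Mat r q → Mat r q → ℝ} (hp : IsPredictiveDensity p) :
    ENNReal.ofReal ((r : ℝ) * q / 2 * Real.log ((vy + vx) / vy)) ≤ ⨆ Θ, klRisk vx vy Θ p := by
  have h1 : Tendsto (fun s : ℝ => vx / (s + vx)) atTop (𝓝 0) :=
    tendsto_const_nhds.div_atTop (tendsto_atTop_add_const_right _ _ tendsto_id)
  have h2 : Tendsto (fun s : ℝ => s * vx / (s + vx)) atTop (𝓝 vx) := by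
    have := (h1.const_sub 1).mul_const vx
    rw [sub_zero, one_mul] at this
    refine this.congr' ?_
    filter_upwards [eventually_gt_atTop 0] with s hs
    field_simp
    ring
  have h3 : Tendsto (fun s : ℝ => ENNReal.ofReal
      ((r : ℝ) * q / 2 * Real.log ((vy + s * vx / (s + vx)) / vy))) atTop
      (𝓝 (ENNReal.ofReal ((r : ℝ) * q / 2 * Real.log ((vy + vx) / vy)))) :=
    ENNReal.tendsto_ofReal ((((h2.const_add vy).div_const vy).log (by positivity)).const_mul _)
  refine le_of_tendsto h3 ?_
  filter_upwards [eventually_gt_atTop 0] with s hs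
  exact le_iSup_klRisk_of_variance hs hvx hvy hp

end MatrixPrediction

end

noncomputable section

namespace MatrixPrediction

open MeasureTheory Filter
open scoped ENNReal Topology

variable {r q : ℕ}

/-! ### The upper bound on the risk of the Bayesian predictive density -/

theorem integral_normalDensity_mul_shear {u v a : ℝ} (hu : 0 < u) (hv : 0 < v) (ha : 0 < a)
    (W Θ : Mat r q) :
    ∫ D, normalDensity u 0 D * normalDensity v (W - a • D) Θ = normalDensity (a ^ 2 * u + v) W Θ := by
  have hau : 0 < a ^ 2 * u := by positivity
  have h1 : √(a ^ 2 * u) = a * √u := by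
    rw [Real.sqrt_mul (by positivity), Real.sqrt_sq ha.le]
  have h2 := integral_normalDensity_mul_eq hu (fun D => normalDensity v (W - a • D) Θ) 0
  have h3 := integral_normalDensity_mul_eq hau (fun y => normalDensity v y Θ) W
  have h4 := integral_normalDensity_mul hau hv W Θ
  simp_rw [normalDensity_comm (a ^ 2 * u) _ W] at h4
  rw [h2, ← h4, h3, ← integral_neg_eq_self, h1]
  simp_rw [normalDensity_neg, zero_add, smul_neg, sub_neg_eq_add, smul_smul]

theorem lintegral_normalDensity_mul_shear {u v a : ℝ} (hu : 0 < u) (hv : 0 < v) (ha : 0 < a)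
    (W Θ : Mat r q) :
    ∫⁻ D, ENNReal.ofReal (normalDensity u 0 D) * ENNReal.ofReal (normalDensity v (W - a • D) Θ) =
      ENNReal.ofReal (normalDensity (a ^ 2 * u + v) W Θ) := by
  have h := integral_normalDensity_mul_shear hu hv ha W Θ
  have hpos := normalDensity_pos (show 0 < a ^ 2 * u + v by positivity) W Θ
  have hi : Integrable fun D => normalDensity u 0 D * normalDensity v (W - a • D) Θ := by
    by_contra hn
    rw [integral_undef hn] at h
    exact hpos.ne h
  simp_rw [← ENNReal.ofReal_mul (normalDensity_pos hu _ _).le]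
  rw [← ofReal_integral_eq_lintegral_ofReal hi (ae_of_all _ fun D =>
    mul_nonneg (normalDensity_pos hu _ _).le (normalDensity_pos hv _ _).le), h]

theorem lintegral_mul_lheat_shear {u v a : ℝ} (hu : 0 < u) (hv : 0 < v) (ha : 0 < a)
    {F : Mat r q → ℝ≥0∞} (hF : Measurable F) (W : Mat r q) :
    ∫⁻ D, ENNReal.ofReal (normalDensity u 0 D) * lheat v F (W - a • D) =
      lheat (a ^ 2 * u + v) F W := by
  unfold lheat
  have hm : Measurable fun z : Mat r q × Mat r q => ENNReal.ofReal (normalDensity u 0 z.1) *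
      (ENNReal.ofReal (normalDensity v (W - a • z.1) z.2) * F z.2) :=
    (measurable_normalDensity_comp measurable_const measurable_fst u).ennreal_ofReal.mul
      ((measurable_normalDensity_comp (by fun_prop) measurable_snd v).ennreal_ofReal.mul
        (hF.comp measurable_snd))
  simp_rw [← lintegral_const_mul' _ _ ENNReal.ofReal_ne_top]
  rw [lintegral_lintegral_swap hm.aemeasurable]
  refine lintegral_congr fun Θ => ?_
  simp_rw [← mul_assoc]
  rw [lintegral_mul_const _ (by
    exact ((continuous_normalDensity_right _ _).measurable.ennreal_ofReal).mul
      (measurable_normalDensity_comp (by fun_prop) measurable_const v).ennreal_ofReal),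
    lintegral_normalDensity_mul_shear hu hv ha]

theorem IsPredictiveDensity.measurable_right {p : Mat r q → Mat r q → ℝ} (hp : IsPredictiveDensity p)
    (X : Mat r q) : Measurable (p X) := hp.measurable.of_uncurry_left

theorem IsPredictiveDensity.integrable {p : Mat r q → Mat r q → ℝ} (hp : IsPredictiveDensity p)
    (X : Mat r q) : Integrable (p X) := by
  refine ⟨(hp.measurable_right X).aestronglyMeasurable, ?_⟩
  rw [hasFiniteIntegral_iff_ofReal (ae_of_all _ (hp.nonneg X)), hp.lintegral_eq_one]
  exact ENNReal.one_lt_top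

theorem IsPredictiveDensity.integral_eq_one {p : Mat r q → Mat r q → ℝ} (hp : IsPredictiveDensity p)
    (X : Mat r q) : ∫ Y, p X Y = 1 := by
  rw [integral_eq_lintegral_of_nonneg_ae (ae_of_all _ (hp.nonneg X))
    (hp.measurable_right X).aestronglyMeasurable, hp.lintegral_eq_one, ENNReal.toReal_one]

namespace IsHeatDecreasing

variable {f : Mat r q → ℝ}

theorem ofReal_marginal (hf : IsHeatDecreasing f) {v : ℝ} (hv : 0 < v) (X : Mat r q) :
    ENNReal.ofReal (marginal f v X) = lheat v (fun Θ => ENNReal.ofReal (f Θ)) X := by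
  rw [marginal, ofReal_integral_eq_lintegral_ofReal (hf.integrable v hv X)
    (ae_of_all _ fun Θ => mul_nonneg (normalDensity_pos hv Θ X).le (hf.nonneg Θ))]
  refine lintegral_congr fun Θ => ?_
  rw [ENNReal.ofReal_mul (normalDensity_pos hv Θ X).le, normalDensity_comm]

theorem measurable_marginal (hf : IsHeatDecreasing f) (v : ℝ) : Measurable (marginal f v) := by
  have h : marginal f v = heat v f := by
    ext X
    simp_rw [marginal, heat, normalDensity_comm v X]
  rw [h]
  exact measurable_heat v hf.measurable

theorem marginal_pos (hf : IsHeatDecreasing f) {v : ℝ} (hv : 0 < v) (X : Mat r q) :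
    0 < marginal f v X := by
  have hnn : ∀ Θ, 0 ≤ normalDensity v Θ X * f Θ := fun Θ =>
    mul_nonneg (normalDensity_pos hv Θ X).le (hf.nonneg Θ)
  refine lt_of_le_of_ne (integral_nonneg hnn) fun h => ?_
  have h0 := (integral_eq_zero_iff_of_nonneg hnn (hf.integrable v hv X)).mp h.symm
  obtain ⟨Θ, h1, h2⟩ := (h0.and hf.ae_pos).exists
  exact (mul_pos (normalDensity_pos hv Θ X) h2).ne' h1

theorem marginal_le (hf : IsHeatDecreasing f) {v : ℝ} (hv : 0 < v) (W X : Mat r q) :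
    marginal f v W ≤
      2 ^ (((r : ℝ) * q) / 2) * Real.exp (‖W - X‖ ^ 2 / (2 * v)) * marginal f (2 * v) X := by
  rw [marginal, marginal, ← integral_const_mul]
  refine integral_mono (hf.integrable v hv W) ((hf.integrable _ (by positivity) X).const_mul _)
    fun Θ => ?_
  simp only
  rw [← mul_assoc, normalDensity_comm v, normalDensity_comm (2 * v)]
  exact mul_le_mul_of_nonneg_right (normalDensity_le_mul hv W X Θ) (hf.nonneg Θ)

theorem exists_abs_log_marginal_le (hf : IsHeatDecreasing f) {v : ℝ} (hv : 0 < v) :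
    ∃ A, ∀ W, |Real.log (marginal f v W)| ≤ A + ‖W‖ ^ 2 / v := by
  set c : ℝ := 2 ^ (((r : ℝ) * q) / 2)
  have hc : 0 < c := by positivity
  have hv2 : 0 < v / 2 := by positivity
  refine ⟨max (Real.log (c * marginal f (2 * v) 0)) (-Real.log (marginal f (v / 2) 0 / c)),
    fun W => abs_le'.mpr ⟨?_, ?_⟩⟩
  · have h1 := Real.log_le_log (hf.marginal_pos hv W) (hf.marginal_le hv W 0)
    have hm := hf.marginal_pos (v := 2 * v) (by positivity) 0
    rw [mul_right_comm, Real.log_mul (mul_pos hc hm).ne' (Real.exp_ne_zero _), Real.log_exp,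
      sub_zero] at h1
    have h2 : ‖W‖ ^ 2 / (2 * v) ≤ ‖W‖ ^ 2 / v := by gcongr; linarith
    linarith [le_max_left (Real.log (c * marginal f (2 * v) 0))
      (-Real.log (marginal f (v / 2) 0 / c))]
  · have h1 := hf.marginal_le hv2 0 W
    rw [mul_div_cancel₀ v two_ne_zero, zero_sub, norm_neg] at h1
    have hm := hf.marginal_pos hv2 0
    have hmW := hf.marginal_pos hv W
    have h2 : marginal f (v / 2) 0 / c ≤ marginal f v W * Real.exp (‖W‖ ^ 2 / v) := by
      rw [div_le_iff₀ hc]; linarith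
    have h3 := Real.log_le_log (div_pos hm hc) h2
    rw [Real.log_mul hmW.ne' (Real.exp_ne_zero _), Real.log_exp] at h3
    linarith [le_max_right (Real.log (c * marginal f (2 * v) 0))
      (-Real.log (marginal f (v / 2) 0 / c))]

theorem _root_.MatrixPrediction.bayesPredictive_eq (f : Mat r q → ℝ) {vx vy : ℝ} (hvx : 0 < vx) (hvy : 0 < vy)
    (X Y : Mat r q) :
    bayesPredictive f vx vy X Y = normalDensity (vx + vy) X Y *
      (marginal f (vx * vy / (vx + vy)) ((vy / (vx + vy)) • X + (vx / (vx + vy)) • Y) /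
        marginal f vx X) := by
  rw [bayesPredictive, mul_div_assoc']
  congr 1
  simp_rw [normalDensity_mul hvx hvy, mul_assoc]
  exact integral_const_mul _ _

theorem bayesPredictive_pos (hf : IsHeatDecreasing f) {vx vy : ℝ} (hvx : 0 < vx) (hvy : 0 < vy)
    (X Y : Mat r q) : 0 < bayesPredictive f vx vy X Y := by
  rw [bayesPredictive_eq f hvx hvy]
  exact mul_pos (normalDensity_pos (by positivity) _ _)
    (div_pos (hf.marginal_pos (by positivity) _) (hf.marginal_pos hvx X))

theorem isPredictiveDensity (hf : IsHeatDecreasing f) {vx vy : ℝ} (hvx : 0 < vx) (hvy : 0 < vy) :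
    IsPredictiveDensity (bayesPredictive f vx vy) where
  measurable := by
    have h : Function.uncurry (bayesPredictive f vx vy) = fun z : Mat r q × Mat r q =>
        normalDensity (vx + vy) z.1 z.2 * (marginal f (vx * vy / (vx + vy))
          ((vy / (vx + vy)) • z.1 + (vx / (vx + vy)) • z.2) / marginal f vx z.1) := by
      ext z
      exact bayesPredictive_eq f hvx hvy z.1 z.2
    rw [h]
    exact (measurable_normalDensity_comp measurable_fst measurable_snd _).mul
      (((hf.measurable_marginal _).comp (by fun_prop)).div
        ((hf.measurable_marginal _).comp measurable_fst))
  nonneg X Y := (hf.bayesPredictive_pos hvx hvy X Y).le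
  lintegral_eq_one X := by
    have hm := hf.marginal_pos hvx X
    have hnn : ∀ Y Θ, 0 ≤ normalDensity vx Θ X * normalDensity vy Θ Y * f Θ := fun Y Θ =>
      mul_nonneg (mul_nonneg (normalDensity_pos hvx Θ X).le (normalDensity_pos hvy Θ Y).le)
        (hf.nonneg Θ)
    have hi : ∀ Y, Integrable fun Θ => normalDensity vx Θ X * normalDensity vy Θ Y * f Θ := by
      intro Y
      simp_rw [normalDensity_mul hvx hvy, mul_assoc]
      exact (hf.integrable _ (by positivity) _).const_mul _
    have h1 : ∀ Y, ENNReal.ofReal (bayesPredictive f vx vy X Y) =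
        ENNReal.ofReal (marginal f vx X)⁻¹ * ∫⁻ Θ, ENNReal.ofReal (normalDensity vx Θ X * f Θ) *
          ENNReal.ofReal (normalDensity vy Θ Y) := fun Y => by
      rw [bayesPredictive, div_eq_inv_mul, ENNReal.ofReal_mul (inv_nonneg.mpr hm.le),
        ofReal_integral_eq_lintegral_ofReal (hi Y) (ae_of_all _ (hnn Y))]
      congr 1
      refine lintegral_congr fun Θ => ?_
      rw [← ENNReal.ofReal_mul (mul_nonneg (normalDensity_pos hvx Θ X).le (hf.nonneg Θ)),
        mul_right_comm]
    have hmeas : Measurable fun z : Mat r q × Mat r q =>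
        ENNReal.ofReal (normalDensity vx z.2 X * f z.2) * ENNReal.ofReal (normalDensity vy z.2 z.1) :=
      (((measurable_normalDensity_comp measurable_snd measurable_const vx).mul
        (hf.measurable.comp measurable_snd)).ennreal_ofReal).mul
        (measurable_normalDensity_comp measurable_snd measurable_fst vy).ennreal_ofReal
    simp_rw [h1]
    rw [lintegral_const_mul' _ _ ENNReal.ofReal_ne_top, lintegral_lintegral_swap hmeas.aemeasurable]
    simp_rw [lintegral_const_mul' _ _ ENNReal.ofReal_ne_top, lintegral_normalDensity hvy, mul_one]
    rw [← ofReal_integral_eq_lintegral_ofReal (hf.integrable vx hvx X) (ae_of_all _ fun Θ =>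
      mul_nonneg (normalDensity_pos hvx Θ X).le (hf.nonneg Θ)), ← ENNReal.ofReal_mul
      (inv_nonneg.mpr hm.le)]
    change ENNReal.ofReal ((marginal f vx X)⁻¹ * marginal f vx X) = 1
    rw [inv_mul_cancel₀ hm.ne', ENNReal.ofReal_one]

theorem integrable_mul_log_bayesPredictive (hf : IsHeatDecreasing f) {vx vy : ℝ} (hvx : 0 < vx)
    (hvy : 0 < vy) (Θ X : Mat r q) :
    Integrable fun Y => normalDensity vy Θ Y *
      Real.log (normalDensity vy Θ Y / bayesPredictive f vx vy X Y) := by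
  have hw : 0 < vx + vy := add_pos hvx hvy
  set vw := vx * vy / (vx + vy) with hvw
  have hvw0 : 0 < vw := by positivity
  set a := vx / (vx + vy)
  set b := vy / (vx + vy)
  obtain ⟨A, hA⟩ := hf.exists_abs_log_marginal_le hvw0
  have hN := integrable_normalDensity hvy Θ
  have h2 := (normalDensity_second_moment hvy Θ 0).1
  simp only [sub_zero] at h2
  have hlog : Integrable fun Y => normalDensity vy Θ Y * Real.log (marginal f vw (b • X + a • Y)) := by
    refine ((hN.mul_const (A + 2 * ‖b • X‖ ^ 2 / vw)).add
      (h2.mul_const (2 * a ^ 2 / vw))).mono' ?_ (ae_of_all _ fun Y => ?_)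
    · exact ((continuous_normalDensity_right _ _).measurable.mul
        ((hf.measurable_marginal vw).comp (by fun_prop)).log).aestronglyMeasurable
    · have hNY := (normalDensity_pos hvy Θ Y).le
      rw [norm_mul, Real.norm_of_nonneg hNY, Real.norm_eq_abs]
      have h3 : ‖b • X + a • Y‖ ^ 2 ≤ 2 * ‖b • X‖ ^ 2 + 2 * a ^ 2 * ‖Y‖ ^ 2 := by
        have h4 := norm_add_le (b • X) (a • Y)
        have h5 : ‖a • Y‖ ^ 2 = a ^ 2 * ‖Y‖ ^ 2 := by
          rw [norm_smul, mul_pow, Real.norm_eq_abs, sq_abs]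
        nlinarith [norm_nonneg (b • X + a • Y), sq_nonneg (‖b • X‖ - ‖a • Y‖)]
      have h6 : |Real.log (marginal f vw (b • X + a • Y))| ≤
          A + (2 * ‖b • X‖ ^ 2 + 2 * a ^ 2 * ‖Y‖ ^ 2) / vw :=
        (hA _).trans (by gcongr)
      refine (mul_le_mul_of_nonneg_left h6 hNY).trans_eq ?_
      simp only [Pi.add_apply]
      ring
  have e : ∀ Y, normalDensity vy Θ Y * Real.log (normalDensity vy Θ Y / bayesPredictive f vx vy X Y) =
      normalDensity vy Θ Y * Real.log (normalDensity vy Θ Y / normalDensity (vx + vy) X Y) -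
        normalDensity vy Θ Y * Real.log (marginal f vw (b • X + a • Y)) +
        normalDensity vy Θ Y * Real.log (marginal f vx X) := fun Y => by
    have h3 := (normalDensity_pos hvy Θ Y).ne'
    have h4 := (normalDensity_pos hw X Y).ne'
    have h5 := (hf.marginal_pos hvw0 (b • X + a • Y)).ne'
    have h6 := (hf.marginal_pos hvx X).ne'
    rw [bayesPredictive_eq f hvx hvy, Real.log_div h3 (mul_ne_zero h4 (div_ne_zero h5 h6)),
      Real.log_mul h4 (div_ne_zero h5 h6), Real.log_div h5 h6, Real.log_div h3 h4]
    ring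
  simp_rw [e]
  exact ((integrable_mul_log_normalDensity_div hvy hw Θ X).1.sub hlog).add (hN.mul_const _)

theorem lintegral_marginal_ratio_le (hf : IsHeatDecreasing f) {vx vy : ℝ} (hvx : 0 < vx)
    (hvy : 0 < vy) (Θ : Mat r q) :
    ∫⁻ X, ENNReal.ofReal (normalDensity vx Θ X) * ∫⁻ Y, ENNReal.ofReal (normalDensity vy Θ Y *
      (normalDensity (vx + vy) X Y / bayesPredictive f vx vy X Y)) ≤ 1 := by
  have hw : 0 < vx + vy := add_pos hvx hvy
  set vw := vx * vy / (vx + vy) with hvw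
  have hvw0 : 0 < vw := by positivity
  set a := vx / (vx + vy) with ha
  have ha0 : 0 < a := by positivity
  have hm1 := (hf.measurable_marginal vx).ennreal_ofReal
  have hm2 := (hf.measurable_marginal vw).inv.ennreal_ofReal
  have hpt : ∀ X D, ENNReal.ofReal (normalDensity vx Θ X) *
      ENNReal.ofReal (normalDensity vy Θ (X + D) *
      (normalDensity (vx + vy) X (X + D) / bayesPredictive f vx vy X (X + D))) =
      ENNReal.ofReal (normalDensity vw Θ (X + a • D)) *
        ENNReal.ofReal (marginal f vw (X + a • D))⁻¹ *
        (ENNReal.ofReal (normalDensity (vx + vy) 0 D) * ENNReal.ofReal (marginal f vx X)) := by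
    intro X D
    have hW : (vy / (vx + vy)) • X + a • (X + D) = X + a • D := by
      rw [smul_add, ← add_assoc, ← add_smul, ha, ← add_div, add_comm vy, div_self hw.ne', one_smul]
    have h1 := normalDensity_mul hvx hvy Θ X (X + D)
    rw [hW, ← hvw] at h1
    have h2 := bayesPredictive_eq f hvx hvy X (X + D)
    rw [hW, ← hvw] at h2
    have h3 : normalDensity (vx + vy) X (X + D) = normalDensity (vx + vy) 0 D := by
      rw [normalDensity_eq_sub, add_sub_cancel_left]
    have p1 := normalDensity_pos hvx Θ X
    have p2 := normalDensity_pos hvw0 Θ (X + a • D)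
    have p3 := normalDensity_pos hw 0 D
    have p4 := hf.marginal_pos hvw0 (X + a • D)
    have p5 := hf.marginal_pos hvx X
    rw [h2, ← ENNReal.ofReal_mul p1.le, ← ENNReal.ofReal_mul p2.le, ← ENNReal.ofReal_mul p3.le,
      ← ENNReal.ofReal_mul (mul_nonneg p2.le (inv_nonneg.mpr p4.le)), ← mul_assoc, h1, h3]
    congr 1
    field_simp
  have hmeas : Measurable fun z : Mat r q × Mat r q =>
      ENNReal.ofReal (normalDensity vw Θ (z.1 + a • z.2)) *
        ENNReal.ofReal (marginal f vw (z.1 + a • z.2))⁻¹ *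
        (ENNReal.ofReal (normalDensity (vx + vy) 0 z.2) * ENNReal.ofReal (marginal f vx z.1)) :=
    ((measurable_normalDensity_comp measurable_const (by fun_prop) vw).ennreal_ofReal.mul
      (hm2.comp (f := fun z : Mat r q × Mat r q => z.1 + a • z.2) (by fun_prop))).mul
      ((measurable_normalDensity_comp measurable_const measurable_snd _).ennreal_ofReal.mul
        (hm1.comp measurable_fst))
  have hmeas' : Measurable fun z : Mat r q × Mat r q =>
      ENNReal.ofReal (normalDensity vw Θ z.2) * ENNReal.ofReal (marginal f vw z.2)⁻¹ *
        (ENNReal.ofReal (normalDensity (vx + vy) 0 z.1) *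
          ENNReal.ofReal (marginal f vx (z.2 - a • z.1))) :=
    ((measurable_normalDensity_comp measurable_const measurable_snd vw).ennreal_ofReal.mul
      (hm2.comp measurable_snd)).mul
      ((measurable_normalDensity_comp measurable_const measurable_fst _).ennreal_ofReal.mul
        (hm1.comp (f := fun z : Mat r q × Mat r q => z.2 - a • z.1) (by fun_prop)))
  calc _ = ∫⁻ X, ∫⁻ D, ENNReal.ofReal (normalDensity vw Θ (X + a • D)) *
        ENNReal.ofReal (marginal f vw (X + a • D))⁻¹ *
        (ENNReal.ofReal (normalDensity (vx + vy) 0 D) * ENNReal.ofReal (marginal f vx X)) := by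
        refine lintegral_congr fun X => ?_
        rw [← lintegral_const_mul' _ _ ENNReal.ofReal_ne_top, ← lintegral_add_left_eq_self _ X]
        exact lintegral_congr fun D => hpt X D
    _ = ∫⁻ D, ∫⁻ W, ENNReal.ofReal (normalDensity vw Θ W) *
        ENNReal.ofReal (marginal f vw W)⁻¹ * (ENNReal.ofReal (normalDensity (vx + vy) 0 D) *
          ENNReal.ofReal (marginal f vx (W - a • D))) := by
        rw [lintegral_lintegral_swap hmeas.aemeasurable]
        refine lintegral_congr fun D => ?_
        rw [← lintegral_sub_right_eq_self _ (a • D)]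
        simp_rw [sub_add_cancel]
    _ = ∫⁻ W, ENNReal.ofReal (normalDensity vw Θ W) * ENNReal.ofReal (marginal f vw W)⁻¹ *
        ENNReal.ofReal (marginal f (a ^ 2 * (vx + vy) + vx) W) := by
        rw [lintegral_lintegral_swap hmeas'.aemeasurable]
        refine lintegral_congr fun W => ?_
        rw [lintegral_const_mul' _ _
          (ENNReal.mul_ne_top ENNReal.ofReal_ne_top ENNReal.ofReal_ne_top)]
        simp_rw [hf.ofReal_marginal hvx]
        rw [lintegral_mul_lheat_shear hw hvx ha0 hf.measurable.ennreal_ofReal,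
          hf.ofReal_marginal (by positivity)]
    _ ≤ ∫⁻ W, ENNReal.ofReal (normalDensity vw Θ W) := by
        refine lintegral_mono fun W => ?_
        have hle : vw ≤ a ^ 2 * (vx + vy) + vx := by
          have : vw ≤ vx := by
            rw [hvw, div_le_iff₀ hw]; nlinarith
          have : 0 ≤ a ^ 2 * (vx + vy) := by positivity
          linarith
        have h1 := hf.marginal_anti vw _ hvw0 hle W
        have p4 := hf.marginal_pos hvw0 W
        simp only
        rw [mul_assoc, ← ENNReal.ofReal_mul (inv_nonneg.mpr p4.le)]
        refine mul_le_of_le_one_right' (ENNReal.ofReal_le_one.mpr ?_)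
        rw [inv_mul_le_iff₀ p4, mul_one]
        exact h1
    _ = 1 := lintegral_normalDensity hvw0 Θ

theorem klLoss_bayesPredictive_add_one_le (hf : IsHeatDecreasing f) {vx vy : ℝ} (hvx : 0 < vx)
    (hvy : 0 < vy) (Θ X : Mat r q) :
    klLoss vy Θ (bayesPredictive f vx vy X) + 1 ≤
      ENNReal.ofReal (gaussianKL r q vy (vx + vy) (‖X - Θ‖ ^ 2)) +
        ∫⁻ Y, ENNReal.ofReal (normalDensity vy Θ Y *
          (normalDensity (vx + vy) X Y / bayesPredictive f vx vy X Y)) := by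
  have hp := hf.isPredictiveDensity hvx hvy
  have hw : 0 < vx + vy := add_pos hvx hvy
  have h := klLoss_add_one_le hvy (hf.bayesPredictive_pos hvx hvy X) (hp.integrable X)
    (hp.integral_eq_one X) (hp.measurable_right X)
    (hf.integrable_mul_log_bayesPredictive hvx hvy Θ X)
    (g := normalDensity (vx + vy) X) (fun Y => (normalDensity_pos hw X Y).le)
    (continuous_normalDensity_right _ _).measurable
  rwa [klLoss_normalDensity hvy hw, norm_sub_rev] at h

theorem klRisk_bayesPredictive_le (hf : IsHeatDecreasing f) {vx vy : ℝ} (hvx : 0 < vx)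
    (hvy : 0 < vy) (Θ : Mat r q) :
    klRisk vx vy Θ (bayesPredictive f vx vy) ≤
      ENNReal.ofReal ((r : ℝ) * q / 2 * Real.log ((vy + vx) / vy)) := by
  obtain ⟨J, hJ⟩ : ∃ J : Mat r q → ℝ≥0∞, ∀ X, ∫⁻ Y, ENNReal.ofReal (normalDensity vy Θ Y *
    (normalDensity (vx + vy) X Y / bayesPredictive f vx vy X Y)) = J X := ⟨_, fun _ => rfl⟩
  have hratio := hf.lintegral_marginal_ratio_le hvx hvy Θ
  have hpt := hf.klLoss_bayesPredictive_add_one_le hvx hvy Θ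
  simp_rw [hJ] at hratio hpt
  simp_rw [add_comm vx vy] at hpt
  have hNm : Measurable fun X : Mat r q => ENNReal.ofReal (normalDensity vx Θ X) :=
    (continuous_normalDensity_right _ _).measurable.ennreal_ofReal
  have hKm : Measurable fun X : Mat r q =>
      ENNReal.ofReal (gaussianKL r q vy (vy + vx) (‖X - Θ‖ ^ 2)) :=
    (measurable_gaussianKL_comp _ _ (by fun_prop)).ennreal_ofReal
  have hNKm : Measurable fun X : Mat r q => ENNReal.ofReal (normalDensity vx Θ X) *
      ENNReal.ofReal (gaussianKL r q vy (vy + vx) (‖X - Θ‖ ^ 2)) := hNm.mul hKm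
  have h1 : ∫⁻ X, ENNReal.ofReal (normalDensity vx Θ X) *
      (klLoss vy Θ (bayesPredictive f vx vy X) + 1) =
        klRisk vx vy Θ (bayesPredictive f vx vy) + 1 := by
    simp_rw [mul_add, mul_one]
    rw [lintegral_add_right _ hNm, lintegral_normalDensity hvx, klRisk]
  have h2 : ∫⁻ X, (ENNReal.ofReal (normalDensity vx Θ X) *
      ENNReal.ofReal (gaussianKL r q vy (vy + vx) (‖X - Θ‖ ^ 2)) +
        ENNReal.ofReal (normalDensity vx Θ X) * J X) ≤
      ENNReal.ofReal ((r : ℝ) * q / 2 * Real.log ((vy + vx) / vy)) + 1 := by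
    rw [lintegral_add_left hNKm, lintegral_gaussianKL hvy hvx]
    exact add_le_add_right hratio _
  refine (ENNReal.add_le_add_iff_right ENNReal.one_ne_top).mp (h1.symm.trans_le (le_trans ?_ h2))
  refine lintegral_mono fun X => ?_
  simp only
  rw [← mul_add]
  exact mul_le_mul_right (hpt X) _

theorem isMinimax (hf : IsHeatDecreasing f) {vx vy : ℝ} (hvx : 0 < vx) (hvy : 0 < vy) :
    IsMinimax vx vy (bayesPredictive f vx vy) :=
  ⟨hf.isPredictiveDensity hvx hvy, fun _ hp' =>
    (iSup_le fun Θ => hf.klRisk_bayesPredictive_le hvx hvy Θ).trans (le_iSup_klRisk hvx hvy hp')⟩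

end IsHeatDecreasing

end MatrixPrediction

end

theorem mainTheorem6 (r q : ℕ) (hr : 1 ≤ r) (hrq : r ≤ q) (α : Fin r → ℝ)
    (hα_nonneg : ∀ i, 0 ≤ α i) (hα_anti : Antitone α)
    (hα_le : ∀ i : Fin r, α i ≤ ((q : ℝ) + (r : ℝ) - 2 * ((i : ℝ) + 1) - 1) / 2) :
    -- the prior is twice continuously differentiable where the eigenvalues are positive and distinct
    (∀ Θ : MatrixPrediction.Mat r q,
      (∀ i, 0 < MatrixPrediction.eig Θ i) → Function.Injective (MatrixPrediction.eig Θ) →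
        ContDiffAt ℝ 2 (MatrixPrediction.priorST α) Θ) ∧
    -- its Laplacian is nonpositive wherever it is twice continuously differentiable
    (∀ Θ : MatrixPrediction.Mat r q, ContDiffAt ℝ 2 (MatrixPrediction.priorST α) Θ →
      MatrixPrediction.laplacian (MatrixPrediction.priorST α) Θ ≤ 0) ∧
    -- it is superharmonic on the whole space in the sense of distributions
    MatrixPrediction.IsDistribSuperharmonic
      (MatrixPrediction.priorST α : MatrixPrediction.Mat r q → ℝ) ∧
    -- the marginal density is finite, and the Bayesian predictive density is minimax
    (∀ vx vy : ℝ, 0 < vx → 0 < vy →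
      (∀ X : MatrixPrediction.Mat r q, MeasureTheory.Integrable (fun Θ : MatrixPrediction.Mat r q =>
        MatrixPrediction.normalDensity vx Θ X * MatrixPrediction.priorST α Θ)) ∧
      MatrixPrediction.IsMinimax vx vy
        (MatrixPrediction.bayesPredictive (MatrixPrediction.priorST α : MatrixPrediction.Mat r q → ℝ)
          vx vy)) := by
  refine ⟨fun Θ hpos hinj => ?_, fun Θ hΘ => ?_, ?_, fun vx vy hvx hvy => ⟨fun X => ?_, ?_⟩⟩
  · rw [← MatrixPrediction.regPrior_zero]
    exact MatrixPrediction.HasSimpleSpectrum.contDiffAt_regPrior le_rfl α ⟨hpos, hinj⟩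
  · exact MatrixPrediction.laplacian_priorST_nonpos hrq hα_nonneg hα_anti hα_le hΘ
  · exact MatrixPrediction.isDistribSuperharmonic_priorST hrq hα_nonneg hα_anti hα_le
  · exact (MatrixPrediction.isHeatDecreasing_priorST hrq hα_nonneg hα_anti hα_le).integrable vx hvx X
  · exact (MatrixPrediction.isHeatDecreasing_priorST hrq hα_nonneg hα_anti hα_le).isMinimax hvx hvy
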